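/- **Setting.** Let $S_0,\Sigma_0,S_2,\Sigma_2\in\mathcal M_4(\mathbb R)$ be symmetric matrices and let $S_1(\cdot),\Sigma_1(\cdot):\mathbb R^4\to\mathcal M_4(\mathbb R)$ be linear maps whose values are symmetric matrices. Assume that $S_0$ is positive definite and that $S_0^{-1}\Sigma_0$ has four different non-zero eigenvalues $c_1,\dots,c_4$. Let $\mathbf e_1,\dots,\mathbf e_4$ be corresponding eigenvectors, orthonormal for $\langle u,v\rangle=u\cdot S_0v$, and set $$\lambda_i=\mathbf e_i\cdot(\Sigma_1(\mathbf e_i)-c_iS_1(\mathbf e_i))\mathbf e_i,\qquad \mu_i=\mathbf e_i\cdot(-\Sigma_2+c_iS_2)\mathbf e_i,$$ $$\alpha_{ijk}=\mathbf e_i\cdot(\Sigma_1(\mathbf e_k)-c_jS_1(\mathbf e_k))\mathbf e_j,\qquad \beta_{ij}=\mathbf e_i\cdot(\Sigma_2-c_jS_2)\mathbf e_j .$$ **Proposition.** There is a positive function $C_0(\cdot,\cdot)$, nondecreasing in each argument, such that the following holds for every such system, with $C_0=C_0(\|S_0\|,\|S_0^{-1}\|)$. Let $s>1/2$ and $U^0\in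 H^{s+2}(\mathbb R)^4$ (real-valued). 1. For each $i=1,\dots,4$ consider the Cauchy problem $$\partial_\tau u_i+\lambda_iu_i\partial_xu_i+\mu_i\partial_x^3u_i=0,\qquad u_i|_{\tau=0}=\mathbf e_i\cdot S_0U^0 .$$ A strong solution on $[0,T]$ is a function $u_i\in C^0([0,T];H^{s+2})\cap C^1([0,T];H^{s-1})$ which satisfies the equation in $H^{s-1}$ for all $\tau\in[0,T]$. On any interval $[0,T']$ there is at most one strong solution. Moreover there is $T>0$ such that for all $i$ the strong solution $u_i$ exists on $[0,T]$, and $$\sum_{i=1}^4|u_i|_{L^\infty([0,T];H^{s+2})}\le C_0\,|U^0|_{H^{s+2}} .$$ 2. With these $T$ and $u_i$, there is a function $U_1(\tau,t,x)\in\mathbb R^4$, continuous in $(\tau,t)\in[0,T]\times\mathbb R$ with values in $H^s(\mathbb R)^4$, with $|U_1(\tau,t,\cdot)|_{H^s}\le C(1+|t|)$ for some constant $C$ and all $(\tau,t)\in[0,T]\times\mathbb R$ (in particular $U_1\in L^\infty([0,T]\times[-R,R];H^s)$ for every $R>0$), with $U_1|_{\tau=t=0}=0$, and which is a strong solution (differentiable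 in $t$ with values in $H^{s-1}$, the equation holding in $H^{s-1}$ for all $\tau\in[0,T]$, $t\in\mathbb R$) of $$(\partial_t+c_i\partial_x)\langle\mathbf e_i,U_1\rangle+\sum_{(j,k)\ne(i,i)}\alpha_{ijk}\,u_k(\tau,x-c_kt)\,\partial_xu_j(\tau,x-c_jt)=\sum_{j\ne i}\beta_{ij}\,\partial_x^3u_j(\tau,x-c_jt),\qquad i=1,\dots,4 .$$ -/

import Mathlib

open MeasureTheory Filter Topology Set TemperedDistribution
open scoped ENNReal SchwartzMap LineDeriv Matrix

noncomputable section

namespace KdVApprox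

/-! ### Sobolev spaces on the real line -/

/-- Real-valued `L²` functions on the line (classes modulo a.e. equality). -/
abbrev L2 : Type := Lp ℝ 2 (volume : Measure ℝ)

/-- The tempered distribution defined by a real-valued `Lᵖ` function. -/
def toDist {p : ℝ≥0∞} [Fact (1 ≤ p)] (f : Lp ℝ p (volume : Measure ℝ)) : 𝓢'(ℝ, ℂ) :=
  ((Complex.ofRealCLM.compLp f : Lp ℂ p (volume : Measure ℝ)) : 𝓢'(ℝ, ℂ))

/-- The `Hʳ(ℝ)` norm of a tempered distribution, for any real order `r`: the `L²` norm of
`𝓕⁻¹ (1 + |ξ|²)^(r/2) 𝓕 f` if this is an `L²` function, and `∞` otherwise. -/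
def hNorm (r : ℝ) (f : 𝓢'(ℝ, ℂ)) : ℝ≥0∞ :=
  ⨅ (g : Lp ℂ 2 (volume : Measure ℝ)) (_ : besselPotential ℝ ℂ r f = g), ‖g‖ₑ

/-- A distribution has finite `Hʳ` norm exactly if it belongs to Mathlib's Sobolev space. -/
theorem hNorm_lt_top_iff (r : ℝ) (f : 𝓢'(ℝ, ℂ)) : hNorm r f < ⊤ ↔ MemSobolev r 2 f := by
  simp [hNorm, iInf_lt_iff, MemSobolev]

/-- The `Hʳ` norm of a vector-valued function `U = (U₁, …, U₄)`, that is
`(∑ⱼ |Uⱼ|²_{Hʳ})^{1/2}`. -/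
def hNormVec (r : ℝ) (U : Fin 4 → L2) : ℝ≥0∞ :=
  (∑ j, hNorm r (toDist (U j)) ^ (2 : ℝ)) ^ (1 / 2 : ℝ)

/-- `v ∈ C⁰(A; Hʳ)`. -/
def ContinuousInH {X : Type*} [TopologicalSpace X] (r : ℝ) (v : X → L2) (A : Set X) : Prop :=
  (∀ a ∈ A, MemSobolev r 2 (toDist (v a))) ∧
    ∀ a ∈ A, Tendsto (fun b => hNorm r (toDist (v b - v a))) (𝓝[A] a) (𝓝 0)

/-- The curve `v` has derivative `v'` at the time `t`, relative to the set of times `I`, the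
difference quotients converging in `Hʳ`. -/
def HasDerivInH (r : ℝ) (v : ℝ → L2) (v' : 𝓢'(ℝ, ℂ)) (I : Set ℝ) (t : ℝ) : Prop :=
  Tendsto (fun σ => hNorm r (toDist ((σ - t)⁻¹ • (v σ - v t)) - v')) (𝓝[I \ {t}] t) (𝓝 0)

/-- The distributional derivative `∂ₓ`. -/
def dx (f : 𝓢'(ℝ, ℂ)) : 𝓢'(ℝ, ℂ) := ∂_{(1 : ℝ)} f

open Classical in
/-- The weak derivative of `f` as an `L²` function (defined as `0` if `∂ₓ f` is not in `L²`). -/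
def weakDeriv (f : L2) : L2 :=
  if h : ∃ g : L2, toDist g = dx (toDist f) then h.choose else 0

/-- The pointwise product of two `L²` functions, which is an `L¹` function, as a tempered
distribution. -/
def mulDist (f g : L2) : 𝓢'(ℝ, ℂ) :=
  toDist (f • g : Lp ℝ 1 (volume : Measure ℝ))

/-- The translate `x ↦ f (x - a)`. -/
def transl (a : ℝ) (f : L2) : L2 :=
  Lp.compMeasurePreserving (fun x : ℝ => x - a) (measurePreserving_sub_right volume a) f

/-! ### The class of symmetric systems -/

/-- The coefficients of a system
`(S₀ + ε (S₁(U) - S₂ ∂ₓ²)) ∂ₜ U + (Σ₀ + ε (Σ₁(U) - Σ₂ ∂ₓ²)) ∂ₓ U = 0`, where all matrices are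
symmetric, `S₁(·)` and `Σ₁(·)` are linear, `S₀` is positive definite, and `S₀⁻¹ Σ₀` has four
different nonzero eigenvalues `c₁, …, c₄`. -/
structure SymmSystem where
  S0 : Matrix (Fin 4) (Fin 4) ℝ
  Sig0 : Matrix (Fin 4) (Fin 4) ℝ
  S2 : Matrix (Fin 4) (Fin 4) ℝ
  Sig2 : Matrix (Fin 4) (Fin 4) ℝ
  S1 : (Fin 4 → ℝ) →ₗ[ℝ] Matrix (Fin 4) (Fin 4) ℝ
  Sig1 : (Fin 4 → ℝ) →ₗ[ℝ] Matrix (Fin 4) (Fin 4) ℝ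
  S0_symm : S0.IsSymm
  Sig0_symm : Sig0.IsSymm
  S2_symm : S2.IsSymm
  Sig2_symm : Sig2.IsSymm
  S1_symm : ∀ U, (S1 U).IsSymm
  Sig1_symm : ∀ U, (Sig1 U).IsSymm
  S0_posDef : S0.PosDef
  c : Fin 4 → ℝ
  c_injective : Function.Injective c
  c_ne_zero : ∀ i, c i ≠ 0
  c_eigenvalue : ∀ i, Module.End.HasEigenvalue (Matrix.toLin' (S0⁻¹ * Sig0)) (c i)

/-- The operator norm of a matrix for the Euclidean norm. -/
def opNorm (A : Matrix (Fin 4) (Fin 4) ℝ) : ℝ := ‖Matrix.toEuclideanCLM (𝕜 := ℝ) A‖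

namespace SymmSystem

variable (P : SymmSystem)

/-- `e₁, …, e₄` are eigenvectors of `S₀⁻¹ Σ₀` for the eigenvalues `c₁, …, c₄`, orthonormal for the
scalar product `⟨u, v⟩ = u · S₀ v`. -/
def IsEigenbasis (e : Fin 4 → Fin 4 → ℝ) : Prop :=
  (∀ i, (P.S0⁻¹ * P.Sig0) *ᵥ e i = P.c i • e i) ∧
    ∀ i j, e i ⬝ᵥ (P.S0 *ᵥ e j) = if i = j then 1 else 0

/-- `⟨a, U⟩ = a · S₀ U` for a vector `a` and a vector-valued function `U`. -/
def pair (a : Fin 4 → ℝ) (U : Fin 4 → L2) : L2 :=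
  ∑ j, (a ᵥ* P.S0) j • U j

variable (e : Fin 4 → Fin 4 → ℝ)

/-- `λᵢ = eᵢ · (Σ₁(eᵢ) - cᵢ S₁(eᵢ)) eᵢ`. -/
def lam (i : Fin 4) : ℝ :=
  e i ⬝ᵥ ((P.Sig1 (e i) - P.c i • P.S1 (e i)) *ᵥ e i)

/-- `μᵢ = eᵢ · (-Σ₂ + cᵢ S₂) eᵢ`. -/
def mu (i : Fin 4) : ℝ :=
  e i ⬝ᵥ ((-P.Sig2 + P.c i • P.S2) *ᵥ e i)

/-- `αᵢⱼₖ = eᵢ · (Σ₁(eₖ) - cⱼ S₁(eₖ)) eⱼ`. -/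
def alpha (i j k : Fin 4) : ℝ :=
  e i ⬝ᵥ ((P.Sig1 (e k) - P.c j • P.S1 (e k)) *ᵥ e j)

/-- `βᵢⱼ = eᵢ · (Σ₂ - cⱼ S₂) eⱼ`. -/
def beta (i j : Fin 4) : ℝ :=
  e i ⬝ᵥ ((P.Sig2 - P.c j • P.S2) *ᵥ e j)

end SymmSystem

/-! ### Strong solutions -/

/-- `u` is a strong solution on `[0, T]` of the Cauchy problem
`∂_τ u + l u ∂ₓ u + m ∂ₓ³ u = 0`, `u(0) = u0`, at the regularity `Hʳ`: it belongs to
`C⁰([0, T]; Hʳ)`, and is differentiable in time with values in `Hʳ⁻³`, where the equation holds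
(so that it is in `C¹([0, T]; Hʳ⁻³)`, by the equation). -/
structure IsStrongKdVSolution (r l m T : ℝ) (u0 : L2) (u : ℝ → L2) : Prop where
  initial : u 0 = u0
  continuous : ContinuousInH r u (Icc 0 T)
  equation : ∀ τ ∈ Icc 0 T, HasDerivInH (r - 3) u
    (-((l : ℂ) • mulDist (u τ) (weakDeriv (u τ)) + (m : ℂ) • dx (dx (dx (toDist (u τ))))))
    (Icc 0 T) τ

/-- `U1 (τ, t)` is a strong solution, for `τ ∈ [0, T]` and `t ∈ ℝ`, of the corrector equations
`(∂ₜ + cᵢ ∂ₓ) ⟨eᵢ, U1⟩ + ∑_{(j,k) ≠ (i,i)} αᵢⱼₖ u_k(τ, x - c_k t) ∂ₓ u_j(τ, x - c_j t)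
  = ∑_{j ≠ i} βᵢⱼ ∂ₓ³ u_j(τ, x - c_j t)`
at the regularity `Hˢ`: it is continuous in `(τ, t)` with values in `Hˢ`, and differentiable in
`t` with values in `Hˢ⁻¹`, where the equations hold. -/
structure IsStrongCorrector (P : SymmSystem) (e : Fin 4 → Fin 4 → ℝ) (s T : ℝ)
    (u : Fin 4 → ℝ → L2) (U1 : ℝ → ℝ → Fin 4 → L2) : Prop where
  continuous : ∀ j, ContinuousInH s (fun q : ℝ × ℝ => U1 q.1 q.2 j) (Icc 0 T ×ˢ univ)
  equation : ∀ τ ∈ Icc 0 T, ∀ t : ℝ, ∀ i, HasDerivInH (s - 1) (fun t' => P.pair (e i) (U1 τ t'))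
    (-((P.c i : ℂ) • dx (toDist (P.pair (e i) (U1 τ t))))
      - (∑ j, ∑ k, if (j, k) ≠ (i, i) then
          (P.alpha e i j k : ℂ) • mulDist (transl (P.c k * t) (u k τ))
            (weakDeriv (transl (P.c j * t) (u j τ))) else 0)
      + ∑ j, if j ≠ i then
          (P.beta e i j : ℂ) • dx (dx (dx (toDist (transl (P.c j * t) (u j τ))))) else 0)
    univ t

end KdVApprox

end

/-! Everything is done on the Fourier side. A distribution in `Hʳ` is replaced by its transform `d`,
and its norm by the `L²` norm of `wgt r * d` (`HasFourier`, `IsHRep`). Real functions correspond to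
Hermitian transforms, products to convolutions, translations to multipliers of modulus 1. With κ =
8π³m and ν = πl the scalar equation becomes ∂_τ a = i(κξ³a − νξ a∗a). Its dispersive part is
multiplication by an imaginary function and contributes nothing to weighted energies.

Existence. Truncation to |ξ| ≤ n gives a locally Lipschitz vector field on `L²` which is orthogonal
to the position, so its solutions are global. The uniform estimate is a commutator estimate in
symbol form. By symmetry in the three interacting frequencies, the derivative of ∫W²|a|² only sees
the symbol (y+z)W(y+z)² − yW(y)² − zW(z)², and `IsWeight.symbol_le` bounds it by terms in which one
frequency carries the derivative and the other two carry W. Hence ‖Wa‖² grows at a rate at most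
C‖ξa‖_{L¹}, for every slowly growing weight W (`norm_integral_energy_le`). The truncated solutions
converge in `L²` at the rate 1/n (`norm_sub_le_of_isGalerkin`). Continuity in `Hʳ`, and not only
boundedness, is obtained from W = wgt r · ω, where ω tends to infinity so slowly that the initial
value stays in the weighted space (`exists_growing_weight`): continuity in `L²` and a bound for W
imply continuity for `wgt r`. Once the Lipschitz norm is bounded, the estimate for W = wgt r is
linear and costs a factor 2 on a short interval. This factor does not depend on s, and the remaining
part of C₀ comes from the pairing with eᵢ.

Uniqueness is the `L²` estimate of the difference of two solutions. Their time derivative exists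
only in `Hʳ⁻³`, so the energy is differentiated through the duality between `H³⁻ʳ` and `Hʳ⁻³`
(`hasDerivWithinAt_of_polarization`).

Corrector. In the basis e the system splits into four scalar transport equations. The quadratic
sources are bounded in `Hˢ`, and their Duhamel integrals grow at most linearly in t. The source
∂ₓ³uⱼ(x − cⱼt) lies only in `Hˢ⁻¹`; but as cⱼ ≠ cᵢ it is the image under ∂ₜ + cᵢ∂ₓ of (cᵢ −
cⱼ)⁻¹∂ₓ²uⱼ(x − cⱼt), which is bounded in `Hˢ`. -/

noncomputable section

namespace KdVApprox

open FourierTransform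

/-! ### Functions and distributions on the Fourier side -/

/-- Complex-valued `L²` functions on the line. -/
abbrev H : Type := Lp ℂ 2 (volume : Measure ℝ)

/-- The weight `(1 + ξ²)^(r/2)`. -/
def wgt (r ξ : ℝ) : ℝ := (1 + ξ ^ 2) ^ (r / 2)

theorem wgt_pos (r ξ : ℝ) : 0 < wgt r ξ := by unfold wgt; positivity

theorem wgt_add (r r' ξ : ℝ) : wgt (r + r') ξ = wgt r ξ * wgt r' ξ := by
  unfold wgt
  rw [← Real.rpow_add (by positivity)]
  ring_nf

@[simp] theorem wgt_zero (ξ : ℝ) : wgt 0 ξ = 1 := by simp [wgt]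

theorem wgt_neg_mul (r ξ : ℝ) : wgt (-r) ξ * wgt r ξ = 1 := by
  rw [← wgt_add]; simp

theorem wgt_mul_neg (r ξ : ℝ) : wgt r ξ * wgt (-r) ξ = 1 := by
  rw [← wgt_add]; simp

@[simp] theorem wgt_neg_arg (r ξ : ℝ) : wgt r (-ξ) = wgt r ξ := by simp [wgt]

theorem wgt_le_one {r : ℝ} (hr : r ≤ 0) (ξ : ℝ) : wgt r ξ ≤ 1 :=
  Real.rpow_le_one_of_one_le_of_nonpos (by nlinarith [sq_nonneg ξ]) (by linarith)

theorem one_le_wgt {r : ℝ} (hr : 0 ≤ r) (ξ : ℝ) : 1 ≤ wgt r ξ :=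
  Real.one_le_rpow (by nlinarith [sq_nonneg ξ]) (by linarith)

theorem wgt_mono {r r' : ℝ} (h : r ≤ r') (ξ : ℝ) : wgt r ξ ≤ wgt r' ξ :=
  Real.rpow_le_rpow_of_exponent_le (by nlinarith [sq_nonneg ξ]) (by linarith)

theorem hasTemperateGrowth_wgt (r : ℝ) :
    Function.HasTemperateGrowth (fun ξ : ℝ => (wgt r ξ : ℂ)) := by
  have := Function.hasTemperateGrowth_one_add_norm_sq_rpow ℝ (r / 2)
  have h : (fun ξ : ℝ => (wgt r ξ : ℂ)) = fun ξ : ℝ => (((1 + ‖ξ‖ ^ 2) ^ (r / 2) : ℝ) : ℂ) := by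
    ext ξ; simp [wgt]
  rw [h]
  fun_prop

theorem continuous_wgt (r : ℝ) : Continuous (wgt r) := by
  unfold wgt
  exact Continuous.rpow_const (by fun_prop) fun x => Or.inl (by positivity)

@[fun_prop]
theorem measurable_wgt (r : ℝ) : Measurable (wgt r) := (continuous_wgt r).measurable

theorem besselPotential_eq (r : ℝ) (D : 𝓢'(ℝ, ℂ)) :
    besselPotential ℝ ℂ r D = fourierMultiplierCLM ℂ (fun ξ : ℝ => (wgt r ξ : ℂ)) D := by
  simp [besselPotential, wgt]

/-- The Fourier transform of the distribution `D` is the function `d`, which is `L²` up to a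
polynomial weight. -/
structure HasFourier (D : 𝓢'(ℝ, ℂ)) (d : ℝ → ℂ) : Prop where
  growth : ∃ k : ℝ, MemLp (fun ξ => (wgt (-k) ξ : ℂ) * d ξ) 2 volume
  apply_fourier : ∀ φ : 𝓢(ℝ, ℂ), D (𝓕 φ) = ∫ ξ, φ ξ * d ξ

theorem memLp_wgt_mul_of_le {d : ℝ → ℂ} {r r' : ℝ} (h : r ≤ r')
    (hd : MemLp (fun ξ => (wgt r' ξ : ℂ) * d ξ) 2 volume) :
    MemLp (fun ξ => (wgt r ξ : ℂ) * d ξ) 2 volume := by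
  have hm : AEStronglyMeasurable (fun ξ => (wgt r ξ : ℂ) * d ξ) volume := by
    have : (fun ξ => (wgt r ξ : ℂ) * d ξ)
        = fun ξ => (wgt (r - r') ξ : ℂ) * ((wgt r' ξ : ℂ) * d ξ) := by
      ext ξ
      rw [← mul_assoc, ← Complex.ofReal_mul, ← wgt_add]; simp
    rw [this]
    exact ((by fun_prop : Measurable fun ξ => (wgt (r - r') ξ : ℂ)).aestronglyMeasurable).mul hd.1
  refine hd.of_le hm (ae_of_all _ fun ξ => ?_)
  simp only [norm_mul, Complex.norm_real, Real.norm_eq_abs, abs_of_pos (wgt_pos _ _)]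
  gcongr
  exact wgt_mono h ξ

theorem aestronglyMeasurable_of_wgt {d : ℝ → ℂ} {r : ℝ}
    (hd : AEStronglyMeasurable (fun ξ => (wgt r ξ : ℂ) * d ξ) volume) :
    AEStronglyMeasurable d volume := by
  have : d = fun ξ => (wgt (-r) ξ : ℂ) * ((wgt r ξ : ℂ) * d ξ) := by
    ext ξ
    rw [← mul_assoc, ← Complex.ofReal_mul, wgt_neg_mul]; simp
  rw [this]
  exact ((by fun_prop : Measurable fun ξ => (wgt (-r) ξ : ℂ)).aestronglyMeasurable).mul hd

/-- The weight is moved onto the Schwartz function: `wgt (-k) * φ` is again a Schwartz function,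
hence in `L²`, and Cauchy–Schwarz applies. -/
theorem integrable_schwartz_mul {d : ℝ → ℂ} {k : ℝ}
    (hd : MemLp (fun ξ => (wgt k ξ : ℂ) * d ξ) 2 volume) (φ : 𝓢(ℝ, ℂ)) :
    Integrable (fun ξ => φ ξ * d ξ) volume := by
  have h1 := (SchwartzMap.smulLeftCLM ℂ (fun ξ : ℝ => (wgt (-k) ξ : ℂ)) φ).memLp 2 volume
  refine (h1.integrable_mul hd).congr (ae_of_all _ fun ξ => ?_)
  simp only [Pi.mul_apply]
  rw [SchwartzMap.smulLeftCLM_apply_apply (hasTemperateGrowth_wgt _)]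
  have := wgt_neg_mul k ξ
  have h2 : (wgt (-k) ξ : ℂ) * wgt k ξ = 1 := by rw [← Complex.ofReal_mul, this]; simp
  simp only [smul_eq_mul]
  linear_combination (φ ξ * d ξ) * h2

/-- Both functions are brought under the smaller of the two weights, so that their weighted
difference is locally integrable. Testing with `φ = wgt m * g`, where `g` is smooth with compact
support, reduces the claim to the fundamental lemma of the calculus of variations. -/
theorem ae_eq_of_integral_schwartz {d d' : ℝ → ℂ} {k k' : ℝ}
    (hd : MemLp (fun ξ => (wgt k ξ : ℂ) * d ξ) 2 volume)
    (hd' : MemLp (fun ξ => (wgt k' ξ : ℂ) * d' ξ) 2 volume)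
    (h : ∀ φ : 𝓢(ℝ, ℂ), ∫ ξ, φ ξ * d ξ = ∫ ξ, φ ξ * d' ξ) : d =ᵐ[volume] d' := by
  obtain ⟨m, hm, hm'⟩ : ∃ m, m ≤ k ∧ m ≤ k' := ⟨min k k', min_le_left _ _, min_le_right _ _⟩
  have h1 := memLp_wgt_mul_of_le hm hd
  have h2 := memLp_wgt_mul_of_le hm' hd'
  have h3 : ∀ᵐ ξ ∂(volume : Measure ℝ), (wgt m ξ : ℂ) * (d ξ - d' ξ) = 0 := by
    apply ae_eq_zero_of_integral_contDiff_smul_eq_zero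
    · refine ((h1.sub h2).locallyIntegrable (by norm_num)).congr (ae_of_all _ fun ξ => ?_)
      simp [mul_sub]
    · intro g hg hc
      have hg₁ : HasCompactSupport (Complex.ofRealCLM ∘ g) := hc.comp_left rfl
      have hg₂ : ContDiff ℝ (⊤ : ℕ∞) (Complex.ofRealCLM ∘ g) := by fun_prop
      set φ := SchwartzMap.smulLeftCLM ℂ (fun ξ : ℝ => (wgt m ξ : ℂ)) (hg₁.toSchwartzMap hg₂)
      have hφ : ∀ ξ, φ ξ = wgt m ξ * g ξ := by
        intro ξ
        simp [φ, SchwartzMap.smulLeftCLM_apply_apply (hasTemperateGrowth_wgt m)]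
      have := h φ
      rw [← sub_eq_zero, ← integral_sub (integrable_schwartz_mul hd φ)
        (integrable_schwartz_mul hd' φ)] at this
      rw [← this]
      congr 1
      ext ξ
      simp only [hφ, Complex.real_smul]
      ring
  filter_upwards [h3] with ξ hξ
  have : (wgt m ξ : ℂ) ≠ 0 := by exact_mod_cast (wgt_pos m ξ).ne'
  simpa [this, sub_eq_zero] using hξ

namespace HasFourier

variable {D D' : 𝓢'(ℝ, ℂ)} {d d' : ℝ → ℂ}

theorem aestronglyMeasurable (h : HasFourier D d) : AEStronglyMeasurable d volume := by
  obtain ⟨k, hk⟩ := h.growth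
  exact aestronglyMeasurable_of_wgt hk.1

theorem integrable (h : HasFourier D d) (φ : 𝓢(ℝ, ℂ)) :
    Integrable (fun ξ => φ ξ * d ξ) volume := by
  obtain ⟨k, hk⟩ := h.growth
  exact integrable_schwartz_mul hk φ

theorem unique (h : HasFourier D d) (h' : HasFourier D d') : d =ᵐ[volume] d' := by
  obtain ⟨k, hk⟩ := h.growth
  obtain ⟨k', hk'⟩ := h'.growth
  exact ae_eq_of_integral_schwartz hk hk' fun φ => by rw [← h.2, ← h'.2]

theorem congr (h : HasFourier D d) (hd : d =ᵐ[volume] d') : HasFourier D d' := by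
  obtain ⟨k, hk⟩ := h.growth
  refine ⟨⟨k, hk.ae_eq ?_⟩, fun φ => ?_⟩
  · filter_upwards [hd] with ξ hξ
    rw [hξ]
  · rw [h.2]
    apply integral_congr_ae
    filter_upwards [hd] with ξ hξ
    rw [hξ]

theorem add (h : HasFourier D d) (h' : HasFourier D' d') :
    HasFourier (D + D') (fun ξ => d ξ + d' ξ) := by
  obtain ⟨k, hk⟩ := h.growth
  obtain ⟨k', hk'⟩ := h'.growth
  refine ⟨⟨max k k', ?_⟩, fun φ => ?_⟩
  · have h1 := memLp_wgt_mul_of_le (r := -(max k k')) (neg_le_neg (le_max_left _ _)) hk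
    have h2 := memLp_wgt_mul_of_le (r := -(max k k')) (neg_le_neg (le_max_right _ _)) hk'
    simpa [mul_add] using! h1.add h2
  · simp only [mul_add]
    rw [integral_add (h.integrable φ) (h'.integrable φ), ← h.2, ← h'.2]
    rfl

theorem const_smul (h : HasFourier D d) (c : ℂ) : HasFourier (c • D) (fun ξ => c * d ξ) := by
  obtain ⟨k, hk⟩ := h.growth
  refine ⟨⟨k, ?_⟩, fun φ => ?_⟩
  · refine (hk.const_mul c).ae_eq (ae_of_all _ fun ξ => ?_)
    ring
  · have : (c • D) (𝓕 φ) = c * D (𝓕 φ) := rfl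
    rw [this, h.2, ← integral_const_mul]
    congr 1
    ext ξ
    ring

theorem neg (h : HasFourier D d) : HasFourier (-D) (fun ξ => -d ξ) := by
  have h1 : -D = (-1 : ℂ) • D := by ext; simp
  rw [h1]
  simpa using h.const_smul (-1)

theorem sub (h : HasFourier D d) (h' : HasFourier D' d') :
    HasFourier (D - D') (fun ξ => d ξ - d' ξ) := by
  have := h.add h'.neg
  simpa [sub_eq_add_neg] using this

theorem zero : HasFourier 0 (fun _ => 0) := by
  refine ⟨⟨0, by simp⟩, fun φ => ?_⟩
  simp

theorem wgt_fourierMultiplier_apply (h : HasFourier D d) (r : ℝ) (φ : 𝓢(ℝ, ℂ)) :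
    besselPotential ℝ ℂ r D (𝓕 φ) = ∫ ξ, φ ξ * (wgt r ξ * d ξ) := by
  rw [besselPotential_eq, fourierMultiplierCLM_apply_apply, h.2]
  congr 1
  ext ξ
  rw [fourierInv_fourier_eq, SchwartzMap.smulLeftCLM_apply_apply (hasTemperateGrowth_wgt r)]
  simp only [smul_eq_mul]
  ring

theorem ofLp (g : H) : HasFourier (g : 𝓢'(ℝ, ℂ)) (𝓕 g : H) := by
  refine ⟨⟨0, ?_⟩, fun φ => ?_⟩
  · simpa using Lp.memLp (𝓕 g : H)
  · have h := congrArg (fun D : 𝓢'(ℝ, ℂ) => D φ) (Lp.fourier_toTemperedDistribution_eq g)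
    simpa using h

theorem besselPotential_eq_iff (h : HasFourier D d) (r : ℝ) (g : H) :
    besselPotential ℝ ℂ r D = g ↔ (𝓕 g : H) =ᵐ[volume] fun ξ => (wgt r ξ : ℂ) * d ξ := by
  obtain ⟨k, hk⟩ := h.growth
  constructor
  · intro hg
    -- The order `-k - r` undoes `wgt r` and leaves the known growth bound of order `-k`.
    refine ae_eq_of_integral_schwartz (k := 0) (k' := -k - r) (by simpa using Lp.memLp (𝓕 g : H))
      (hk.ae_eq (ae_of_all _ fun ξ => ?_)) fun φ => ?_
    · simp only
      rw [← mul_assoc, ← Complex.ofReal_mul, ← wgt_add]; simp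
    · rw [← h.wgt_fourierMultiplier_apply, hg, (ofLp g).2]
  · intro hg
    ext φ
    have hφ : φ = 𝓕 (𝓕⁻ φ) := (fourier_fourierInv_eq φ).symm
    rw [hφ, h.wgt_fourierMultiplier_apply, (ofLp g).2]
    apply integral_congr_ae
    filter_upwards [hg] with ξ hξ
    rw [hξ]

theorem memSobolev_iff (h : HasFourier D d) (r : ℝ) :
    MemSobolev r 2 D ↔ MemLp (fun ξ => (wgt r ξ : ℂ) * d ξ) 2 volume := by
  constructor
  · rintro ⟨g, hg⟩
    exact (Lp.memLp (𝓕 g : H)).ae_eq ((h.besselPotential_eq_iff r g).1 hg)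
  · intro hd
    refine ⟨𝓕⁻ (hd.toLp _ : H), (h.besselPotential_eq_iff r _).2 ?_⟩
    rw [fourier_fourierInv_eq]
    exact hd.coeFn_toLp

/-- By Plancherel every `g` in the infimum has the norm on the right. If there is no such `g`, the
infimum is `⊤`, and so is the right-hand side. -/
theorem hNorm_eq (h : HasFourier D d) (r : ℝ) :
    hNorm r D = eLpNorm (fun ξ => (wgt r ξ : ℂ) * d ξ) 2 volume := by
  have hm : AEStronglyMeasurable (fun ξ => (wgt r ξ : ℂ) * d ξ) volume :=
    ((by fun_prop : Measurable fun ξ => (wgt r ξ : ℂ)).aestronglyMeasurable).mul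
      h.aestronglyMeasurable
  have key : ∀ g : H, besselPotential ℝ ℂ r D = g →
      ‖g‖ₑ = eLpNorm (fun ξ => (wgt r ξ : ℂ) * d ξ) 2 volume := by
    intro g hg
    rw [← eLpNorm_congr_ae ((h.besselPotential_eq_iff r g).1 hg), ← Lp.enorm_def]
    rw [← ofReal_norm, ← ofReal_norm, Lp.norm_fourier_eq]
  by_cases hd : MemLp (fun ξ => (wgt r ξ : ℂ) * d ξ) 2 volume
  · obtain ⟨g, hg⟩ := (h.memSobolev_iff r).2 hd
    refine le_antisymm ?_ ?_
    · rw [← key g hg]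
      exact iInf₂_le g hg
    · exact le_iInf₂ fun g' hg' => (key g' hg').ge
  · have h1 : eLpNorm (fun ξ => (wgt r ξ : ℂ) * d ξ) 2 volume = ⊤ := by
      by_contra h2
      exact hd ⟨hm, lt_top_iff_ne_top.2 h2⟩
    rw [h1]
    refine le_antisymm le_top (le_iInf₂ fun g hg => ?_)
    exact absurd ((h.memSobolev_iff r).1 ⟨g, hg⟩) hd

theorem dx (h : HasFourier D d) :
    HasFourier (dx D) (fun ξ => 2 * Real.pi * Complex.I * ξ * d ξ) := by
  obtain ⟨k, hk⟩ := h.growth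
  -- A derivative costs one order of growth, because `|ξ| ≤ wgt 1 ξ`.
  refine ⟨⟨k + 1, ?_⟩, fun φ => ?_⟩
  · have hm : Measurable fun ξ : ℝ => (wgt (-1) ξ : ℂ) * (2 * Real.pi * Complex.I * ξ) := by
      fun_prop
    have heq : (fun ξ => (wgt (-(k + 1)) ξ : ℂ) * (2 * Real.pi * Complex.I * ξ * d ξ))
        = fun ξ => ((wgt (-1) ξ : ℂ) * (2 * Real.pi * Complex.I * ξ)) *
            ((wgt (-k) ξ : ℂ) * d ξ) := by
      ext ξ
      rw [show -(k + 1) = -1 + -k by ring, wgt_add]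
      push_cast
      ring
    rw [heq]
    refine MemLp.of_le_mul (c := 2 * Real.pi) hk (hm.aestronglyMeasurable.mul hk.1)
      (ae_of_all _ fun ξ => ?_)
    rw [norm_mul]
    gcongr
    simp only [norm_mul, Complex.norm_real, Complex.norm_I, Complex.norm_ofNat, Real.norm_eq_abs,
      abs_of_pos (wgt_pos _ _), abs_of_pos Real.pi_pos, mul_one]
    have : wgt (-1) ξ * |ξ| ≤ 1 := by
      have h2 : |ξ| ≤ wgt 1 ξ := by
        have : wgt 1 ξ = √(1 + ξ ^ 2) := by simp [wgt, Real.sqrt_eq_rpow]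
        rw [this]
        exact Real.abs_le_sqrt (by linarith)
      calc wgt (-1) ξ * |ξ| ≤ wgt (-1) ξ * wgt 1 ξ :=
            mul_le_mul_of_nonneg_left h2 (wgt_pos _ _).le
        _ = 1 := wgt_neg_mul 1 ξ
    nlinarith [Real.pi_pos]
  · have h1 : KdVApprox.dx D (𝓕 φ) = 𝓕 (∂_{(1 : ℝ)} D) φ := rfl
    rw [h1, TemperedDistribution.fourier_lineDerivOp_eq]
    have h2 : ((2 * Real.pi * Complex.I) • smulLeftCLM ℂ (fun x : ℝ => ((inner ℝ x 1 : ℝ) : ℂ)) (𝓕 D)) φ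
        = (2 * Real.pi * Complex.I) * D (𝓕 (SchwartzMap.smulLeftCLM ℂ
          (fun x : ℝ => ((inner ℝ x 1 : ℝ) : ℂ)) φ)) := rfl
    rw [h2, h.2, ← integral_const_mul]
    congr 1
    ext ξ
    rw [SchwartzMap.smulLeftCLM_apply_apply (by fun_prop)]
    simp
    ring

end HasFourier

end KdVApprox

end

/-! ### Calculus of convolutions and the Fourier transform of a product -/

noncomputable section

namespace KdVApprox

open FourierTransform

/-! ### Norms, convolutions and trilinear integrals -/

/-- The `L²` norm as a real number. -/
def n2 (f : ℝ → ℂ) : ℝ := (eLpNorm f 2 volume).toReal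

/-- The `L¹` norm as a real number. -/
def n1 (f : ℝ → ℂ) : ℝ := ∫ ξ, ‖f ξ‖

theorem n2_nonneg (f : ℝ → ℂ) : 0 ≤ n2 f := ENNReal.toReal_nonneg

theorem n1_nonneg (f : ℝ → ℂ) : 0 ≤ n1 f := integral_nonneg fun _ => norm_nonneg _

theorem norm_eq_n2 (a : H) : ‖a‖ = n2 a := Lp.norm_def a

theorem n2_congr {f g : ℝ → ℂ} (h : f =ᵐ[volume] g) : n2 f = n2 g := by
  rw [n2, n2, eLpNorm_congr_ae h]

theorem n2_le_of_norm_le {f g : ℝ → ℂ} (hg : MemLp g 2 volume)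
    (h : ∀ᵐ ξ, ‖f ξ‖ ≤ ‖g ξ‖) : n2 f ≤ n2 g :=
  ENNReal.toReal_mono hg.2.ne (eLpNorm_mono_ae h)

theorem n2_le_mul_of_norm_le {f g : ℝ → ℂ} {C : ℝ} (hC : 0 ≤ C) (hg : MemLp g 2 volume)
    (h : ∀ᵐ ξ, ‖f ξ‖ ≤ C * ‖g ξ‖) : n2 f ≤ C * n2 g := by
  have := eLpNorm_le_mul_eLpNorm_of_ae_le_mul h 2
  have h2 := ENNReal.toReal_mono (ENNReal.mul_ne_top ENNReal.ofReal_ne_top hg.2.ne) this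
  rwa [ENNReal.toReal_mul, ENNReal.toReal_ofReal hC] at h2

theorem n2_add_le {f g : ℝ → ℂ} (hf : MemLp f 2 volume) (hg : MemLp g 2 volume) :
    n2 (fun ξ => f ξ + g ξ) ≤ n2 f + n2 g := by
  have := ENNReal.toReal_mono (ENNReal.add_ne_top.2 ⟨hf.2.ne, hg.2.ne⟩)
    (eLpNorm_add_le hf.1 hg.1 (by norm_num : (1 : ℝ≥0∞) ≤ 2))
  rwa [ENNReal.toReal_add hf.2.ne hg.2.ne] at this

theorem n2_const_mul (c : ℂ) (f : ℝ → ℂ) : n2 (fun ξ => c * f ξ) = ‖c‖ * n2 f := by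
  have := eLpNorm_const_smul c f 2 volume
  have h2 := congrArg ENNReal.toReal this
  rw [ENNReal.toReal_mul] at h2
  simpa [n2] using! h2

theorem n2_neg (f : ℝ → ℂ) : n2 (fun ξ => -f ξ) = n2 f := by
  have := n2_const_mul (-1) f
  simpa using this

theorem n2_sub_le {f g : ℝ → ℂ} (hf : MemLp f 2 volume) (hg : MemLp g 2 volume) :
    n2 (fun ξ => f ξ - g ξ) ≤ n2 f + n2 g := by
  have := n2_add_le hf hg.neg
  simp only [Pi.neg_apply, ← sub_eq_add_neg] at this
  rwa [show n2 (-g) = n2 g from n2_neg g] at this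

theorem n2_sq {f : ℝ → ℂ} (hf : MemLp f 2 volume) : n2 f ^ 2 = ∫ ξ, ‖f ξ‖ ^ 2 := by
  have h := hf.eLpNorm_eq_integral_rpow_norm (by norm_num) (by norm_num)
  have h0 : 0 ≤ ∫ ξ, ‖f ξ‖ ^ 2 := integral_nonneg fun _ => by positivity
  simp only [ENNReal.toReal_ofNat, Real.rpow_two] at h
  rw [n2, h, ENNReal.toReal_ofReal (by positivity), ← Real.rpow_natCast, ← Real.rpow_mul h0]
  simp

theorem integral_norm_mul_le {f g : ℝ → ℂ} (hf : MemLp f 2 volume) (hg : MemLp g 2 volume) :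
    ∫ ξ, ‖f ξ‖ * ‖g ξ‖ ≤ n2 f * n2 g := by
  have h := integral_mul_norm_le_Lp_mul_Lq (μ := (volume : Measure ℝ)) (f := f) (g := g)
    Real.HolderConjugate.two_two (by simpa using hf) (by simpa using hg)
  simp only [Real.rpow_two] at h
  rw [← n2_sq hf, ← n2_sq hg] at h
  rwa [← Real.sqrt_eq_rpow, ← Real.sqrt_eq_rpow, Real.sqrt_sq (n2_nonneg _),
    Real.sqrt_sq (n2_nonneg _)] at h

theorem measurePreserving_const_sub (x : ℝ) :
    MeasurePreserving (fun y : ℝ => x - y) volume volume :=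
  Measure.measurePreserving_sub_left volume x

theorem memLp_const_sub {f : ℝ → ℂ} (hf : MemLp f 2 volume) (x : ℝ) :
    MemLp (fun y => f (x - y)) 2 volume :=
  hf.comp_measurePreserving (measurePreserving_const_sub x)

theorem n2_const_sub {f : ℝ → ℂ} (hf : MemLp f 2 volume) (x : ℝ) :
    n2 (fun y => f (x - y)) = n2 f := by
  have := eLpNorm_comp_measurePreserving (p := 2) hf.1 (measurePreserving_const_sub x)
  exact congrArg ENNReal.toReal this

theorem ae_const_sub {p : ℝ → Prop} (h : ∀ᵐ y, p y) (x : ℝ) : ∀ᵐ y, p (x - y) :=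
  (measurePreserving_const_sub x).quasiMeasurePreserving.ae h

theorem ae_neg {p : ℝ → Prop} (h : ∀ᵐ y, p y) : ∀ᵐ y, p (-y) :=
  (Measure.measurePreserving_neg (volume : Measure ℝ)).quasiMeasurePreserving.ae h

/-- The convolution of two functions on the line. -/
def conv (a b : ℝ → ℂ) (ξ : ℝ) : ℂ := ∫ η, a η * b (ξ - η)

theorem conv_congr {a a' b b' : ℝ → ℂ} (ha : a =ᵐ[volume] a') (hb : b =ᵐ[volume] b') :
    conv a b = conv a' b' := by
  ext ξ
  apply integral_congr_ae
  filter_upwards [ha, ae_const_sub hb ξ] with η h1 h2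
  rw [h1, h2]

theorem conv_comm (a b : ℝ → ℂ) : conv a b = conv b a := by
  ext ξ
  unfold conv
  rw [← integral_sub_left_eq_self _ volume ξ]
  congr 1
  ext η
  simp [mul_comm]

theorem integrable_conv {a b : ℝ → ℂ} (ha : MemLp a 2 volume) (hb : MemLp b 2 volume) (ξ : ℝ) :
    Integrable (fun η => a η * b (ξ - η)) volume :=
  ha.integrable_mul (memLp_const_sub hb ξ)

theorem norm_conv_le {a b : ℝ → ℂ} (ha : MemLp a 2 volume) (hb : MemLp b 2 volume) (ξ : ℝ) :
    ‖conv a b ξ‖ ≤ n2 a * n2 b := by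
  refine (norm_integral_le_integral_norm _).trans ?_
  simp only [norm_mul]
  rw [← n2_const_sub hb ξ]
  exact integral_norm_mul_le ha (memLp_const_sub hb ξ)

theorem conv_add_left {a a' b : ℝ → ℂ} (ha : MemLp a 2 volume) (ha' : MemLp a' 2 volume)
    (hb : MemLp b 2 volume) (ξ : ℝ) :
    conv (fun η => a η + a' η) b ξ = conv a b ξ + conv a' b ξ := by
  unfold conv
  rw [← integral_add (integrable_conv ha hb ξ) (integrable_conv ha' hb ξ)]
  simp [add_mul]

theorem conv_const_mul_left (c : ℂ) (a b : ℝ → ℂ) (ξ : ℝ) :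
    conv (fun η => c * a η) b ξ = c * conv a b ξ := by
  unfold conv
  rw [← integral_const_mul]
  simp [mul_assoc]

theorem conv_sub_left {a a' b : ℝ → ℂ} (ha : MemLp a 2 volume) (ha' : MemLp a' 2 volume)
    (hb : MemLp b 2 volume) (ξ : ℝ) :
    conv (fun η => a η - a' η) b ξ = conv a b ξ - conv a' b ξ := by
  unfold conv
  rw [← integral_sub (integrable_conv ha hb ξ) (integrable_conv ha' hb ξ)]
  simp [sub_mul]

theorem aestronglyMeasurable_conv_kernel {a b : ℝ → ℂ} (ha : AEStronglyMeasurable a volume)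
    (hb : AEStronglyMeasurable b volume) :
    AEStronglyMeasurable (fun p : ℝ × ℝ => a p.2 * b (p.1 - p.2)) (volume.prod volume) :=
  (ha.comp_quasiMeasurePreserving Measure.quasiMeasurePreserving_snd).mul
    (hb.comp_quasiMeasurePreserving (quasiMeasurePreserving_sub volume volume))

theorem aestronglyMeasurable_conv {a b : ℝ → ℂ} (ha : AEStronglyMeasurable a volume)
    (hb : AEStronglyMeasurable b volume) : AEStronglyMeasurable (conv a b) volume :=
  (aestronglyMeasurable_conv_kernel ha hb).integral_prod_right'

/-- The trilinear integrand `f(x) g(y) h(x - y)` is integrable for `f ∈ L¹` and `g, h ∈ L²`. -/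
theorem integrable_trilinear {f g h : ℝ → ℂ} (hf : Integrable f volume) (hg : MemLp g 2 volume)
    (hh : MemLp h 2 volume) :
    Integrable (fun p : ℝ × ℝ => f p.1 * (g p.2 * h (p.1 - p.2))) (volume.prod volume) := by
  have hm : AEStronglyMeasurable (fun p : ℝ × ℝ => f p.1 * (g p.2 * h (p.1 - p.2)))
      (volume.prod volume) :=
    (hf.1.comp_quasiMeasurePreserving Measure.quasiMeasurePreserving_fst).mul
      (aestronglyMeasurable_conv_kernel hg.1 hh.1)
  refine (integrable_prod_iff hm).2 ⟨ae_of_all _ fun x => (integrable_conv hg hh x).const_mul (f x), ?_⟩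
  refine (hf.norm.mul_const (n2 g * n2 h)).mono' hm.norm.integral_prod_right' ?_
  refine ae_of_all _ fun x => ?_
  rw [Real.norm_of_nonneg (integral_nonneg fun _ => norm_nonneg _)]
  simp only [norm_mul]
  rw [integral_const_mul]
  gcongr
  rw [← n2_const_sub hh x]
  exact integral_norm_mul_le hg (memLp_const_sub hh x)

theorem integral_mul_conv {f g h : ℝ → ℂ} (hf : Integrable f volume) (hg : MemLp g 2 volume)
    (hh : MemLp h 2 volume) :
    ∫ ξ, f ξ * conv g h ξ = ∫ η, g η * ∫ ξ, f ξ * h (ξ - η) := by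
  have h5 := integral_integral_swap (f := fun ξ η => f ξ * (g η * h (ξ - η)))
    (integrable_trilinear hf hg hh)
  simp only [integral_const_mul] at h5
  unfold conv
  rw [h5]
  congr 1
  ext η
  rw [← integral_const_mul]
  congr 1
  ext ξ
  ring

/-- Young's inequality `L¹ * L² ⊂ L²`. -/
theorem memLp_conv {a b : ℝ → ℂ} (ha : Integrable a volume) (ha2 : MemLp a 2 volume)
    (hb : MemLp b 2 volume) :
    MemLp (conv a b) 2 volume ∧ n2 (conv a b) ≤ n1 a * n2 b := by
  have hm := aestronglyMeasurable_conv ha2.1 hb.1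
  set A := ∫⁻ η, ‖a η‖ₑ with hA
  have hAtop : A ≠ ⊤ := ha.2.ne
  have hn1 : n1 a = A.toReal := by
    rw [n1, integral_norm_eq_lintegral_enorm ha.1]
  -- Cauchy–Schwarz with |a||b| split as |a|^{1/2} · (|a|^{1/2}|b|). Integration in ξ then produces
  -- the second factor `A`.
  have hpt : ∀ ξ, ‖conv a b ξ‖ₑ ^ 2 ≤ A * ∫⁻ η, ‖a η‖ₑ * ‖b (ξ - η)‖ₑ ^ 2 := by
    intro ξ
    have hbm : AEMeasurable (fun η => ‖b (ξ - η)‖ₑ) volume := (memLp_const_sub hb ξ).1.enorm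
    have ham : AEMeasurable (fun η => ‖a η‖ₑ ^ (1 / 2 : ℝ)) volume := ha.1.enorm.pow_const _
    have hcs := ENNReal.lintegral_mul_le_Lp_mul_Lq volume Real.HolderConjugate.two_two ham
      (ham.mul hbm)
    have h1 : ‖conv a b ξ‖ₑ ≤ ∫⁻ η, ((fun η => ‖a η‖ₑ ^ (1 / 2 : ℝ)) *
        ((fun η => ‖a η‖ₑ ^ (1 / 2 : ℝ)) * fun η => ‖b (ξ - η)‖ₑ)) η := by
      refine (enorm_integral_le_lintegral_enorm _).trans (le_of_eq ?_)
      congr 1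
      ext η
      simp only [Pi.mul_apply, enorm_mul]
      rw [← mul_assoc, ← ENNReal.rpow_add_of_nonneg _ _ (by norm_num) (by norm_num)]
      norm_num
    have h2 := h1.trans hcs
    have h3 : ‖conv a b ξ‖ₑ ^ 2 ≤ ((∫⁻ η, (‖a η‖ₑ ^ (1 / 2 : ℝ)) ^ (2 : ℝ)) ^ (1 / 2 : ℝ) *
        (∫⁻ η, (((fun η => ‖a η‖ₑ ^ (1 / 2 : ℝ)) * fun η => ‖b (ξ - η)‖ₑ) η) ^ (2 : ℝ))
          ^ (1 / 2 : ℝ)) ^ 2 := by gcongr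
    refine h3.trans (le_of_eq ?_)
    rw [mul_pow, ← ENNReal.rpow_natCast, ← ENNReal.rpow_natCast, ← ENNReal.rpow_mul,
      ← ENNReal.rpow_mul]
    simp only [Pi.mul_apply, ENNReal.mul_rpow_of_nonneg _ _ (by norm_num : (0 : ℝ) ≤ 2),
      ← ENNReal.rpow_mul]
    norm_num [hA]
  have hint : ∫⁻ ξ, ‖conv a b ξ‖ₑ ^ 2 ≤ A * (A * ∫⁻ ζ, ‖b ζ‖ₑ ^ 2) := by
    refine (lintegral_mono hpt).trans (le_of_eq ?_)
    rw [lintegral_const_mul' _ _ hAtop]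
    congr 1
    have hmeas : AEMeasurable (Function.uncurry fun ξ η => ‖a η‖ₑ * ‖b (ξ - η)‖ₑ ^ 2)
        (volume.prod volume) := by
      have h1 : AEMeasurable (fun p : ℝ × ℝ => ‖a p.2‖ₑ) (volume.prod volume) :=
        (ha.1.comp_quasiMeasurePreserving Measure.quasiMeasurePreserving_snd).enorm
      have h2 : AEMeasurable (fun p : ℝ × ℝ => ‖b (p.1 - p.2)‖ₑ) (volume.prod volume) :=
        (hb.1.comp_quasiMeasurePreserving (quasiMeasurePreserving_sub volume volume)).enorm
      exact h1.mul (h2.pow_const 2)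
    rw [lintegral_lintegral_swap hmeas]
    have : ∀ η : ℝ, ∫⁻ ξ, ‖a η‖ₑ * ‖b (ξ - η)‖ₑ ^ 2 = ‖a η‖ₑ * ∫⁻ ζ, ‖b ζ‖ₑ ^ 2 := by
      intro η
      rw [lintegral_const_mul' _ _ enorm_ne_top]
      congr 1
      exact lintegral_sub_right_eq_self (fun ζ => ‖b ζ‖ₑ ^ 2) η
    simp only [this]
    rw [lintegral_mul_const'' _ ha.1.enorm]
  have hsq : ∀ f : ℝ → ℂ, eLpNorm f 2 volume = (∫⁻ ξ, ‖f ξ‖ₑ ^ 2) ^ (1 / 2 : ℝ) := by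
    intro f
    rw [eLpNorm_eq_lintegral_rpow_enorm_toReal (by norm_num) (by norm_num)]
    simp
  have hfin : eLpNorm (conv a b) 2 volume ≤ A * eLpNorm b 2 volume := by
    rw [hsq, hsq]
    refine (ENNReal.rpow_le_rpow hint (by norm_num)).trans (le_of_eq ?_)
    rw [← mul_assoc, ENNReal.mul_rpow_of_nonneg _ _ (by norm_num), ← sq, ← ENNReal.rpow_natCast,
      ← ENNReal.rpow_mul]
    norm_num
  refine ⟨⟨hm, hfin.trans_lt (ENNReal.mul_lt_top hAtop.lt_top hb.2)⟩, ?_⟩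
  rw [hn1, n2, n2, ← ENNReal.toReal_mul]
  exact ENNReal.toReal_mono (ENNReal.mul_ne_top hAtop hb.2.ne) hfin

/-! ### The Fourier transform of real functions -/

/-- The Fourier transform of real `L²` functions. -/
def hat : L2 →ₗᵢ[ℝ] H where
  toLinearMap := ((Lp.fourierTransformₗᵢ ℝ ℂ).toLinearEquiv.toLinearMap.restrictScalars ℝ) ∘ₗ
    (Complex.ofRealCLM.compLpL 2 (volume : Measure ℝ)).toLinearMap
  norm_map' f := by
    have h1 : ‖(Lp.fourierTransformₗᵢ ℝ ℂ) (Complex.ofRealCLM.compLpL 2 (volume : Measure ℝ) f)‖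
        = ‖f‖ := by
      rw [LinearIsometryEquiv.norm_map, Lp.norm_def, Lp.norm_def]
      congr 1
      apply eLpNorm_congr_norm_ae
      filter_upwards [Complex.ofRealCLM.coeFn_compLpL (𝕜 := ℝ) f] with x hx
      rw [hx]
      simp
    exact h1

theorem hat_apply (f : L2) : hat f = 𝓕 (Complex.ofRealCLM.compLp f : H) := rfl

theorem hasFourier_toDist (f : L2) : HasFourier (toDist f) (hat f) := HasFourier.ofLp _

theorem memLp_hat (f : L2) : MemLp (hat f) 2 volume := Lp.memLp _

/-- A shift in frequency is a modulation in space. This serves both the convolution theorem and the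
symbol of translations in `hat_transl`. -/
theorem fourierInv_compSubConst_fourier_apply (g : 𝓢(ℝ, ℂ)) (η x : ℝ) :
    (𝓕⁻ (SchwartzMap.compSubConstCLM ℂ η (𝓕 g))) x = (Real.fourierChar (x * η) : ℂ) * g x := by
  have h1 : g x = ∫ v, Real.fourierChar (inner ℝ v x) • (𝓕 g) v := by
    rw [← Real.fourierInv_eq, ← SchwartzMap.fourierInv_coe, fourierInv_fourier_eq]
  rw [SchwartzMap.fourierInv_coe, Real.fourierInv_eq, h1]
  simp only [Circle.smul_def, smul_eq_mul]
  rw [← integral_const_mul]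
  refine Eq.trans ?_ (integral_sub_right_eq_self (fun v => (Real.fourierChar (x * η) : ℂ) *
    ((Real.fourierChar (inner ℝ v x) : ℂ) * (𝓕 g) v)) η)
  congr 1
  ext v
  rw [SchwartzMap.compSubConstCLM_apply, ← mul_assoc, ← Circle.coe_mul, ← AddChar.map_add_eq_mul]
  congr 3
  simp
  ring

/-- Parseval for `φ` and the shifted transform of `g`. The right-hand side is the inner integral
that remains when Fubini has isolated one factor of a convolution. -/
theorem fourierInv_mul_fourier_apply (φ g P : 𝓢(ℝ, ℂ)) (hP : ∀ x, P x = (𝓕 φ) x * g x) (η : ℝ) :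
    (𝓕⁻ P) η = ∫ ξ, φ ξ * (𝓕 g) (ξ - η) := by
  have h2 := SchwartzMap.integral_fourier_smul_eq φ
    (𝓕⁻ (SchwartzMap.compSubConstCLM ℂ η (𝓕 g)))
  rw [fourier_fourierInv_eq] at h2
  simp only [smul_eq_mul, SchwartzMap.compSubConstCLM_apply] at h2
  rw [← h2, SchwartzMap.fourierInv_coe, Real.fourierInv_eq]
  congr 1
  ext x
  rw [fourierInv_compSubConst_fourier_apply, hP]
  simp only [Circle.smul_def, smul_eq_mul, RCLike.inner_apply, conj_trivial]
  rw [mul_comm η x]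
  ring

/-- This lemma and the next show that the two sides of the convolution theorem are bounded linear
functionals of `g`, so that it suffices to prove it for Schwartz functions `g`. -/
theorem continuous_integral_fourier_mul_mul (f : H) (φ : 𝓢(ℝ, ℂ)) :
    Continuous fun g : H => ∫ x, (𝓕 φ) x * (f x * g x) := by
  have hb : ∃ C, ∀ x, ‖(𝓕 φ) x‖ ≤ C := by
    obtain ⟨C, hC⟩ := (𝓕 φ).decay 0 0
    exact ⟨C, fun x => by simpa using hC.2 x⟩
  obtain ⟨C, hC⟩ := hb
  have hC0 : 0 ≤ C := (norm_nonneg _).trans (hC 0)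
  have hLi : ∀ g : H, Integrable (fun x => (𝓕 φ) x * (f x * g x)) volume := fun g =>
    ((Lp.memLp f).integrable_mul (Lp.memLp g)).bdd_mul (𝓕 φ).continuous.aestronglyMeasurable
      (ae_of_all _ hC)
  refine (IsLinearMap.with_bound (𝕜 := ℂ) (M := C * ‖f‖) ⟨fun g g' => ?_, fun c g => ?_⟩
    fun g => ?_).continuous
  · rw [← integral_add (hLi g) (hLi g')]
    apply integral_congr_ae
    filter_upwards [Lp.coeFn_add g g'] with x hx
    rw [hx, Pi.add_apply]; ring
  · rw [smul_eq_mul, ← integral_const_mul]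
    apply integral_congr_ae
    filter_upwards [Lp.coeFn_smul c g] with x hx
    rw [hx, Pi.smul_apply, smul_eq_mul]; ring
  · refine (norm_integral_le_integral_norm _).trans ?_
    have h1 : ∫ x, ‖(𝓕 φ) x * (f x * g x)‖ ≤ ∫ x, C * (‖f x‖ * ‖g x‖) := by
      refine integral_mono_of_nonneg (ae_of_all _ fun x => norm_nonneg _) ?_
        (ae_of_all _ fun x => ?_)
      · have := ((Lp.memLp f).integrable_mul (Lp.memLp g)).norm
        simp only [Pi.mul_apply, norm_mul] at this
        exact this.const_mul C
      · simp only [norm_mul]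
        gcongr
        exact hC x
    refine h1.trans ?_
    rw [integral_const_mul, mul_assoc, norm_eq_n2, norm_eq_n2]
    gcongr
    exact integral_norm_mul_le (Lp.memLp f) (Lp.memLp g)

theorem continuous_integral_mul_conv (f : H) (φ : 𝓢(ℝ, ℂ)) :
    Continuous fun g : H => ∫ ξ, φ ξ * conv (𝓕 f : H) (𝓕 g : H) ξ := by
  have hφ := φ.integrable (μ := volume)
  have hRi : ∀ g : H, Integrable (fun ξ => φ ξ * conv (𝓕 f : H) (𝓕 g : H) ξ) volume := fun g => by
    have := hφ.mul_bdd (c := n2 (𝓕 f : H) * n2 (𝓕 g : H))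
      (aestronglyMeasurable_conv (Lp.memLp (𝓕 f : H)).1 (Lp.memLp (𝓕 g : H)).1)
      (ae_of_all _ (norm_conv_le (Lp.memLp _) (Lp.memLp _)))
    exact this
  have hadd : ∀ g g' : H, ∀ ξ, conv (𝓕 f : H) (𝓕 (g + g') : H) ξ
      = conv (𝓕 f : H) (𝓕 g : H) ξ + conv (𝓕 f : H) (𝓕 g' : H) ξ := by
    intro g g' ξ
    rw [FourierTransform.fourier_add, conv_congr (ae_eq_refl _) (Lp.coeFn_add _ _), conv_comm,
      conv_comm _ (𝓕 g : H), conv_comm _ (𝓕 g' : H)]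
    exact conv_add_left (Lp.memLp _) (Lp.memLp _) (Lp.memLp _) ξ
  have hsmul : ∀ (c : ℂ) (g : H), ∀ ξ, conv (𝓕 f : H) (𝓕 (c • g) : H) ξ
      = c * conv (𝓕 f : H) (𝓕 g : H) ξ := by
    intro c g ξ
    rw [FourierTransform.fourier_smul, conv_congr (ae_eq_refl _) (Lp.coeFn_smul _ _), conv_comm,
      conv_comm _ (𝓕 g : H)]
    exact conv_const_mul_left c _ _ ξ
  refine (IsLinearMap.with_bound (𝕜 := ℂ) (M := (∫ ξ, ‖φ ξ‖) * ‖f‖)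
    ⟨fun g g' => ?_, fun c g => ?_⟩ fun g => ?_).continuous
  · rw [← integral_add (hRi g) (hRi g')]
    congr 1
    ext ξ
    rw [hadd]; ring
  · rw [smul_eq_mul, ← integral_const_mul]
    congr 1
    ext ξ
    rw [hsmul]; ring
  · refine (norm_integral_le_integral_norm _).trans ?_
    rw [mul_assoc, ← integral_mul_const]
    refine integral_mono_of_nonneg (ae_of_all _ fun x => norm_nonneg _)
      (hφ.norm.mul_const _) (ae_of_all _ fun ξ => ?_)
    simp only [norm_mul]
    gcongr
    refine (norm_conv_le (Lp.memLp _) (Lp.memLp _) ξ).trans (le_of_eq ?_)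
    rw [← norm_eq_n2, ← norm_eq_n2, Lp.norm_fourier_eq, Lp.norm_fourier_eq]

/-- For a Schwartz function `g` the product `𝓕 φ * g` is a Schwartz function `P`, and the integral
is the distribution `f` tested with `P = 𝓕 (𝓕⁻ P)`. -/
theorem integral_fourier_mul_mul_schwartz (f : H) (g φ : 𝓢(ℝ, ℂ)) :
    ∫ x, (𝓕 φ) x * (f x * g x) = ∫ ξ, φ ξ * conv (𝓕 f : H) (𝓕 g : 𝓢(ℝ, ℂ)) ξ := by
  set P : 𝓢(ℝ, ℂ) := SchwartzMap.pairing (ContinuousLinearMap.mul ℂ ℂ) (𝓕 φ) g with hP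
  have hPx : ∀ x, P x = (𝓕 φ) x * g x := fun x => by
    simp [hP]
  have hψ := fourierInv_mul_fourier_apply φ g P hPx
  have h3 := (HasFourier.ofLp f).2 (𝓕⁻ P)
  rw [fourier_fourierInv_eq, Lp.toTemperedDistribution_apply] at h3
  have h4 : ∫ x, (𝓕 φ) x * (f x * g x) = ∫ x, P x • f x := by
    congr 1
    ext x
    rw [hPx, smul_eq_mul]
    ring
  rw [h4, h3, integral_mul_conv (φ.integrable (μ := volume)) (Lp.memLp _) ((𝓕 g).memLp 2 volume)]
  congr 1
  ext η
  rw [hψ, mul_comm]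

/-- The Fourier transform turns products into convolutions. -/
theorem integral_fourier_mul_mul (f g : H) (φ : 𝓢(ℝ, ℂ)) :
    ∫ x, (𝓕 φ) x * (f x * g x) = ∫ ξ, φ ξ * conv (𝓕 f : H) (𝓕 g : H) ξ := by
  refine DenseRange.induction_on (p := fun g : H => ∫ x, (𝓕 φ) x * (f x * g x)
    = ∫ ξ, φ ξ * conv (𝓕 f : H) (𝓕 g : H) ξ)
    (SchwartzMap.denseRange_toLpCLM (F := ℂ) (p := 2) ENNReal.ofNat_ne_top) g
    (isClosed_eq (continuous_integral_fourier_mul_mul f φ)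
      (continuous_integral_mul_conv f φ)) fun g => ?_
  have hg : ((SchwartzMap.toLpCLM ℝ ℂ 2 volume g : H) : ℝ → ℂ) =ᵐ[volume] g :=
    g.coeFn_toLp 2 volume
  have hgh : ((𝓕 (SchwartzMap.toLpCLM ℝ ℂ 2 volume g : H) : H) : ℝ → ℂ) =ᵐ[volume]
      (𝓕 g : 𝓢(ℝ, ℂ)) := by
    have : (𝓕 (SchwartzMap.toLpCLM ℝ ℂ 2 volume g : H) : H) = (𝓕 g).toLp 2 := by
      exact SchwartzMap.toLp_fourier_eq g
    rw [this]
    exact (𝓕 g).coeFn_toLp 2 volume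
  rw [conv_congr (ae_eq_refl _) hgh]
  rw [← integral_fourier_mul_mul_schwartz]
  apply integral_congr_ae
  filter_upwards [hg] with x hx
  rw [hx]

/-- The condition `1 / 2 < r` is the integrability of (1 + ξ²)^(-r) on the line. The threshold of
the Sobolev embedding enters here. -/
theorem memLp_wgt_neg {r : ℝ} (hr : 1 / 2 < r) :
    MemLp (fun ξ => (wgt (-r) ξ : ℂ)) 2 volume := by
  have hm : Measurable fun ξ => (wgt (-r) ξ : ℂ) := by fun_prop
  refine (memLp_two_iff_integrable_sq_norm hm.aestronglyMeasurable).2 ?_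
  have h := integrable_rpow_neg_one_add_norm_sq (E := ℝ) (μ := volume) (r := 2 * r)
    (by simp; linarith)
  refine h.congr (ae_of_all _ fun ξ => ?_)
  simp only [Complex.norm_real, Real.norm_eq_abs, sq_abs]
  rw [sq (wgt _ _), ← wgt_add, wgt]
  ring_nf

theorem hasFourier_mulDist (f g : L2) : HasFourier (mulDist f g) (conv (hat f) (hat g)) := by
  refine ⟨⟨1, ?_⟩, fun φ => ?_⟩
  -- The convolution of two `L²` functions is bounded, and a weight of order below -1/2 makes a
  -- bounded function square-integrable.
  · refine MemLp.of_le_mul (c := n2 (hat f) * n2 (hat g)) (memLp_wgt_neg (r := 1) (by norm_num))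
      ((by fun_prop : Measurable fun ξ => (wgt (-1) ξ : ℂ)).aestronglyMeasurable.mul
        (aestronglyMeasurable_conv (memLp_hat f).1 (memLp_hat g).1)) (ae_of_all _ fun ξ => ?_)
    rw [norm_mul, mul_comm]
    gcongr
    exact norm_conv_le (memLp_hat f) (memLp_hat g) ξ
  · rw [hat_apply, hat_apply, ← integral_fourier_mul_mul]
    rw [mulDist, toDist, Lp.toTemperedDistribution_apply]
    apply integral_congr_ae
    filter_upwards [Complex.ofRealCLM.coeFn_compLp (𝕜 := ℝ) f,
      Complex.ofRealCLM.coeFn_compLp (𝕜 := ℝ) g,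
      Complex.ofRealCLM.coeFn_compLp (𝕜 := ℝ) (f • g : Lp ℝ 1 (volume : Measure ℝ)),
      Lp.coeFn_lpSMul (r := 1) f g] with x h1 h2 h3 h4
    rw [h1, h2, h3, h4]
    simp

end KdVApprox

end

noncomputable section

namespace KdVApprox

open FourierTransform

/-! ### Hermitian functions and real inverse Fourier transforms -/

open ComplexConjugate in
/-- Hermitian functions are the Fourier transforms of real functions. -/
def Herm (a : ℝ → ℂ) : Prop := ∀ᵐ ξ, a (-ξ) = conj (a ξ)

/-- Complex conjugation of `L²` functions. -/
def conjL : H →L[ℝ] H := Complex.conjCLE.toContinuousLinearMap.compLpL 2 volume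

/-- Reflection of `L²` functions. -/
def reflL : H →ₗᵢ[ℂ] H :=
  Lp.compMeasurePreservingₗᵢ ℂ Neg.neg (Measure.measurePreserving_neg (volume : Measure ℝ))

open ComplexConjugate in
theorem conjL_coe (g : H) : conjL g =ᵐ[volume] fun x => conj (g x) := by
  filter_upwards [Complex.conjCLE.toContinuousLinearMap.coeFn_compLpL (𝕜 := ℝ) (p := 2) g] with x hx
  rw [conjL, hx]
  simp

theorem reflL_coe (g : H) : reflL g =ᵐ[volume] fun x => g (-x) :=
  Lp.coeFn_compMeasurePreserving g (Measure.measurePreserving_neg (volume : Measure ℝ))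

open ComplexConjugate in
theorem fourier_conj_apply (g : 𝓢(ℝ, ℂ)) (ξ : ℝ) :
    𝓕 (fun x => conj (g x)) ξ = conj ((𝓕 g) (-ξ)) := by
  rw [SchwartzMap.fourier_coe, Real.fourier_eq, Real.fourier_eq, ← integral_conj]
  congr 1
  ext x
  simp only [Circle.smul_def, smul_eq_mul, map_mul]
  congr 1
  rw [← Circle.coe_inv_eq_conj, ← AddChar.map_neg_eq_inv]
  congr 2
  simp

theorem fourier_conjL (g : H) : 𝓕 (conjL g) = conjL (reflL (𝓕 g)) := by
  refine DenseRange.induction_on (p := fun g : H => 𝓕 (conjL g) = conjL (reflL (𝓕 g)))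
    (SchwartzMap.denseRange_toLpCLM (F := ℂ) (p := 2) ENNReal.ofNat_ne_top) g
    (isClosed_eq ?_ ?_) fun g => ?_
  · exact (Lp.fourierTransformₗᵢ ℝ ℂ).continuous.comp conjL.continuous
  · exact conjL.continuous.comp (reflL.continuous.comp (Lp.fourierTransformₗᵢ ℝ ℂ).continuous)
  · set gc : 𝓢(ℝ, ℂ) := SchwartzMap.postcompCLM Complex.conjCLE.toContinuousLinearMap g with hgc
    have h1 : conjL (SchwartzMap.toLpCLM ℝ ℂ 2 volume g : H) = gc.toLp 2 volume := by
      apply Lp.ext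
      filter_upwards [conjL_coe (SchwartzMap.toLpCLM ℝ ℂ 2 volume g : H), g.coeFn_toLp 2 volume,
        gc.coeFn_toLp 2 volume] with x h1 h2 h3
      rw [h1, h3, SchwartzMap.toLpCLM_apply, h2]
      rfl
    have h2 : (𝓕 (SchwartzMap.toLpCLM ℝ ℂ 2 volume g : H) : H) = (𝓕 g).toLp 2 :=
      SchwartzMap.toLp_fourier_eq g
    rw [h1, h2, SchwartzMap.toLp_fourier_eq]
    apply Lp.ext
    filter_upwards [conjL_coe (reflL ((𝓕 g).toLp 2 volume : H)),
      reflL_coe ((𝓕 g).toLp 2 volume : H), ae_neg ((𝓕 g).coeFn_toLp 2 volume),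
      (𝓕 gc).coeFn_toLp 2 volume] with x h1 h2 h3 h4
    rw [h1, h2, h3, h4, ← fourier_conj_apply, SchwartzMap.fourier_coe]
    rfl

-- Hermitian functions are the fixed points of a continuous real-linear map. Hence the property
-- passes to `L²` limits and to vector-valued integrals.
open ComplexConjugate in
theorem herm_iff (a : H) : Herm a ↔ conjL (reflL a) = a := by
  have h : conjL (reflL a) =ᵐ[volume] fun ξ => conj (a (-ξ)) := by
    filter_upwards [conjL_coe (reflL a), reflL_coe a] with ξ h1 h2
    rw [h1, h2]
  constructor
  · intro ha
    apply Lp.ext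
    filter_upwards [h, ha] with ξ h1 h2
    rw [h1, h2]
    simp
  · intro ha
    rw [ha] at h
    filter_upwards [h] with ξ h1
    rw [h1]
    simp

theorem herm_hat (f : L2) : Herm (hat f) := by
  rw [herm_iff, hat_apply, ← fourier_conjL]
  congr 1
  apply Lp.ext
  filter_upwards [conjL_coe (Complex.ofRealCLM.compLp f : H),
    Complex.ofRealCLM.coeFn_compLp (𝕜 := ℝ) f] with x h1 h2
  rw [h1, h2]
  simp

/-- The real part of the inverse Fourier transform. -/
def ofHat : H →L[ℝ] L2 :=
  (Complex.reCLM.compLpL 2 volume) ∘L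
    ((Lp.fourierTransformₗᵢ ℝ ℂ).symm.toContinuousLinearEquiv.toContinuousLinearMap.restrictScalars
      ℝ)

/-- Injectivity of the Fourier transform turns the symmetry of `a` into reality of its inverse
transform, so that taking the real part loses nothing. -/
theorem hat_ofHat {a : H} (ha : Herm a) : hat (ofHat a) = a := by
  set g : H := 𝓕⁻ a with hg
  have hga : 𝓕 g = a := fourier_fourierInv_eq a
  have h1 : conjL g = g := by
    have : 𝓕 (conjL g) = 𝓕 g := by
      rw [fourier_conjL, hga]
      exact (herm_iff a).1 ha
    exact (Lp.fourierTransformₗᵢ ℝ ℂ).injective this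
  have h2 : ofHat a = Complex.reCLM.compLpL 2 volume g := rfl
  rw [hat_apply, h2]
  refine Eq.trans ?_ hga
  congr 1
  apply Lp.ext
  have h3 := conjL_coe g
  rw [h1] at h3
  filter_upwards [Complex.ofRealCLM.coeFn_compLp (𝕜 := ℝ) (Complex.reCLM.compLpL 2 volume g),
    Complex.reCLM.coeFn_compLpL (𝕜 := ℝ) g, h3] with x h1 h2 h3
  rw [h1, h2]
  simp only [Complex.reCLM_apply, Complex.ofRealCLM_apply]
  exact (Complex.conj_eq_iff_re.1 h3.symm)

namespace Herm

open ComplexConjugate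

variable {a b : ℝ → ℂ}

theorem congr (ha : Herm a) (h : a =ᵐ[volume] b) : Herm b := by
  filter_upwards [ha, h, ae_neg h] with ξ h1 h2 h3
  rw [← h3, ← h2, h1]

theorem add (ha : Herm a) (hb : Herm b) : Herm (fun ξ => a ξ + b ξ) := by
  filter_upwards [ha, hb] with ξ h1 h2
  rw [h1, h2, map_add]

theorem sub (ha : Herm a) (hb : Herm b) : Herm (fun ξ => a ξ - b ξ) := by
  filter_upwards [ha, hb] with ξ h1 h2
  rw [h1, h2, map_sub]

theorem mul (ha : Herm a) (hb : Herm b) : Herm (fun ξ => a ξ * b ξ) := by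
  filter_upwards [ha, hb] with ξ h1 h2
  rw [h1, h2, map_mul]

theorem conv (ha : Herm a) (hb : Herm b) : Herm (conv a b) := by
  refine ae_of_all _ fun ξ => ?_
  unfold KdVApprox.conv
  rw [← integral_conj, ← integral_neg_eq_self]
  apply integral_congr_ae
  filter_upwards [ha, ae_const_sub hb ξ] with η h1 h2
  rw [h1, map_mul, ← h2]
  congr 2
  ring

theorem ofReal_of_even {m : ℝ → ℝ} (hm : ∀ ξ, m (-ξ) = m ξ) : Herm (fun ξ => (m ξ : ℂ)) :=
  ae_of_all _ fun ξ => by simp [hm]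

theorem I_mul_of_odd {m : ℝ → ℝ} (hm : ∀ ξ, m (-ξ) = -m ξ) : Herm (fun ξ => Complex.I * m ξ) :=
  ae_of_all _ fun ξ => by simp [hm]

theorem wgt (r : ℝ) : Herm (fun ξ => (wgt r ξ : ℂ)) := ofReal_of_even (wgt_neg_arg r)

theorem derivSymbol : Herm (fun ξ => 2 * Real.pi * Complex.I * ξ) :=
  ae_of_all _ fun ξ => by simp [Complex.conj_ofNat]

end Herm

/-! ### Weak derivatives and translations on the Fourier side -/

/-- The class of an `L²` function (and `0` for other functions). -/
def toH (f : ℝ → ℂ) : H := open Classical in if h : MemLp f 2 volume then h.toLp f else 0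

theorem toH_coe {f : ℝ → ℂ} (h : MemLp f 2 volume) : toH f =ᵐ[volume] f := by
  rw [toH, dif_pos h]
  exact h.coeFn_toLp

theorem norm_toH {f : ℝ → ℂ} (h : MemLp f 2 volume) : ‖toH f‖ = n2 f := by
  rw [norm_eq_n2, n2_congr (toH_coe h)]

theorem toH_congr {f g : ℝ → ℂ} (h : f =ᵐ[volume] g) : toH f = toH g := by
  by_cases hf : MemLp f 2 volume
  · exact Lp.ext ((toH_coe hf).trans (h.trans (toH_coe (hf.ae_eq h)).symm))
  · have hg : ¬ MemLp g 2 volume := fun hg => hf (hg.ae_eq h.symm)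
    rw [toH, toH, dif_neg hf, dif_neg hg]

theorem eq_toH {a : H} {f : ℝ → ℂ} (h : a =ᵐ[volume] f) : a = toH f :=
  Lp.ext (h.trans (toH_coe ((Lp.memLp a).ae_eq h)).symm)

theorem toH_sub {f g : ℝ → ℂ} (hf : MemLp f 2 volume) (hg : MemLp g 2 volume) :
    toH f - toH g = toH (fun ξ => f ξ - g ξ) := by
  apply eq_toH
  filter_upwards [Lp.coeFn_sub (toH f) (toH g), toH_coe hf, toH_coe hg] with ξ h1 h2 h3
  rw [h1, Pi.sub_apply, h2, h3]

theorem toH_add {f g : ℝ → ℂ} (hf : MemLp f 2 volume) (hg : MemLp g 2 volume) :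
    toH f + toH g = toH (fun ξ => f ξ + g ξ) := by
  apply eq_toH
  filter_upwards [Lp.coeFn_add (toH f) (toH g), toH_coe hf, toH_coe hg] with ξ h1 h2 h3
  rw [h1, Pi.add_apply, h2, h3]

theorem smul_toH (c : ℂ) {f : ℝ → ℂ} (hf : MemLp f 2 volume) :
    c • toH f = toH (fun ξ => c * f ξ) := by
  apply eq_toH
  filter_upwards [Lp.coeFn_smul c (toH f), toH_coe hf] with ξ h1 h2
  rw [h1, Pi.smul_apply, h2, smul_eq_mul]

theorem hat_ofHat_toH {f : ℝ → ℂ} (hf : MemLp f 2 volume) (h : Herm f) :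
    hat (ofHat (toH f)) =ᵐ[volume] f := by
  rw [hat_ofHat (h.congr (toH_coe hf).symm)]
  exact toH_coe hf

/-- The inverse transform of 2πiξ times `hat f` is real by Hermitian symmetry and shows that the
weak derivative exists in `L²`. The function selected by `weakDeriv` has the same transform by
uniqueness. -/
theorem hat_weakDeriv {f : L2}
    (hf : MemLp (fun ξ => 2 * Real.pi * Complex.I * ξ * hat f ξ) 2 volume) :
    hat (weakDeriv f) =ᵐ[volume] fun ξ => 2 * Real.pi * Complex.I * ξ * hat f ξ := by
  have hex : ∃ g : L2, toDist g = dx (toDist f) := by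
    have h1 := hat_ofHat_toH hf (Herm.derivSymbol.mul (herm_hat f))
    refine ⟨ofHat (toH fun ξ => 2 * Real.pi * Complex.I * ξ * hat f ξ), ?_⟩
    ext φ
    have hφ : φ = 𝓕 (𝓕⁻ φ) := (fourier_fourierInv_eq φ).symm
    rw [hφ, (hasFourier_toDist _).2, (hasFourier_toDist f).dx.2]
    apply integral_congr_ae
    filter_upwards [h1] with ξ h
    rw [h]
  have h2 : toDist (weakDeriv f) = dx (toDist f) := by
    rw [weakDeriv, dif_pos hex]
    exact hex.choose_spec
  have h3 := hasFourier_toDist (weakDeriv f)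
  rw [h2] at h3
  exact h3.unique (hasFourier_toDist f).dx

/-- The symbol `exp (-2 π i c ξ)` of the translation by `c`. -/
def ph (c ξ : ℝ) : ℂ := Complex.exp (-(2 * Real.pi * Complex.I * c * ξ))

theorem norm_ph (c ξ : ℝ) : ‖ph c ξ‖ = 1 := by
  have : -(2 * Real.pi * Complex.I * c * ξ) = ((-(2 * Real.pi * c * ξ) : ℝ) : ℂ) * Complex.I := by
    push_cast; ring
  rw [ph, this, Complex.norm_exp_ofReal_mul_I]

theorem ph_add (c c' ξ : ℝ) : ph (c + c') ξ = ph c ξ * ph c' ξ := by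
  rw [ph, ph, ph, ← Complex.exp_add]
  congr 1
  push_cast
  ring

@[simp] theorem ph_zero (ξ : ℝ) : ph 0 ξ = 1 := by simp [ph]

theorem continuous_ph (c : ℝ) : Continuous (ph c) := by unfold ph; fun_prop

theorem Herm.ph (c : ℝ) : Herm (ph c) :=
  ae_of_all _ fun ξ => by
    rw [KdVApprox.ph, KdVApprox.ph, ← Complex.exp_conj]
    simp [Complex.conj_ofNat]

theorem ph_eq_fourierChar (c ξ : ℝ) : ph c ξ = Real.fourierChar (ξ * -c) := by
  rw [ph, Real.fourierChar_apply]
  congr 1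
  push_cast
  ring

theorem hat_transl (c : ℝ) (f : L2) :
    hat (transl c f) =ᵐ[volume] fun ξ => ph c ξ * hat f ξ := by
  have hm : MemLp (fun ξ => ph c ξ * hat f ξ) 2 volume :=
    (memLp_hat f).of_le ((continuous_ph c).aestronglyMeasurable.mul (memLp_hat f).1)
      (ae_of_all _ fun ξ => by rw [norm_mul, norm_ph, one_mul])
  refine ae_eq_of_integral_schwartz (k := 0) (k' := 0) (by simpa using memLp_hat _)
    (by simpa using hm) fun φ => ?_
  rw [← (hasFourier_toDist (transl c f)).2]
  have h1 := (hasFourier_toDist f).2 (𝓕⁻ (SchwartzMap.compSubConstCLM ℂ (-c) (𝓕 φ)))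
  rw [fourier_fourierInv_eq] at h1
  simp only [fourierInv_compSubConst_fourier_apply, ← ph_eq_fourierChar] at h1
  have h2 : ∫ ξ, φ ξ * (ph c ξ * hat f ξ) = ∫ ξ, ph c ξ * φ ξ * hat f ξ := by
    congr 1; ext ξ; ring
  rw [h2, ← h1, toDist, toDist, Lp.toTemperedDistribution_apply, Lp.toTemperedDistribution_apply,
    ← integral_sub_right_eq_self (fun x => _ • (Complex.ofRealCLM.compLp f : H) x) c]
  have hf := (measurePreserving_sub_right (volume : Measure ℝ) c).quasiMeasurePreserving.ae
    (Complex.ofRealCLM.coeFn_compLp (𝕜 := ℝ) f)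
  apply integral_congr_ae
  filter_upwards [hf, Complex.ofRealCLM.coeFn_compLp (𝕜 := ℝ) (transl c f),
    Lp.coeFn_compMeasurePreserving f (measurePreserving_sub_right (volume : Measure ℝ) c)]
    with x h1 h2 h3
  rw [h1, h2, SchwartzMap.compSubConstCLM_apply, transl, h3]
  simp

end KdVApprox

end

/-! ### Commutator estimates in symbol form -/

noncomputable section

namespace KdVApprox

open ComplexConjugate

/-! ### Slowly varying weights -/

/-- Even weights `W ≥ 1`, nondecreasing on the half line, such that `x⁻ᴺ W(x)` is nonincreasing. -/
structure IsWeight (W : ℝ → ℝ) (N : ℕ) : Prop where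
  measurable : Measurable W
  one_le : ∀ x, 1 ≤ W x
  even : ∀ x, W (-x) = W x
  mono : ∀ {b a}, 0 ≤ b → b ≤ a → W b ≤ W a
  slow : ∀ {b a}, 0 ≤ b → b ≤ a → b ^ N * W a ≤ a ^ N * W b

theorem pow_succ_sub_pow_succ_le {a b : ℝ} (hb : 0 ≤ b) (hab : b ≤ a) (m : ℕ) :
    a ^ (m + 1) - b ^ (m + 1) ≤ (m + 1) * (a - b) * a ^ m := by
  induction m with
  | zero => simp
  | succ m ih =>
    have h1 : b ^ (m + 1) ≤ a ^ (m + 1) := by gcongr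
    have h2 : a ^ (m + 1 + 1) - b ^ (m + 1 + 1)
        = a * (a ^ (m + 1) - b ^ (m + 1)) + b ^ (m + 1) * (a - b) := by ring
    rw [h2]
    have h3 : a * (a ^ (m + 1) - b ^ (m + 1)) ≤ a * ((m + 1) * (a - b) * a ^ m) :=
      mul_le_mul_of_nonneg_left ih (hb.trans hab)
    have h4 : b ^ (m + 1) * (a - b) ≤ a ^ (m + 1) * (a - b) :=
      mul_le_mul_of_nonneg_right h1 (by linarith)
    push_cast
    calc _ ≤ a * ((m + 1) * (a - b) * a ^ m) + a ^ (m + 1) * (a - b) := add_le_add h3 h4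
      _ = _ := by ring

namespace IsWeight

variable {W : ℝ → ℝ} {N : ℕ}

theorem pos (hW : IsWeight W N) (x : ℝ) : 0 < W x := zero_lt_one.trans_le (hW.one_le x)

theorem mul {W' : ℝ → ℝ} {N' : ℕ} (hW : IsWeight W N) (hW' : IsWeight W' N') :
    IsWeight (fun x => W x * W' x) (N + N') where
  measurable := hW.measurable.mul hW'.measurable
  one_le x := one_le_mul_of_one_le_of_one_le (hW.one_le x) (hW'.one_le x)
  even x := by rw [hW.even, hW'.even]
  mono hb hab := mul_le_mul (hW.mono hb hab) (hW'.mono hb hab) (hW'.pos _).le (hW.pos _).le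
  slow {b a} hb hab := by
    have h1 := hW.slow hb hab
    have h2 := hW'.slow hb hab
    have ha := hb.trans hab
    calc b ^ (N + N') * (W a * W' a) = (b ^ N * W a) * (b ^ N' * W' a) := by ring
      _ ≤ (a ^ N * W b) * (a ^ N' * W' b) :=
        mul_le_mul h1 h2 (mul_nonneg (by positivity) (hW'.pos _).le)
          (mul_nonneg (by positivity) (hW.pos _).le)
      _ = _ := by ring

theorem wgt {r : ℝ} (hr : 0 ≤ r) : IsWeight (wgt r) ⌈r⌉₊ where
  measurable := measurable_wgt r
  one_le := one_le_wgt hr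
  even := wgt_neg_arg r
  mono hb hab := by
    unfold KdVApprox.wgt
    gcongr
  slow {b a} hb hab := by
    rcases hb.eq_or_lt with rfl | hb
    · rcases hr.eq_or_lt with rfl | hr
      · simp
      · rw [zero_pow (by simpa using hr)]
        have := wgt_pos r 0
        have : 0 ≤ a := hab
        simp
        positivity
    · have ha := hb.trans_le hab
      have h1 : b ^ r * KdVApprox.wgt r a ≤ a ^ r * KdVApprox.wgt r b := by
        have hb2 : b ^ r = (b ^ 2) ^ (r / 2) := by
          rw [← Real.rpow_natCast, ← Real.rpow_mul hb.le]; congr 1; push_cast; ring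
        have ha2 : a ^ r = (a ^ 2) ^ (r / 2) := by
          rw [← Real.rpow_natCast, ← Real.rpow_mul ha.le]; congr 1; push_cast; ring
        rw [hb2, ha2, KdVApprox.wgt, KdVApprox.wgt, ← Real.mul_rpow (by positivity) (by positivity),
          ← Real.mul_rpow (by positivity) (by positivity)]
        apply Real.rpow_le_rpow (by positivity) _ (by positivity)
        nlinarith
      -- The natural decay exponent is the real number `r`. To reach the integer `⌈r⌉₊` both sides
      -- are multiplied by x^m, which is nondecreasing.
      set m : ℝ := (⌈r⌉₊ : ℝ) - r with hm
      have hm0 : 0 ≤ m := by rw [hm]; linarith [Nat.le_ceil r]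
      have hb3 : b ^ ⌈r⌉₊ = b ^ m * b ^ r := by
        rw [← Real.rpow_add hb, hm, sub_add_cancel, Real.rpow_natCast]
      have ha3 : a ^ ⌈r⌉₊ = a ^ m * a ^ r := by
        rw [← Real.rpow_add ha, hm, sub_add_cancel, Real.rpow_natCast]
      rw [hb3, ha3, mul_assoc, mul_assoc]
      have := wgt_pos r a
      exact mul_le_mul (Real.rpow_le_rpow hb.le hab hm0) h1 (by positivity) (by positivity)

/-- The constant in the commutator estimate. -/
def const (N : ℕ) : ℝ := (2 * N + 1) * 2 ^ N + 1

theorem const_pos (N : ℕ) : 0 < const N := by unfold const; positivity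

/-- Here `c` is the smallest of the three frequencies and has to carry the derivative. Since x^(-2N)
W(x)² is nonincreasing, the increment of x W(x)² from b to a = b + c is controlled by that of
x^(2N+1), which gives a multiple of c W(a)². As a ≤ 2b, one has W(a) ≤ 2^N W(b), so that one factor
W(a) can be exchanged for W(b). The term c W(c)² is smaller because W is nondecreasing. -/
theorem symbol_ordered (hW : IsWeight W N) {b c : ℝ} (hc : 0 ≤ c) (hcb : c ≤ b) :
    |(b + c) * W (b + c) ^ 2 - b * W b ^ 2 - c * W c ^ 2|
      ≤ const N * (c * (W (b + c) * W b)) := by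
  have hb : 0 ≤ b := hc.trans hcb
  rcases hb.eq_or_lt with hb0 | hb0
  · have hc0 : c = 0 := le_antisymm (hb0 ▸ hcb) hc
    subst hc0
    simp
  set a := b + c with ha
  have hba : b ≤ a := by linarith
  have ha0 : 0 < a := by linarith
  have hWa := hW.pos a
  have hWb := hW.pos b
  have hWc := hW.pos c
  have h1 := hW.slow hb hba
  have h2 : W a ≤ 2 ^ N * W b := by
    have : b ^ N * W a ≤ b ^ N * (2 ^ N * W b) := by
      refine h1.trans ?_
      rw [← mul_assoc, ← mul_pow]
      gcongr
      linarith
    exact le_of_mul_le_mul_left this (by positivity)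
  have h3 : a * W a ^ 2 - b * W b ^ 2 ≤ (2 * N + 1) * c * W a ^ 2 := by
    have h4 : b ^ (2 * N) * W a ^ 2 ≤ a ^ (2 * N) * W b ^ 2 := by
      have := pow_le_pow_left₀ (by positivity) h1 2
      calc _ = (b ^ N * W a) ^ 2 := by ring
        _ ≤ _ := this
        _ = _ := by ring
    have h5 := pow_succ_sub_pow_succ_le hb hba (2 * N)
    have h6 : a ^ (2 * N) * (a * W a ^ 2 - b * W b ^ 2)
        ≤ a ^ (2 * N) * ((2 * N + 1) * c * W a ^ 2) := by
      calc a ^ (2 * N) * (a * W a ^ 2 - b * W b ^ 2)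
          = a ^ (2 * N + 1) * W a ^ 2 - b * (a ^ (2 * N) * W b ^ 2) := by ring
        _ ≤ a ^ (2 * N + 1) * W a ^ 2 - b * (b ^ (2 * N) * W a ^ 2) := by gcongr
        _ = (a ^ (2 * N + 1) - b ^ (2 * N + 1)) * W a ^ 2 := by ring
        _ ≤ ((((2 * N : ℕ) : ℝ) + 1) * (a - b) * a ^ (2 * N)) * W a ^ 2 := by gcongr
        _ = _ := by
          rw [ha]
          push_cast
          ring
    exact le_of_mul_le_mul_left h6 (by positivity)
  have h7 : W c ≤ W b := hW.mono hc hcb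
  have h8 : W c ≤ W a := hW.mono hc (by linarith)
  have h9 : W b ≤ W a := hW.mono hb hba
  have h10 : c * W c ^ 2 ≤ c * (W a * W b) := by
    gcongr
    nlinarith
  have h11 : W a ^ 2 ≤ 2 ^ N * (W a * W b) := by nlinarith
  have h12 : (2 * N + 1) * c * W a ^ 2 ≤ (2 * N + 1) * c * (2 ^ N * (W a * W b)) := by gcongr
  have h13 : b * W b ^ 2 ≤ a * W a ^ 2 := by gcongr
  have h14 : 0 ≤ c * W c ^ 2 := by positivity
  have h15 : 0 ≤ (2 * N + 1) * c * (2 ^ N * (W a * W b)) := by positivity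
  have h16 : 0 ≤ c * (W a * W b) := by positivity
  rw [abs_le]
  unfold const
  constructor <;> nlinarith

theorem symbol_nonneg (hW : IsWeight W N) {b c : ℝ} (hb : 0 ≤ b) (hc : 0 ≤ c) :
    |(b + c) * W (b + c) ^ 2 - b * W b ^ 2 - c * W c ^ 2|
      ≤ const N * (c * (W (b + c) * W b) + b * (W (b + c) * W c)) := by
  have hK := const_pos N
  have hWa := hW.pos (b + c)
  have hWb := hW.pos b
  have hWc := hW.pos c
  rcases le_total c b with h | h
  · refine (hW.symbol_ordered hc h).trans ?_
    gcongr
    have : 0 ≤ b * (W (b + c) * W c) := by positivity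
    linarith
  · have := hW.symbol_ordered hb h
    rw [add_comm c b] at this
    rw [sub_right_comm]
    refine this.trans ?_
    gcongr
    have : 0 ≤ c * (W (b + c) * W b) := by positivity
    linarith

/-- The symmetrized symbol of the commutator gains one derivative on the smallest frequency. -/
theorem symbol_le (hW : IsWeight W N) (y z : ℝ) :
    |(y + z) * W (y + z) ^ 2 - y * W y ^ 2 - z * W z ^ 2|
      ≤ const N * (|y| * (W (y + z) * W z) + |z| * (W (y + z) * W y)
        + |y + z| * (W y * W z)) := by
  have hK := const_pos N
  have key : ∀ b c : ℝ, 0 ≤ b → 0 ≤ c →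
      |(b + c) * W (b + c) ^ 2 - b * W b ^ 2 - c * W c ^ 2|
      ≤ const N * (b * (W (b + c) * W c) + c * (W (b + c) * W b) + (b + c) * (W b * W c)) := by
    intro b c hb hc
    refine (hW.symbol_nonneg hb hc).trans (mul_le_mul_of_nonneg_left ?_ hK.le)
    have := hW.pos b
    have := hW.pos c
    have : 0 ≤ (b + c) * (W b * W c) := by positivity
    linarith
  -- As (y + z) + (−y) + (−z) = 0 and x W(x)² is odd, the bound is symmetric in the three
  -- frequencies up to sign. In every sign pattern the modulus of one of them is the sum of the
  -- moduli of the two others, and `key` applies to these two.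
  rcases le_total 0 y with hy | hy <;> rcases le_total 0 z with hz | hz
  · rw [abs_of_nonneg hy, abs_of_nonneg hz, abs_of_nonneg (add_nonneg hy hz)]
    exact key y z hy hz
  · rcases le_total 0 (y + z) with hx | hx
    · have h := key (y + z) (-z) hx (by linarith)
      rw [show y + z + -z = y by ring, hW.even] at h
      rw [abs_of_nonneg hy, abs_of_nonpos hz, abs_of_nonneg hx]
      refine le_trans (le_of_eq ?_) (h.trans (le_of_eq ?_))
      · rw [← abs_neg]; congr 1; ring
      · ring
    · have h := key y (-(y + z)) hy (by linarith)
      rw [show y + -(y + z) = -z by ring, hW.even, hW.even] at h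
      rw [abs_of_nonneg hy, abs_of_nonpos hz, abs_of_nonpos hx]
      refine le_trans (le_of_eq ?_) (h.trans (le_of_eq ?_))
      · congr 1; ring
      · ring
  · rcases le_total 0 (y + z) with hx | hx
    · have h := key (y + z) (-y) hx (by linarith)
      rw [show y + z + -y = z by ring, hW.even] at h
      rw [abs_of_nonpos hy, abs_of_nonneg hz, abs_of_nonneg hx]
      refine le_trans (le_of_eq ?_) (h.trans (le_of_eq ?_))
      · rw [← abs_neg]; congr 1; ring
      · ring
    · have h := key z (-(y + z)) hz (by linarith)
      rw [show z + -(y + z) = -y by ring, hW.even, hW.even] at h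
      rw [abs_of_nonpos hy, abs_of_nonneg hz, abs_of_nonpos hx]
      refine le_trans (le_of_eq ?_) (h.trans (le_of_eq ?_))
      · congr 1; ring
      · ring
  · have h := key (-y) (-z) (by linarith) (by linarith)
    rw [show -y + -z = -(y + z) by ring, hW.even, hW.even, hW.even] at h
    rw [abs_of_nonpos hy, abs_of_nonpos hz, abs_of_nonpos (add_nonpos hy hz)]
    refine le_trans (le_of_eq ?_) h
    rw [← abs_neg]; congr 1; ring

end IsWeight

/-! ### Trilinear energy estimates -/

theorem integral_add₃ {E : Type*} [NormedAddCommGroup E] [NormedSpace ℝ E] {f g h : ℝ → E}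
    (hf : Integrable f volume) (hg : Integrable g volume) (hh : Integrable h volume) :
    ∫ x, (f x + g x + h x) = (∫ x, f x) + (∫ x, g x) + ∫ x, h x := by
  rw [← integral_add hf hg]
  exact integral_add (hf.add hg) hh

theorem memLp_conj {u : ℝ → ℂ} (hu : MemLp u 2 volume) : MemLp (fun ξ => conj (u ξ)) 2 volume :=
  hu.of_le (Complex.continuous_conj.comp_aestronglyMeasurable hu.1)
    (ae_of_all _ fun ξ => by simp)

theorem n2_conj (u : ℝ → ℂ) : n2 (fun ξ => conj (u ξ)) = n2 u := by
  unfold n2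
  rw [eLpNorm_congr_norm_ae (g := u) (ae_of_all _ fun ξ => by simp)]

/-- The analogue of `integral_mul_conv` in which the integrable function is a factor of the
convolution. Reflecting `h` brings the kernel into the form of `integrable_trilinear`. -/
theorem integral_mul_conv_of_integrable {f g h : ℝ → ℂ} (hf : MemLp f 2 volume)
    (hg : Integrable g volume) (hh : MemLp h 2 volume) :
    ∫ ξ, f ξ * conv g h ξ = ∫ η, g η * ∫ ξ, f ξ * h (ξ - η) := by
  have hn : MemLp (fun ξ => h (-ξ)) 2 volume :=
    hh.comp_measurePreserving (Measure.measurePreserving_neg (volume : Measure ℝ))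
  have hi := (integrable_trilinear hg hf hn).swap
  have h5 := integral_integral_swap (f := fun ξ η => f ξ * (g η * h (ξ - η))) (by
    refine hi.congr (ae_of_all _ fun p => ?_)
    simp only [Function.comp_apply, Prod.fst_swap, Prod.snd_swap, Function.uncurry, neg_sub]
    ring)
  simp only [integral_const_mul] at h5
  unfold conv
  rw [h5]
  congr 1
  ext η
  rw [← integral_const_mul]
  congr 1
  ext ξ
  ring

/-- Multiplication by a function acts symmetrically on real functions. -/
theorem integral_conj_mul_conv_symm {u v p : ℝ → ℂ} (hu : MemLp u 2 volume)
    (hv : MemLp v 2 volume) (hp : Integrable p volume) (hu' : Herm u) (hv' : Herm v) :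
    ∫ ξ, conj (u ξ) * conv p v ξ = ∫ ξ, conj (v ξ) * conv p u ξ := by
  rw [integral_mul_conv_of_integrable (memLp_conj hu) hp hv,
    integral_mul_conv_of_integrable (memLp_conj hv) hp hu]
  congr 1
  ext η
  congr 1
  rw [← integral_sub_left_eq_self _ volume η]
  apply integral_congr_ae
  filter_upwards [ae_const_sub hu' η, hv'] with ξ h1 h2
  rw [← h1, ← h2, neg_sub, sub_sub_cancel_left, mul_comm]

theorem integrable_mul_conv {u p v : ℝ → ℂ} (hu : MemLp u 2 volume)
    (hp : Integrable p volume) (hp2 : MemLp p 2 volume) (hv : MemLp v 2 volume) :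
    Integrable (fun ξ => u ξ * conv p v ξ) volume :=
  hu.integrable_mul (memLp_conv hp hp2 hv).1

theorem norm_integral_mul_conv_le {u p v : ℝ → ℂ} (hu : MemLp u 2 volume)
    (hp : Integrable p volume) (hp2 : MemLp p 2 volume) (hv : MemLp v 2 volume) :
    ‖∫ ξ, u ξ * conv p v ξ‖ ≤ n1 p * (n2 u * n2 v) := by
  refine (norm_integral_le_integral_norm _).trans ?_
  simp only [norm_mul]
  refine (integral_norm_mul_le hu (memLp_conv hp hp2 hv).1).trans ?_
  calc n2 u * n2 (conv p v) ≤ n2 u * (n1 p * n2 v) :=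
        mul_le_mul_of_nonneg_left (memLp_conv hp hp2 hv).2 (n2_nonneg _)
    _ = _ := by ring

/-- The `L²` energy estimate for the transport term `∂ₓ (p z)`. -/
theorem norm_integral_transport_le {z p : ℝ → ℂ} (hz : MemLp z 2 volume) (hz' : Herm z)
    (hdz : MemLp (fun ξ : ℝ => (ξ : ℂ) * z ξ) 2 volume) (hp : Integrable p volume)
    (hp2 : MemLp p 2 volume) (hdp : Integrable (fun ξ : ℝ => (ξ : ℂ) * p ξ) volume)
    (hdp2 : MemLp (fun ξ : ℝ => (ξ : ℂ) * p ξ) 2 volume) :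
    ‖∫ ξ : ℝ, (ξ : ℂ) * (conj (z ξ) * conv p z ξ)‖ ≤ n1 (fun ξ : ℝ => (ξ : ℂ) * p ξ) * n2 z ^ 2 := by
  set u : ℝ → ℂ := fun ξ => Complex.I * ξ * z ξ with hu
  have hum : MemLp u 2 volume := by
    simpa [hu, mul_assoc] using! hdz.const_mul Complex.I
  have huH : Herm u := (Herm.I_mul_of_odd (m := fun ξ => ξ) fun ξ => rfl).mul hz'
  have h1 : ∫ ξ : ℝ, (ξ : ℂ) * (conj (z ξ) * conv p z ξ)
      = Complex.I * ∫ ξ, conj (u ξ) * conv p z ξ := by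
    rw [← integral_const_mul]
    congr 1
    ext ξ
    simp only [hu, map_mul, Complex.conj_I, Complex.conj_ofReal]
    linear_combination (ξ : ℂ) * conj (z ξ) * conv p z ξ * Complex.I_mul_I
  have hsym := integral_conj_mul_conv_symm hum hz hp huH hz'
  -- In the sum of the two symmetric forms the frequencies combine as −ξ + (ξ − η) = −η, so that the
  -- derivative falls on `p` alone. This is the integration by parts behind the `L²` estimate of a
  -- transport term.
  have h2 : 2 * ∫ ξ, conj (u ξ) * conv p z ξ
      = -(Complex.I * ∫ ξ, conj (z ξ) * conv (fun ξ : ℝ => (ξ : ℂ) * p ξ) z ξ) := by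
    rw [two_mul]
    nth_rw 2 [hsym]
    rw [← integral_add (integrable_mul_conv (memLp_conj hum) hp hp2 hz)
      (integrable_mul_conv (memLp_conj hz) hp hp2 hum), ← integral_const_mul, ← integral_neg]
    congr 1
    ext ξ
    unfold conv
    rw [← integral_const_mul, ← integral_const_mul, ← integral_const_mul, ← integral_const_mul,
      ← integral_add ((integrable_conv hp2 hz ξ).const_mul _)
        ((integrable_conv hp2 hum ξ).const_mul _), ← integral_neg]
    congr 1
    ext η
    simp only [hu, map_mul, Complex.conj_I, Complex.conj_ofReal]
    push_cast
    ring
  have h3 := norm_integral_mul_conv_le (memLp_conj hz) hdp hdp2 hz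
  rw [n2_conj, ← sq] at h3
  have h4 : ‖∫ ξ : ℝ, (ξ : ℂ) * (conj (z ξ) * conv p z ξ)‖ = ‖∫ ξ, conj (u ξ) * conv p z ξ‖ := by
    rw [h1, norm_mul, Complex.norm_I, one_mul]
  have h5 : 2 * ‖∫ ξ, conj (u ξ) * conv p z ξ‖
      = ‖∫ ξ, conj (z ξ) * conv (fun ξ : ℝ => (ξ : ℂ) * p ξ) z ξ‖ := by
    have := congrArg norm h2
    rwa [norm_mul, norm_neg, norm_mul, Complex.norm_I, one_mul, Complex.norm_ofNat] at this
  rw [h4]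
  linarith [norm_nonneg (∫ ξ, conj (u ξ) * conv p z ξ)]

/-- The weighted energy estimate for the nonlinear term `∂ₓ (a²)`. -/
theorem norm_integral_energy_le {W : ℝ → ℝ} {N : ℕ} (hW : IsWeight W N) {a : ℝ → ℂ}
    (ha : Herm a) (ha1 : Integrable a volume) (ha2 : MemLp a 2 volume)
    (hda1 : Integrable (fun ξ : ℝ => (ξ : ℂ) * a ξ) volume)
    (hda2 : MemLp (fun ξ : ℝ => (ξ : ℂ) * a ξ) 2 volume)
    (hWa : MemLp (fun ξ => (W ξ : ℂ) * a ξ) 2 volume)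
    (hu : MemLp (fun ξ => ((ξ * W ξ ^ 2 : ℝ) : ℂ) * a ξ) 2 volume) :
    ‖∫ ξ, ((ξ * W ξ ^ 2 : ℝ) : ℂ) * (conj (a ξ) * conv a a ξ)‖
      ≤ IsWeight.const N * (n1 (fun ξ : ℝ => (ξ : ℂ) * a ξ) * n2 (fun ξ => (W ξ : ℂ) * a ξ) ^ 2) := by
  set u : ℝ → ℂ := fun ξ => Complex.I * ((ξ * W ξ ^ 2 : ℝ) : ℂ) * a ξ with hudef
  set al : ℝ → ℂ := fun ξ : ℝ => (ξ : ℂ) * a ξ with hal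
  set be : ℝ → ℂ := fun ξ => (W ξ : ℂ) * a ξ with hbe
  have hum : MemLp u 2 volume := by
    simpa [hudef, mul_assoc] using! hu.const_mul Complex.I
  have huH : Herm u := (Herm.I_mul_of_odd (m := fun ξ => ξ * W ξ ^ 2) fun ξ => by
    rw [hW.even]; ring).mul ha
  have h1 : ∫ ξ, ((ξ * W ξ ^ 2 : ℝ) : ℂ) * (conj (a ξ) * conv a a ξ)
      = Complex.I * ∫ ξ, conj (u ξ) * conv a a ξ := by
    rw [← integral_const_mul]
    congr 1
    ext ξ
    simp only [hudef, map_mul, Complex.conj_I, Complex.conj_ofReal]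
    linear_combination ((ξ * W ξ ^ 2 : ℝ) : ℂ) * conj (a ξ) * conv a a ξ * Complex.I_mul_I
  have hsym := integral_conj_mul_conv_symm hum ha2 ha1 huH ha
  -- the symmetrized integrand
  set G : ℝ → ℂ := fun ξ => conj (u ξ) * conv a a ξ + conj (a ξ) * conv a u ξ
    + conj (a ξ) * conv u a ξ with hG
  have i1 := integrable_mul_conv (memLp_conj hum) ha1 ha2 ha2
  have i2 := integrable_mul_conv (memLp_conj ha2) ha1 ha2 hum
  have i3 : Integrable (fun ξ => conj (a ξ) * conv u a ξ) volume := by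
    rw [conv_comm]; exact i2
  -- The three integrals agree, by symmetry of the trilinear form on Hermitian functions. In their
  -- sum the multiplier is ξW(ξ)² − ηW(η)² − (ξ−η)W(ξ−η)², which is estimated by `symbol_le`.
  have h2 : 3 * ∫ ξ, conj (u ξ) * conv a a ξ = ∫ ξ, G ξ := by
    rw [hG, integral_add₃ i1 i2 i3, conv_comm u a, ← hsym]
    ring
  -- nonnegative comparison functions
  set al' : ℝ → ℂ := fun ξ => (‖al ξ‖ : ℂ) with hal'
  set be' : ℝ → ℂ := fun ξ => (‖be ξ‖ : ℂ) with hbe'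
  have hal1 : Integrable al' volume := hda1.norm.ofReal
  have hal2 : MemLp al' 2 volume := hda2.norm.ofReal
  have hbe2 : MemLp be' 2 volume := hWa.norm.ofReal
  have n1al : n1 al' = n1 al := by simp [n1, hal']
  have n2be : n2 be' = n2 be := by
    unfold n2
    rw [eLpNorm_congr_norm_ae (g := be) (ae_of_all _ fun ξ => by simp [hbe'])]
  have hK := IsWeight.const_pos N
  have hpt : ∀ ξ, ‖G ξ‖ ≤ IsWeight.const N * (‖be' ξ‖ * ‖conv al' be' ξ‖
      + ‖be' ξ‖ * ‖conv al' be' ξ‖ + ‖al' ξ‖ * ‖conv be' be' ξ‖) := by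
    intro ξ
    have e1 : ∀ f g : ℝ → ℂ, MemLp (fun ξ => (‖f ξ‖ : ℂ)) 2 volume →
        MemLp (fun ξ => (‖g ξ‖ : ℂ)) 2 volume →
        ∫ η, ‖f η‖ * ‖g (ξ - η)‖ ≤ ‖conv (fun ξ => (‖f ξ‖ : ℂ)) (fun ξ => (‖g ξ‖ : ℂ)) ξ‖ := by
      intro f g hf hg
      unfold conv
      have : ∀ η, (‖f η‖ : ℂ) * (‖g (ξ - η)‖ : ℂ) = ((‖f η‖ * ‖g (ξ - η)‖ : ℝ) : ℂ) := by
        intro η; push_cast; rfl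
      simp only [this]
      rw [integral_complex_ofReal, Complex.norm_real]
      exact le_abs_self _
    have hGi : G ξ = ∫ η, -Complex.I * ((ξ * W ξ ^ 2 - η * W η ^ 2
        - (ξ - η) * W (ξ - η) ^ 2 : ℝ) : ℂ) * (conj (a ξ) * (a η * a (ξ - η))) := by
      rw [hG]
      unfold conv
      simp only
      rw [← integral_const_mul, ← integral_const_mul, ← integral_const_mul,
        ← integral_add₃ ((integrable_conv ha2 ha2 ξ).const_mul _)
          ((integrable_conv ha2 hum ξ).const_mul _) ((integrable_conv hum ha2 ξ).const_mul _)]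
      congr 1
      ext η
      simp only [hudef, map_mul, Complex.conj_I, Complex.conj_ofReal]
      push_cast
      ring
    have j1 : Integrable (fun η => ‖al η‖ * ‖be (ξ - η)‖) volume := by
      have := (integrable_conv hda2 hWa ξ).norm
      simpa only [norm_mul] using! this
    have j2 : Integrable (fun η => ‖be η‖ * ‖al (ξ - η)‖) volume := by
      have := (integrable_conv hWa hda2 ξ).norm
      simpa only [norm_mul] using! this
    have j3 : Integrable (fun η => ‖be η‖ * ‖be (ξ - η)‖) volume := by
      have := (integrable_conv hWa hWa ξ).norm
      simpa only [norm_mul] using! this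
    have hb : ‖G ξ‖ ≤ ∫ η, IsWeight.const N * (‖be ξ‖ * (‖al η‖ * ‖be (ξ - η)‖)
        + ‖be ξ‖ * (‖be η‖ * ‖al (ξ - η)‖) + ‖al ξ‖ * (‖be η‖ * ‖be (ξ - η)‖)) := by
      rw [hGi]
      refine (norm_integral_le_integral_norm _).trans ?_
      refine integral_mono_of_nonneg (ae_of_all _ fun η => norm_nonneg _)
        ((((j1.const_mul _).add (j2.const_mul _)).add (j3.const_mul _)).const_mul _)
        (ae_of_all _ fun η => ?_)
      have hs := hW.symbol_le η (ξ - η)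
      rw [add_sub_cancel] at hs
      simp only [norm_mul, norm_neg, Complex.norm_I, one_mul, Complex.norm_real, Real.norm_eq_abs,
        RCLike.norm_conj, hal, hbe, abs_of_pos (hW.pos _)]
      calc _ ≤ IsWeight.const N * (|η| * (W ξ * W (ξ - η)) + |ξ - η| * (W ξ * W η)
            + |ξ| * (W η * W (ξ - η))) * (‖a ξ‖ * (‖a η‖ * ‖a (ξ - η)‖)) := by
            gcongr
        _ = _ := by ring
    refine hb.trans ?_
    rw [integral_const_mul, integral_add₃ (j1.const_mul _) (j2.const_mul _) (j3.const_mul _), integral_const_mul, integral_const_mul,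
      integral_const_mul]
    have e2 := e1 al be hal2 hbe2
    have e3 := e1 be al hbe2 hal2
    have e4 := e1 be be hbe2 hbe2
    rw [conv_comm] at e3
    have hn : ‖be' ξ‖ = ‖be ξ‖ := by simp [hbe']
    have hn' : ‖al' ξ‖ = ‖al ξ‖ := by simp [hal']
    rw [hn, hn']
    gcongr
  have k1 : Integrable (fun ξ => ‖be' ξ‖ * ‖conv al' be' ξ‖) volume := by
    have := (integrable_mul_conv hbe2 hal1 hal2 hbe2).norm
    simpa only [norm_mul] using this
  have k2 : Integrable (fun ξ => ‖al' ξ‖ * ‖conv be' be' ξ‖) volume := by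
    have := (hal1.mul_bdd (aestronglyMeasurable_conv hbe2.1 hbe2.1)
      (ae_of_all _ (norm_conv_le hbe2 hbe2))).norm
    simpa only [norm_mul] using this
  -- The `L¹` norm must always be put on the factor with the derivative: by Young's inequality if
  -- that factor is inside the convolution, by the pointwise bound of `conv be' be'` if it is
  -- outside (`k4`).
  have k3 : ∫ ξ, ‖be' ξ‖ * ‖conv al' be' ξ‖ ≤ n1 al * n2 be ^ 2 := by
    refine (integral_norm_mul_le hbe2 (memLp_conv hal1 hal2 hbe2).1).trans ?_
    have := (memLp_conv hal1 hal2 hbe2).2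
    rw [n1al, n2be] at this
    rw [n2be]
    calc n2 be * n2 (conv al' be') ≤ n2 be * (n1 al * n2 be) :=
          mul_le_mul_of_nonneg_left this (n2_nonneg _)
      _ = _ := by ring
  have k4 : ∫ ξ, ‖al' ξ‖ * ‖conv be' be' ξ‖ ≤ n1 al * n2 be ^ 2 := by
    rw [← n1al, n1, ← integral_mul_const]
    refine integral_mono_of_nonneg (ae_of_all _ fun ξ => by positivity) (hal1.norm.mul_const _)
      (ae_of_all _ fun ξ => ?_)
    have := norm_conv_le hbe2 hbe2 ξ
    rw [n2be] at this
    simp only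
    gcongr
    rw [sq]
    exact this
  have h3 : ‖∫ ξ, G ξ‖ ≤ IsWeight.const N * (3 * (n1 al * n2 be ^ 2)) := by
    refine (norm_integral_le_integral_norm _).trans ?_
    calc ∫ ξ, ‖G ξ‖ ≤ ∫ ξ, IsWeight.const N * (‖be' ξ‖ * ‖conv al' be' ξ‖
          + ‖be' ξ‖ * ‖conv al' be' ξ‖ + ‖al' ξ‖ * ‖conv be' be' ξ‖) :=
          integral_mono_of_nonneg (ae_of_all _ fun ξ => norm_nonneg _)
            (((k1.add k1).add k2).const_mul _) (ae_of_all _ hpt)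
      _ ≤ _ := by
          rw [integral_const_mul, integral_add₃ k1 k1 k2]
          gcongr
          linarith
  have h4 : 3 * ‖∫ ξ, conj (u ξ) * conv a a ξ‖ = ‖∫ ξ, G ξ‖ := by
    have := congrArg norm h2
    rwa [norm_mul, Complex.norm_ofNat] at this
  rw [h1, norm_mul, Complex.norm_I, one_mul]
  linarith

end KdVApprox

end

/-! ### Differential inequalities and the truncated flow -/

noncomputable section

namespace KdVApprox

open ComplexConjugate

/-! ### Differential inequalities and ordinary differential equations -/

/-- Grönwall's inequality, from the monotonicity of `f t * exp (-K * t)`. -/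
theorem le_mul_exp_of_deriv_le {f f' : ℝ → ℝ} {K T : ℝ}
    (h : ∀ t ∈ Icc 0 T, HasDerivWithinAt f (f' t) (Icc 0 T) t)
    (hb : ∀ t ∈ Icc 0 T, f' t ≤ K * f t) :
    ∀ t ∈ Icc 0 T, f t ≤ f 0 * Real.exp (K * t) := by
  intro t ht
  have hd : ∀ t ∈ Icc 0 T, HasDerivWithinAt (fun t => f t * Real.exp (-K * t))
      (f' t * Real.exp (-K * t) + f t * (Real.exp (-K * t) * -K)) (Icc 0 T) t := by
    intro t ht
    refine (h t ht).mul ?_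
    have : HasDerivAt (fun t : ℝ => -K * t) (-K) t := by
      simpa using (hasDerivAt_id t).const_mul (-K)
    exact this.exp.hasDerivWithinAt
  have hanti : AntitoneOn (fun t => f t * Real.exp (-K * t)) (Icc 0 T) := by
    refine antitoneOn_of_hasDerivWithinAt_nonpos (convex_Icc 0 T)
      (fun t ht => (hd t ht).continuousWithinAt)
      (f' := fun t => f' t * Real.exp (-K * t) + f t * (Real.exp (-K * t) * -K)) ?_ ?_
    · intro t ht
      exact (hd t (interior_subset ht)).mono interior_subset
    · intro t ht
      have := hb t (interior_subset ht)
      have := Real.exp_pos (-K * t)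
      nlinarith
  have h0 : (0 : ℝ) ∈ Icc 0 T := ⟨le_rfl, ht.1.trans ht.2⟩
  have := hanti h0 ht ht.1
  simp only [mul_zero, Real.exp_zero, mul_one] at this
  calc f t = f t * Real.exp (-K * t) * Real.exp (K * t) := by
        rw [mul_assoc, ← Real.exp_add]; simp
    _ ≤ _ := by gcongr

/-- The differential inequality says that (f + 1)^(-1/2) decreases at a rate of at most C/2. Up to
the time allowed by `hT` at least half of its initial value is left, hence the factor 4 = 2². -/
theorem add_one_le_of_deriv_le {f f' : ℝ → ℝ} {C T : ℝ} (hf : ∀ t ∈ Icc 0 T, 0 ≤ f t)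
    (h : ∀ t ∈ Icc 0 T, HasDerivWithinAt f (f' t) (Icc 0 T) t)
    (hb : ∀ t ∈ Icc 0 T, f' t ≤ C * (f t + 1) ^ (3 / 2 : ℝ))
    (hT : C * T ≤ (f 0 + 1) ^ (-1 / 2 : ℝ)) (hC : 0 ≤ C) :
    ∀ t ∈ Icc 0 T, f t + 1 ≤ 4 * (f 0 + 1) := by
  intro t ht
  have h0 : (0 : ℝ) ∈ Icc 0 T := ⟨le_rfl, ht.1.trans ht.2⟩
  have hd : ∀ t ∈ Icc 0 T, HasDerivWithinAt (fun t => (f t + 1) ^ (-1 / 2 : ℝ) + C / 2 * t)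
      (f' t * (-1 / 2) * (f t + 1) ^ (-1 / 2 - 1 : ℝ) + C / 2) (Icc 0 T) t := by
    intro t ht
    have hpos : f t + 1 ≠ 0 := by have := hf t ht; positivity
    have h1 := ((h t ht).add_const 1).rpow_const (p := (-1 / 2 : ℝ)) (Or.inl hpos)
    have h2 : HasDerivWithinAt (fun t : ℝ => C / 2 * t) (C / 2) (Icc 0 T) t := by
      simpa using ((hasDerivAt_id t).const_mul (C / 2)).hasDerivWithinAt
    exact h1.add h2
  have hmono : MonotoneOn (fun t => (f t + 1) ^ (-1 / 2 : ℝ) + C / 2 * t) (Icc 0 T) := by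
    refine monotoneOn_of_hasDerivWithinAt_nonneg (convex_Icc 0 T)
      (fun t ht => (hd t ht).continuousWithinAt)
      (f' := fun t => f' t * (-1 / 2) * (f t + 1) ^ (-1 / 2 - 1 : ℝ) + C / 2) ?_ ?_
    · intro t ht
      exact (hd t (interior_subset ht)).mono interior_subset
    · intro t ht
      have ht' := interior_subset ht
      have hpos : 0 < f t + 1 := by have := hf t ht'; positivity
      have h1 := hb t ht'
      have h2 : (f t + 1) ^ (3 / 2 : ℝ) * (f t + 1) ^ (-1 / 2 - 1 : ℝ) = 1 := by
        rw [← Real.rpow_add hpos]; norm_num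
      have h3 : 0 < (f t + 1) ^ (-1 / 2 - 1 : ℝ) := by positivity
      have h4 := mul_le_mul_of_nonneg_right h1 h3.le
      rw [mul_assoc, h2] at h4
      linarith
  have h1 := hmono h0 ht ht.1
  simp only [mul_zero, add_zero] at h1
  have hp0 : 0 < f 0 + 1 := by have := hf 0 h0; positivity
  have hpt : 0 < f t + 1 := by have := hf t ht; positivity
  have h2 : C * t ≤ (f 0 + 1) ^ (-1 / 2 : ℝ) := (mul_le_mul_of_nonneg_left ht.2 hC).trans hT
  have h3 : (f 0 + 1) ^ (-1 / 2 : ℝ) / 2 ≤ (f t + 1) ^ (-1 / 2 : ℝ) := by linarith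
  have e : ∀ x : ℝ, 0 < x → (x ^ (-1 / 2 : ℝ)) ^ 2 = x⁻¹ := by
    intro x hx
    rw [← Real.rpow_natCast, ← Real.rpow_mul hx.le]
    norm_num [Real.rpow_neg_one]
  have h4 := pow_le_pow_left₀ (by positivity) h3 2
  rw [div_pow, e _ hp0, e _ hpt] at h4
  have h5 : (4 * (f 0 + 1))⁻¹ ≤ (f t + 1)⁻¹ := by
    rw [mul_inv]; linarith
  exact (inv_le_inv₀ (by positivity) hpt).1 h5

open Metric in
/-- A locally Lipschitz vector field which is orthogonal to the radial direction has solutions on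
arbitrary time intervals, on which the norm is constant. -/
theorem exists_solution_of_inner_eq_zero {E : Type*} [NormedAddCommGroup E]
    [InnerProductSpace ℝ E] [CompleteSpace E] (F : E → E)
    (hL : ∀ R : ℝ, ∃ K : NNReal, LipschitzOnWith K F (closedBall 0 R))
    (hF : ∀ x, inner ℝ x (F x) = 0) (x₀ : E) {T : ℝ} (hT : 0 ≤ T) :
    ∃ x : ℝ → E, x 0 = x₀ ∧
      ∀ t ∈ Icc 0 T, HasDerivWithinAt x (F (x t)) (Icc 0 T) t ∧ ‖x t‖ = ‖x₀‖ := by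
  set R := ‖x₀‖ with hR
  -- A Lipschitz cut-off, equal to 1 on the ball of radius `R` and to 0 outside the ball of radius
  -- `R + 1`. The field `θ • F` is bounded and still orthogonal to the position; its solution
  -- therefore stays on the sphere of radius `R`, where it coincides with `F`.
  set θ : E → ℝ := fun x => max 0 (min 1 (R + 1 - ‖x‖)) with hθ
  have hθ0 : ∀ x, 0 ≤ θ x := fun x => le_max_left _ _
  have hθ1 : ∀ x, θ x ≤ 1 := fun x => max_le zero_le_one (min_le_left _ _)
  have hθL : ∀ x y, |θ x - θ y| ≤ ‖x - y‖ := by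
    intro x y
    refine (abs_max_sub_max_le_max _ _ _ _).trans (max_le (by simp) ?_)
    refine (abs_min_sub_min_le_max _ _ _ _).trans (max_le (by simp) ?_)
    rw [show R + 1 - ‖x‖ - (R + 1 - ‖y‖) = -(‖x‖ - ‖y‖) by ring, abs_neg]
    exact abs_norm_sub_norm_le x y
  have hθz : ∀ x, R + 1 < ‖x‖ → θ x = 0 := by
    intro x hx
    exact max_eq_left ((min_le_right _ _).trans (by linarith))
  have hbound : ∀ M : ℝ, 0 ≤ M → ∃ B : ℝ, 0 ≤ B ∧ ∀ x : E, ‖x‖ ≤ M → ‖F x‖ ≤ B := by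
    intro M hM
    obtain ⟨K, hK⟩ := hL M
    refine ⟨‖F 0‖ + K * M, by positivity, fun x hx => ?_⟩
    have h1 := hK.dist_le_mul x (by simpa using hx) 0 (by simpa using hM)
    rw [dist_eq_norm, dist_zero_right] at h1
    calc ‖F x‖ = ‖F 0 + (F x - F 0)‖ := by congr 1; abel
      _ ≤ ‖F 0‖ + ‖F x - F 0‖ := norm_add_le _ _
      _ ≤ _ := by gcongr; exact h1.trans (by gcongr)
  obtain ⟨B, hB0, hB⟩ := hbound (R + 1) (by positivity)
  set f : E → E := fun x => θ x • F x with hf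
  have hfB : ∀ x, ‖f x‖ ≤ B := by
    intro x
    simp only [hf, norm_smul, Real.norm_eq_abs, abs_of_nonneg (hθ0 x)]
    rcases le_or_gt ‖x‖ (R + 1) with h | h
    · calc θ x * ‖F x‖ ≤ 1 * B := mul_le_mul (hθ1 x) (hB x h) (norm_nonneg _) zero_le_one
        _ = B := one_mul B
    · rw [hθz x h]; simpa using hB0
  have hfL : ∀ M : ℝ, ∃ K : NNReal, LipschitzOnWith K f (closedBall 0 M) := by
    intro M
    obtain ⟨K, hK⟩ := hL M
    rcases lt_or_ge M 0 with hM | hM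
    · exact ⟨0, by rw [closedBall_eq_empty.2 hM]; exact fun x hx => absurd hx (by simp)⟩
    obtain ⟨B', hB'0, hB'⟩ := hbound M hM
    refine ⟨K + ⟨B', hB'0⟩, LipschitzOnWith.of_dist_le_mul fun x hx y hy => ?_⟩
    have h1 := hK.dist_le_mul x hx y hy
    rw [dist_eq_norm, dist_eq_norm] at *
    have h2 : f x - f y = θ x • (F x - F y) + (θ x - θ y) • F y := by
      simp only [hf]; module
    rw [h2]
    refine (norm_add_le _ _).trans ?_
    rw [norm_smul, norm_smul, Real.norm_eq_abs, Real.norm_eq_abs, abs_of_nonneg (hθ0 x)]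
    have h3 : θ x * ‖F x - F y‖ ≤ 1 * (K * ‖x - y‖) :=
      mul_le_mul (hθ1 x) h1 (norm_nonneg _) zero_le_one
    have h4 : |θ x - θ y| * ‖F y‖ ≤ ‖x - y‖ * B' :=
      mul_le_mul (hθL x y) (hB' y (by simpa using hy)) (norm_nonneg _) (norm_nonneg _)
    have h5 : ((K + ⟨B', hB'0⟩ : NNReal) : ℝ) = K + B' := rfl
    rw [h5]
    linarith
  -- A field bounded by `B` moves a point by at most `B * T` in time `T`, so that Picard–Lindelöf
  -- applies on the whole interval at once.
  set a : NNReal := ⟨B * T, by positivity⟩ with ha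
  obtain ⟨K, hK⟩ := hfL (R + B * T)
  have hPL : IsPicardLindelof (fun _ => f) (tmin := 0) (tmax := T) ⟨0, ⟨le_rfl, hT⟩⟩ x₀ a 0
      ⟨B, hB0⟩ K := by
    refine IsPicardLindelof.of_time_independent (fun x _ => hfB x) (hK.mono fun x hx => ?_) ?_
    · rw [mem_closedBall_zero_iff]
      rw [mem_closedBall, dist_eq_norm] at hx
      calc ‖x‖ = ‖x₀ + (x - x₀)‖ := by congr 1; abel
        _ ≤ ‖x₀‖ + ‖x - x₀‖ := norm_add_le _ _
        _ ≤ _ := by gcongr; exact hx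
    · have : max (T - 0) (0 - 0) = T := by simp [hT]
      change B * max (T - 0) (0 - 0) ≤ B * T - 0
      rw [this, sub_zero]
  obtain ⟨x, hx0, hx⟩ := hPL.exists_eq_forall_mem_Icc_hasDerivWithinAt₀
  simp only at hx0
  have hnorm : ∀ t ∈ Icc 0 T, ‖x t‖ = R := by
    have hd : ∀ t ∈ Icc 0 T, HasDerivWithinAt (fun t => ‖x t‖ ^ 2) 0 (Icc 0 T) t := by
      intro t ht
      have := (hx t ht).norm_sq
      simpa [hf, inner_smul_right, hF] using this
    intro t ht
    have h1 := (convex_Icc (0 : ℝ) T).norm_image_sub_le_of_norm_hasDerivWithin_le (C := 0)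
      hd (fun t _ => by simp) ⟨le_rfl, hT⟩ ht
    rw [zero_mul, norm_le_zero_iff, sub_eq_zero, hx0] at h1
    exact (pow_left_inj₀ (norm_nonneg _) (norm_nonneg _) (by norm_num)).1 h1
  refine ⟨x, hx0, fun t ht => ⟨?_, hnorm t ht⟩⟩
  have h1 := hx t ht
  have h2 : θ (x t) = 1 := by
    simp [hθ, hnorm t ht]
  simpa [hf, h2] using h1

/-! ### Inner products and multiplication operators -/

theorem inner_H (f g : H) : inner ℂ f g = ∫ ξ, conj (f ξ) * g ξ := by
  rw [L2.inner_def]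
  congr 1
  ext ξ
  rw [RCLike.inner_apply, mul_comm]

/-- By polarization, as `hat` is a real-linear isometry. -/
theorem inner_L2 (f g : L2) : inner ℝ f g = (∫ ξ, conj (hat f ξ) * hat g ξ).re := by
  have h1 := norm_add_sq_real f g
  have h2 := norm_add_sq (𝕜 := ℂ) (hat f) (hat g)
  rw [← map_add, hat.norm_map, hat.norm_map, hat.norm_map] at h2
  rw [← inner_H]
  simp only [RCLike.re_to_complex] at h2
  linarith

theorem hasDerivWithinAt_norm_sq {f : ℝ → H} {f' : H} {s : Set ℝ} {t : ℝ}
    (h : HasDerivWithinAt f f' s t) :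
    HasDerivWithinAt (fun t => ‖f t‖ ^ 2) (2 * (∫ ξ, conj (f t ξ) * f' ξ).re) s t := by
  have h1 := h.inner ℂ h
  have h2 : HasDerivWithinAt (fun t => (inner ℂ (f t) (f t)).re)
      (inner ℂ (f t) f' + inner ℂ f' (f t)).re s t :=
    Complex.reCLM.hasFDerivAt.comp_hasDerivWithinAt t h1
  have h3 : (inner ℂ (f t) f' + inner ℂ f' (f t)).re = 2 * (∫ ξ, conj (f t ξ) * f' ξ).re := by
    rw [Complex.add_re, ← inner_H, ← inner_conj_symm f' (f t), Complex.conj_re]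
    ring
  rw [h3] at h2
  have h4 : (fun t => ‖f t‖ ^ 2) = fun t => (inner ℂ (f t) (f t)).re := by
    ext t
    rw [inner_self_eq_norm_sq_to_K]
    norm_cast
  rw [h4]
  exact h2

theorem hasDerivWithinAt_clm (M : H →L[ℂ] H) {f : ℝ → H} {f' : H} {s : Set ℝ} {t : ℝ}
    (h : HasDerivWithinAt f f' s t) : HasDerivWithinAt (fun t => M (f t)) (M f') s t :=
  (M.restrictScalars ℝ).hasFDerivAt.comp_hasDerivWithinAt t h

theorem memLp_bdd_mul {m : ℝ → ℂ} (hm : Measurable m) {C : ℝ} (hC : ∀ ξ, ‖m ξ‖ ≤ C)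
    {f : ℝ → ℂ} (hf : MemLp f 2 volume) : MemLp (fun ξ => m ξ * f ξ) 2 volume := by
  refine hf.of_le_mul (c := C) (hm.aestronglyMeasurable.mul hf.1) (ae_of_all _ fun ξ => ?_)
  rw [norm_mul]
  exact mul_le_mul_of_nonneg_right (hC ξ) (norm_nonneg _)

/-- Multiplication by a bounded function. -/
def mulB (m : ℝ → ℂ) (hm : Measurable m) (C : ℝ) (hC : ∀ ξ, ‖m ξ‖ ≤ C) : H →L[ℂ] H :=
  LinearMap.mkContinuous
    { toFun := fun a => toH fun ξ => m ξ * a ξ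
      map_add' := fun a b => by
        rw [toH_add (memLp_bdd_mul hm hC (Lp.memLp a)) (memLp_bdd_mul hm hC (Lp.memLp b))]
        refine toH_congr ?_
        filter_upwards [Lp.coeFn_add a b] with ξ h
        rw [h, Pi.add_apply, mul_add]
      map_smul' := fun k a => by
        refine Lp.ext ?_
        have h1 := toH_coe (memLp_bdd_mul hm hC (Lp.memLp a))
        have h2 := toH_coe (memLp_bdd_mul hm hC (Lp.memLp (k • a)))
        filter_upwards [h1, h2, Lp.coeFn_smul k a,
          Lp.coeFn_smul k (toH fun ξ => m ξ * a ξ)] with ξ h1 h2 h3 h4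
        simp only [RingHom.id_apply]
        rw [h2, h3, h4, Pi.smul_apply, Pi.smul_apply, h1, smul_eq_mul, smul_eq_mul]
        ring } C fun a => by
    change ‖toH fun ξ => m ξ * a ξ‖ ≤ C * ‖a‖
    rw [norm_toH (memLp_bdd_mul hm hC (Lp.memLp a)), norm_eq_n2]
    refine n2_le_mul_of_norm_le ((norm_nonneg _).trans (hC 0)) (Lp.memLp a) ?_
    refine ae_of_all _ fun ξ => ?_
    rw [norm_mul]
    exact mul_le_mul_of_nonneg_right (hC ξ) (norm_nonneg _)

theorem mulB_coe {m : ℝ → ℂ} (hm : Measurable m) {C : ℝ} (hC : ∀ ξ, ‖m ξ‖ ≤ C) (a : H) :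
    mulB m hm C hC a =ᵐ[volume] fun ξ => m ξ * a ξ :=
  toH_coe (memLp_bdd_mul hm hC (Lp.memLp a))

end KdVApprox

end

noncomputable section

namespace KdVApprox

open ComplexConjugate

/-! ### Frequency truncation -/

/-- The symmetrization for the weight 1, in which the multiplier ξ − η − (ξ − η) vanishes. This is ∫
u² ∂ₓu = 0, and it makes the truncated flow conserve the `L²` norm. -/
theorem integral_self_interaction_eq_zero {a : ℝ → ℂ} (ha : Herm a) (ha1 : Integrable a volume)
    (ha2 : MemLp a 2 volume) (hda : MemLp (fun ξ : ℝ => (ξ : ℂ) * a ξ) 2 volume) :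
    ∫ ξ : ℝ, (ξ : ℂ) * (conj (a ξ) * conv a a ξ) = 0 := by
  set u : ℝ → ℂ := fun ξ => Complex.I * ξ * a ξ with hu
  have hum : MemLp u 2 volume := by
    simpa [hu, mul_assoc] using! hda.const_mul Complex.I
  have huH : Herm u := (Herm.I_mul_of_odd (m := fun ξ => ξ) fun ξ => rfl).mul ha
  have h1 : ∫ ξ : ℝ, (ξ : ℂ) * (conj (a ξ) * conv a a ξ)
      = Complex.I * ∫ ξ, conj (u ξ) * conv a a ξ := by
    rw [← integral_const_mul]
    congr 1
    ext ξ
    simp only [hu, map_mul, Complex.conj_I, Complex.conj_ofReal]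
    linear_combination (ξ : ℂ) * conj (a ξ) * conv a a ξ * Complex.I_mul_I
  have hsym := integral_conj_mul_conv_symm hum ha2 ha1 huH ha
  have i1 := integrable_mul_conv (memLp_conj hum) ha1 ha2 ha2
  have i2 := integrable_mul_conv (memLp_conj ha2) ha1 ha2 hum
  have i3 : Integrable (fun ξ => conj (a ξ) * conv u a ξ) volume := by
    rw [conv_comm]; exact i2
  have h2 : 3 * ∫ ξ, conj (u ξ) * conv a a ξ = 0 := by
    have h3 : ∫ ξ, (conj (u ξ) * conv a a ξ + conj (a ξ) * conv a u ξ
        + conj (a ξ) * conv u a ξ) = 0 := by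
      rw [← integral_zero ℝ ℂ]
      congr 1
      ext ξ
      unfold conv
      rw [← integral_const_mul, ← integral_const_mul, ← integral_const_mul,
        ← integral_add₃ ((integrable_conv ha2 ha2 ξ).const_mul _)
          ((integrable_conv ha2 hum ξ).const_mul _) ((integrable_conv hum ha2 ξ).const_mul _),
        ← integral_zero ℝ ℂ]
      congr 1
      ext η
      simp only [hu, map_mul, Complex.conj_I, Complex.conj_ofReal]
      push_cast
      ring
    rw [integral_add₃ i1 i2 i3, conv_comm u a, ← hsym] at h3
    linear_combination h3
  rw [h1, (mul_eq_zero.1 h2).resolve_left (by norm_num), mul_zero]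

/-- The indicator function of the frequencies `|ξ| ≤ n`. -/
def chi (n ξ : ℝ) : ℝ := if |ξ| ≤ n then 1 else 0

@[fun_prop]
theorem measurable_chi (n : ℝ) : Measurable (chi n) :=
  Measurable.ite (measurableSet_le (by fun_prop) measurable_const) measurable_const measurable_const

theorem chi_neg_arg (n ξ : ℝ) : chi n (-ξ) = chi n ξ := by simp [chi]

theorem chi_nonneg (n ξ : ℝ) : 0 ≤ chi n ξ := by unfold chi; split_ifs <;> norm_num

theorem chi_le_one (n ξ : ℝ) : chi n ξ ≤ 1 := by unfold chi; split_ifs <;> norm_num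

theorem norm_chi_le (n ξ : ℝ) : ‖(chi n ξ : ℂ)‖ ≤ 1 := by
  rw [Complex.norm_real, Real.norm_eq_abs, abs_of_nonneg (chi_nonneg n ξ)]
  exact chi_le_one n ξ

theorem memLp_chi (n : ℝ) : MemLp (fun ξ => (chi n ξ : ℂ)) 2 volume := by
  have h : (fun ξ => (chi n ξ : ℂ)) = (Icc (-n) n).indicator fun _ => 1 := by
    ext ξ
    simp only [chi, indicator, mem_Icc, abs_le]
    split_ifs <;> simp
  rw [h]
  exact memLp_indicator_const 2 measurableSet_Icc 1 (Or.inr (by simp))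

/-- The function `a` vanishes at the frequencies `|ξ| > n`. -/
def Band (n : ℝ) (a : ℝ → ℂ) : Prop := ∀ᵐ ξ, n < |ξ| → a ξ = 0

theorem band_chi_mul (n : ℝ) (a : ℝ → ℂ) : Band n (fun ξ => (chi n ξ : ℂ) * a ξ) :=
  ae_of_all _ fun ξ h => by simp [chi, not_le.2 h]

theorem memLp_chi_mul (n : ℝ) {a : ℝ → ℂ} (ha : MemLp a 2 volume) :
    MemLp (fun ξ => (chi n ξ : ℂ) * a ξ) 2 volume :=
  memLp_bdd_mul (by fun_prop) (norm_chi_le n) ha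

theorem n2_chi_mul_le (n : ℝ) {a : ℝ → ℂ} (ha : MemLp a 2 volume) :
    n2 (fun ξ => (chi n ξ : ℂ) * a ξ) ≤ n2 a := by
  refine n2_le_of_norm_le ha (ae_of_all _ fun ξ => ?_)
  rw [norm_mul]
  exact mul_le_of_le_one_left (norm_nonneg _) (norm_chi_le n ξ)

namespace Band

variable {n : ℝ} {a b : ℝ → ℂ}

theorem chi_mul (h : Band n a) : (fun ξ => (chi n ξ : ℂ) * a ξ) =ᵐ[volume] a := by
  filter_upwards [h] with ξ hξ
  rcases le_or_gt |ξ| n with h1 | h1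
  · simp [chi, h1]
  · simp [hξ h1]

theorem mul_left (h : Band n a) (m : ℝ → ℂ) : Band n (fun ξ => m ξ * a ξ) := by
  filter_upwards [h] with ξ hξ h1
  rw [hξ h1, mul_zero]

theorem add (ha : Band n a) (hb : Band n b) : Band n (fun ξ => a ξ + b ξ) := by
  filter_upwards [ha, hb] with ξ h h' h1
  rw [h h1, h' h1, add_zero]

theorem sub (ha : Band n a) (hb : Band n b) : Band n (fun ξ => a ξ - b ξ) := by
  filter_upwards [ha, hb] with ξ h h' h1
  rw [h h1, h' h1, sub_zero]

theorem mono {n' : ℝ} (ha : Band n a) (h : n ≤ n') : Band n' a := by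
  filter_upwards [ha] with ξ hξ h1
  exact hξ (h.trans_lt h1)

theorem integrable (h : Band n a) (ha : MemLp a 2 volume) : Integrable a volume :=
  ((memLp_chi n).integrable_mul ha).congr h.chi_mul

theorem n1_le (h : Band n a) (ha : MemLp a 2 volume) :
    n1 a ≤ n2 (fun ξ => (chi n ξ : ℂ)) * n2 a := by
  refine le_trans (le_of_eq ?_) (integral_norm_mul_le (memLp_chi n) ha)
  refine integral_congr_ae ?_
  filter_upwards [h.chi_mul] with ξ hξ
  rw [← norm_mul, hξ]

theorem norm_mul_le (h : Band n a) {m : ℝ → ℂ} {C : ℝ} (hC : ∀ ξ, |ξ| ≤ n → ‖m ξ‖ ≤ C) :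
    ∀ᵐ ξ, ‖m ξ * a ξ‖ ≤ C * ‖a ξ‖ := by
  filter_upwards [h] with ξ hξ
  rcases le_or_gt |ξ| n with h1 | h1
  · rw [norm_mul]
    exact mul_le_mul_of_nonneg_right (hC ξ h1) (norm_nonneg _)
  · simp [hξ h1]

theorem memLp_mul (h : Band n a) (ha : MemLp a 2 volume) {m : ℝ → ℂ} (hm : Measurable m) {C : ℝ}
    (hC : ∀ ξ, |ξ| ≤ n → ‖m ξ‖ ≤ C) : MemLp (fun ξ => m ξ * a ξ) 2 volume :=
  ha.of_le_mul (hm.aestronglyMeasurable.mul ha.1) (h.norm_mul_le hC)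

theorem n2_mul_le (h : Band n a) (ha : MemLp a 2 volume) {m : ℝ → ℂ} {C : ℝ} (hC0 : 0 ≤ C)
    (hC : ∀ ξ, |ξ| ≤ n → ‖m ξ‖ ≤ C) : n2 (fun ξ => m ξ * a ξ) ≤ C * n2 a :=
  n2_le_mul_of_norm_le hC0 ha (h.norm_mul_le hC)

theorem memLp_id_mul (h : Band n a) (ha : MemLp a 2 volume) :
    MemLp (fun ξ : ℝ => (ξ : ℂ) * a ξ) 2 volume :=
  h.memLp_mul ha (by fun_prop) (C := n) fun ξ hξ => by simpa using hξ

end Band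

/-- The truncated Fourier transform of `-(l v ∂ₓ v + m ∂ₓ³ v)`, with `κ = 8 π³ m`, `ν = π l`. -/
def gal (κ ν n : ℝ) (a : ℝ → ℂ) (ξ : ℝ) : ℂ :=
  chi n ξ * (Complex.I * (κ * ξ ^ 3 * a ξ - ν * ξ * conv a a ξ))

variable {κ ν n : ℝ}

theorem memLp_gal {a : ℝ → ℂ} (ha : MemLp a 2 volume) (hb : Band n a) :
    MemLp (gal κ ν n a) 2 volume := by
  have h1 : MemLp (fun ξ : ℝ => (Complex.I * κ * ξ ^ 3 : ℂ) * ((chi n ξ : ℂ) * a ξ)) 2 volume := by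
    refine (band_chi_mul n a).memLp_mul (memLp_chi_mul n ha) (by fun_prop) (C := |κ| * n ^ 3) ?_
    intro ξ hξ
    simp only [norm_mul, Complex.norm_I, one_mul, norm_pow, Complex.norm_real, Real.norm_eq_abs]
    gcongr
  have hc := (memLp_conv (hb.integrable ha) ha ha).1
  have h2 : MemLp (fun ξ : ℝ => (Complex.I * ν * ξ : ℂ) * ((chi n ξ : ℂ) * conv a a ξ)) 2 volume := by
    refine (band_chi_mul n _).memLp_mul (memLp_chi_mul n hc) (by fun_prop) (C := |ν| * n) ?_
    intro ξ hξ
    simp only [norm_mul, Complex.norm_I, one_mul, Complex.norm_real, Real.norm_eq_abs]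
    gcongr
  refine (h1.sub h2).ae_eq (ae_of_all _ fun ξ => ?_)
  simp only [Pi.sub_apply, gal]
  ring

theorem herm_gal {a : ℝ → ℂ} (ha : Herm a) : Herm (gal κ ν n a) := by
  filter_upwards [ha, ha.conv ha] with ξ h1 h2
  simp only [gal, chi_neg_arg, h1, h2, map_mul, map_sub, Complex.conj_ofReal, Complex.conj_I,
    map_pow]
  push_cast
  ring

theorem conv_self_sub {a b : ℝ → ℂ} (ha : MemLp a 2 volume) (hb : MemLp b 2 volume) (ξ : ℝ) :
    conv a a ξ - conv b b ξ = conv (fun η => a η + b η) (fun η => a η - b η) ξ := by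
  have hab : MemLp (fun η => a η - b η) 2 volume := ha.sub hb
  rw [conv_add_left ha hb hab, conv_comm a (fun η => a η - b η), conv_comm b (fun η => a η - b η)]
  have h1 : conv (fun η => a η - b η) a ξ = conv a a ξ - conv b a ξ := conv_sub_left ha hb ha ξ
  have h2 : conv (fun η => a η - b η) b ξ = conv a b ξ - conv b b ξ := conv_sub_left ha hb hb ξ
  rw [h1, h2, conv_comm b a]
  ring

/-- On a bounded band the multipliers are bounded and the `L²` norm controls the `L¹` norm. The
quadratic part is factored as in `conv_self_sub` and estimated by Young's inequality. The constant
depends on `n`; only local solvability uses it. -/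
theorem n2_gal_sub_le (hn : 0 ≤ n) {a b : ℝ → ℂ} (ha : MemLp a 2 volume) (ha' : Band n a)
    (hb : MemLp b 2 volume) (hb' : Band n b) :
    n2 (fun ξ => gal κ ν n a ξ - gal κ ν n b ξ)
      ≤ (|κ| * n ^ 3 + |ν| * n * (n2 (fun ξ => (chi n ξ : ℂ)) * (n2 a + n2 b)))
        * n2 (fun ξ => a ξ - b ξ) := by
  have hab : MemLp (fun ξ => a ξ - b ξ) 2 volume := ha.sub hb
  have hab' : MemLp (fun ξ => a ξ + b ξ) 2 volume := ha.add hb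
  have hc := memLp_conv ((ha'.add hb').integrable hab') hab' hab
  set c := conv (fun ξ => a ξ + b ξ) (fun ξ => a ξ - b ξ) with hcdef
  have e : (fun ξ => gal κ ν n a ξ - gal κ ν n b ξ)
      = fun ξ : ℝ => (Complex.I * κ * ξ ^ 3 : ℂ) * ((chi n ξ : ℂ) * (a ξ - b ξ))
        - (Complex.I * ν * ξ : ℂ) * ((chi n ξ : ℂ) * c ξ) := by
    ext ξ
    rw [hcdef, ← conv_self_sub ha hb ξ]
    simp only [gal]
    ring
  have b1 : ∀ ξ : ℝ, |ξ| ≤ n → ‖(Complex.I * κ * ξ ^ 3 : ℂ)‖ ≤ |κ| * n ^ 3 := by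
    intro ξ hξ
    simp only [norm_mul, Complex.norm_I, one_mul, norm_pow, Complex.norm_real, Real.norm_eq_abs]
    gcongr
  have b2 : ∀ ξ : ℝ, |ξ| ≤ n → ‖(Complex.I * ν * ξ : ℂ)‖ ≤ |ν| * n := by
    intro ξ hξ
    simp only [norm_mul, Complex.norm_I, one_mul, Complex.norm_real, Real.norm_eq_abs]
    gcongr
  rw [e]
  refine (n2_sub_le ((band_chi_mul n _).memLp_mul (memLp_chi_mul n hab) (by fun_prop) b1)
    ((band_chi_mul n _).memLp_mul (memLp_chi_mul n hc.1) (by fun_prop) b2)).trans ?_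
  have k1 := (band_chi_mul n _).n2_mul_le (memLp_chi_mul n hab) (by positivity) b1
  have k2 := (band_chi_mul n _).n2_mul_le (memLp_chi_mul n hc.1) (by positivity) b2
  have k3 := n2_chi_mul_le n hab
  have k4 := n2_chi_mul_le n hc.1
  have k5 := (ha'.add hb').n1_le hab'
  have k6 := n2_add_le ha hb
  have p0 := n2_nonneg (fun ξ => (chi n ξ : ℂ))
  have p1 := n2_nonneg (fun ξ => a ξ - b ξ)
  calc _ ≤ |κ| * n ^ 3 * n2 (fun ξ => a ξ - b ξ) + |ν| * n *
        (n2 (fun ξ => (chi n ξ : ℂ)) * (n2 a + n2 b) * n2 (fun ξ => a ξ - b ξ)) := by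
        refine add_le_add (k1.trans ?_) (k2.trans ?_)
        · gcongr
        · gcongr
          refine k4.trans (hc.2.trans ?_)
          gcongr
          exact k5.trans (by gcongr)
    _ = _ := by ring

/-- The contribution of the dispersive term to a weighted energy vanishes. -/
theorem re_integral_conj_mul_gal {a : ℝ → ℂ} (ha : MemLp a 2 volume) (hb : Band n a)
    {m : ℝ → ℝ} (hm : Measurable m) {C : ℝ} (hC : ∀ ξ, |ξ| ≤ n → |m ξ| ≤ C) :
    (∫ ξ, conj ((m ξ : ℂ) * a ξ) * gal κ ν n a ξ).re
      = (-(Complex.I * ν) * ∫ ξ : ℝ, ((ξ * m ξ : ℝ) : ℂ) * (conj (a ξ) * conv a a ξ)).re := by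
  have b0 : ∀ ξ : ℝ, |ξ| ≤ n → ‖((κ * ξ ^ 3 * m ξ : ℝ) : ℂ)‖ ≤ |κ| * n ^ 3 * C := by
    intro ξ hξ
    have h1 := hC ξ hξ
    have h2 : 0 ≤ n := (abs_nonneg _).trans hξ
    rw [Complex.norm_real, Real.norm_eq_abs, abs_mul, abs_mul, abs_pow]
    gcongr
  have b1 : ∀ ξ : ℝ, |ξ| ≤ n → ‖((ξ * m ξ : ℝ) : ℂ)‖ ≤ n * C := by
    intro ξ hξ
    have h1 := hC ξ hξ
    have h2 : 0 ≤ n := (abs_nonneg _).trans hξ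
    rw [Complex.norm_real, Real.norm_eq_abs, abs_mul]
    gcongr
  have i1 : Integrable (fun ξ : ℝ => ((κ * ξ ^ 3 * m ξ * ‖a ξ‖ ^ 2 : ℝ) : ℂ)) volume := by
    have h1 := (hb.memLp_mul ha (by fun_prop) b0).integrable_mul (memLp_conj ha)
    refine h1.congr (ae_of_all _ fun ξ => ?_)
    simp only [Pi.mul_apply]
    rw [mul_assoc, Complex.mul_conj, Complex.normSq_eq_norm_sq]
    push_cast
    ring
  have i2 : Integrable (fun ξ : ℝ => ((ξ * m ξ : ℝ) : ℂ) * (conj (a ξ) * conv a a ξ)) volume := by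
    have h1 := integrable_mul_conv (memLp_conj (hb.memLp_mul ha (by fun_prop) b1))
      (hb.integrable ha) ha ha
    refine h1.congr (ae_of_all _ fun ξ => ?_)
    simp only [map_mul, Complex.conj_ofReal]
    ring
  -- The cubic multiplier yields `I` times a real integral. The cut-off of `gal` disappears because
  -- `a` lies in the band.
  have e : ∫ ξ, conj ((m ξ : ℂ) * a ξ) * gal κ ν n a ξ
      = Complex.I * (∫ ξ : ℝ, ((κ * ξ ^ 3 * m ξ * ‖a ξ‖ ^ 2 : ℝ) : ℂ))
        + -(Complex.I * ν) * ∫ ξ : ℝ, ((ξ * m ξ : ℝ) : ℂ) * (conj (a ξ) * conv a a ξ) := by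
    rw [← integral_const_mul, ← integral_const_mul,
      ← integral_add (i1.const_mul _) (i2.const_mul _)]
    apply integral_congr_ae
    filter_upwards [hb.chi_mul] with ξ hξ
    have hξ' : (chi n ξ : ℂ) * conj (a ξ) = conj (a ξ) := by
      have := congrArg conj hξ
      rwa [map_mul, Complex.conj_ofReal] at this
    have hn : ((‖a ξ‖ ^ 2 : ℝ) : ℂ) = a ξ * conj (a ξ) := by
      rw [Complex.mul_conj, Complex.normSq_eq_norm_sq]
    simp only [gal]
    rw [Complex.ofReal_mul _ (‖a ξ‖ ^ 2), hn]
    simp only [map_mul, Complex.conj_ofReal]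
    push_cast
    linear_combination (m ξ * (Complex.I * (κ * ξ ^ 3 * a ξ - ν * ξ * conv a a ξ)) : ℂ) * hξ'
  rw [e, Complex.add_re, integral_complex_ofReal]
  simp

/-- The truncated equation as a vector field on `L²`. -/
def galField (κ ν n : ℝ) (u : L2) : L2 :=
  ofHat (toH (gal κ ν n fun ξ => (chi n ξ : ℂ) * hat u ξ))

theorem herm_chi_mul {a : ℝ → ℂ} (ha : Herm a) : Herm (fun ξ => (chi n ξ : ℂ) * a ξ) :=
  (Herm.ofReal_of_even (chi_neg_arg n)).mul ha

theorem hat_galField (u : L2) :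
    hat (galField κ ν n u) = toH (gal κ ν n fun ξ => (chi n ξ : ℂ) * hat u ξ) := by
  have h := memLp_gal (κ := κ) (ν := ν) (memLp_chi_mul n (memLp_hat u)) (band_chi_mul n (hat u))
  exact hat_ofHat ((herm_gal (herm_chi_mul (herm_hat u))).congr (toH_coe h).symm)

theorem lipschitz_galField (hn : 0 ≤ n) (R : ℝ) :
    ∃ K : NNReal, LipschitzOnWith K (galField κ ν n) (Metric.closedBall 0 R) := by
  set K := |κ| * n ^ 3 + |ν| * n * (n2 (fun ξ => (chi n ξ : ℂ)) * (|R| + |R|)) with hK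
  have hK0 : 0 ≤ K := by
    have := n2_nonneg (fun ξ => (chi n ξ : ℂ))
    positivity
  refine ⟨⟨K, hK0⟩, LipschitzOnWith.of_dist_le_mul fun u hu v hv => ?_⟩
  rw [mem_closedBall_zero_iff] at hu hv
  have hu' := memLp_chi_mul n (memLp_hat u)
  have hv' := memLp_chi_mul n (memLp_hat v)
  rw [dist_eq_norm, dist_eq_norm, ← hat.norm_map, map_sub, hat_galField, hat_galField,
    toH_sub (memLp_gal hu' (band_chi_mul n _)) (memLp_gal hv' (band_chi_mul n _)),
    norm_toH (by exact
      (memLp_gal hu' (band_chi_mul n _)).sub (memLp_gal hv' (band_chi_mul n _)))]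
  refine (n2_gal_sub_le hn hu' (band_chi_mul n _) hv' (band_chi_mul n _)).trans ?_
  have h1 : n2 (fun ξ => (chi n ξ : ℂ) * hat u ξ) ≤ |R| := by
    refine (n2_chi_mul_le n (memLp_hat u)).trans ?_
    rw [← norm_eq_n2, hat.norm_map]
    exact hu.trans (le_abs_self R)
  have h2 : n2 (fun ξ => (chi n ξ : ℂ) * hat v ξ) ≤ |R| := by
    refine (n2_chi_mul_le n (memLp_hat v)).trans ?_
    rw [← norm_eq_n2, hat.norm_map]
    exact hv.trans (le_abs_self R)
  have h3 : n2 (fun ξ => (chi n ξ : ℂ) * hat u ξ - (chi n ξ : ℂ) * hat v ξ) ≤ ‖u - v‖ := by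
    rw [← hat.norm_map, map_sub, norm_eq_n2]
    refine n2_le_of_norm_le (Lp.memLp _) ?_
    filter_upwards [Lp.coeFn_sub (hat u) (hat v)] with ξ h
    rw [h, ← mul_sub, norm_mul]
    exact mul_le_of_le_one_left (norm_nonneg _) (norm_chi_le n ξ)
  have := n2_nonneg (fun ξ => (chi n ξ : ℂ))
  change _ ≤ K * ‖u - v‖
  rw [hK]
  gcongr
  exact n2_nonneg _

/-- The truncation is a symmetric projection, so that only the truncated part `a` of `u` enters, and
for it the dispersive and the quadratic contributions both vanish. -/
theorem inner_galField (u : L2) : inner ℝ u (galField κ ν n u) = 0 := by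
  have hm := memLp_chi_mul n (memLp_hat u)
  have hb := band_chi_mul n (hat u)
  have hH : Herm fun ξ => (chi n ξ : ℂ) * hat u ξ := herm_chi_mul (herm_hat u)
  set a : ℝ → ℂ := fun ξ => (chi n ξ : ℂ) * hat u ξ with ha
  have h := re_integral_conj_mul_gal (κ := κ) (ν := ν) hm hb (m := fun _ => 1) measurable_const
    (C := 1) (by simp)
  have h0 := integral_self_interaction_eq_zero hH (hb.integrable hm) hm (hb.memLp_id_mul hm)
  simp only [mul_one, Complex.ofReal_one, one_mul] at h
  rw [h0, mul_zero, Complex.zero_re] at h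
  rw [inner_L2, hat_galField, ← h]
  congr 1
  apply integral_congr_ae
  filter_upwards [toH_coe (memLp_gal (κ := κ) (ν := ν) hm hb)] with ξ h1
  rw [h1]
  simp only [gal, ha, map_mul, Complex.conj_ofReal]
  have : (chi n ξ : ℂ) * chi n ξ = chi n ξ := by
    unfold chi; split_ifs <;> simp
  linear_combination -(conj (hat u ξ)) * (Complex.I * (κ * ξ ^ 3 * (chi n ξ * hat u ξ)
    - ν * ξ * conv a a ξ)) * this

/-- Solutions of the truncated equation, on the Fourier side. -/
theorem exists_galerkin (κ ν : ℝ) {n : ℝ} (hn : 0 ≤ n) (u0 : L2) {T : ℝ} (hT : 0 ≤ T) :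
    ∃ a : ℝ → H, a 0 = toH (fun ξ => (chi n ξ : ℂ) * hat u0 ξ) ∧
      ∀ t ∈ Icc 0 T, Herm (a t) ∧ Band n (a t) ∧
        HasDerivWithinAt a (toH (gal κ ν n (a t))) (Icc 0 T) t := by
  have hm0 := memLp_chi_mul n (memLp_hat u0)
  obtain ⟨u, hu0, hu⟩ := exists_solution_of_inner_eq_zero (galField κ ν n) (lipschitz_galField hn)
    inner_galField (ofHat (toH fun ξ => (chi n ξ : ℂ) * hat u0 ξ)) hT
  have h0 : hat (u 0) = toH fun ξ => (chi n ξ : ℂ) * hat u0 ξ := by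
    rw [hu0]
    exact hat_ofHat ((herm_chi_mul (herm_hat u0)).congr (toH_coe hm0).symm)
  have hd : ∀ t ∈ Icc 0 T, HasDerivWithinAt (fun t => hat (u t))
      (toH (gal κ ν n fun ξ => (chi n ξ : ℂ) * hat (u t) ξ)) (Icc 0 T) t := by
    intro t ht
    rw [← hat_galField]
    exact hat.toContinuousLinearMap.hasFDerivAt.comp_hasDerivWithinAt t (hu t ht).1
  have hb : ∀ t ∈ Icc 0 T, Band n (hat (u t)) := by
    intro t ht
    -- `M` projects onto the high frequencies. It annihilates the field and the initial value, so
    -- the solution stays in the band, and the cut-offs inside the nonlinearity can be dropped.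
    set M := mulB (fun ξ => 1 - (chi n ξ : ℂ)) (by fun_prop) 2 (fun ξ => by
      refine (norm_sub_le _ _).trans ?_
      have := norm_chi_le n ξ
      rw [norm_one]
      linarith) with hM
    have hz : ∀ b : ℝ → ℂ, MemLp (fun ξ => (chi n ξ : ℂ) * b ξ) 2 volume →
        M (toH fun ξ => (chi n ξ : ℂ) * b ξ) = 0 := by
      intro b hb
      apply Lp.ext
      filter_upwards [mulB_coe (m := fun ξ => 1 - (chi n ξ : ℂ)) (by fun_prop) (C := 2) (fun ξ => by
        refine (norm_sub_le _ _).trans ?_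
        have := norm_chi_le n ξ
        rw [norm_one]
        linarith) (toH fun ξ => (chi n ξ : ℂ) * b ξ), toH_coe hb, Lp.coeFn_zero ℂ 2 volume]
        with ξ h1 h2 h3
      rw [h1, h2, h3]
      simp only [chi]
      split_ifs <;> simp
    have hd' : ∀ t ∈ Icc 0 T, HasDerivWithinAt (fun t => M (hat (u t))) 0 (Icc 0 T) t := by
      intro t ht
      have h1 := hasDerivWithinAt_clm M (hd t ht)
      rwa [show M (toH (gal κ ν n fun ξ => (chi n ξ : ℂ) * hat (u t) ξ)) = 0 from hz _
        (memLp_gal (memLp_chi_mul n (memLp_hat _)) (band_chi_mul n _))] at h1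
    have h1 := (convex_Icc (0 : ℝ) T).norm_image_sub_le_of_norm_hasDerivWithin_le (C := 0)
      hd' (fun t _ => by simp) ⟨le_rfl, hT⟩ ht
    rw [zero_mul, norm_le_zero_iff, sub_eq_zero, h0, hz _ hm0] at h1
    filter_upwards [mulB_coe (m := fun ξ => 1 - (chi n ξ : ℂ)) (by fun_prop) (C := 2) (fun ξ => by
        refine (norm_sub_le _ _).trans ?_
        have := norm_chi_le n ξ
        rw [norm_one]
        linarith) (hat (u t)), Lp.coeFn_zero ℂ 2 volume] with ξ h2 h3 h4
    have h5 : M (hat (u t)) ξ = 0 := by rw [h1, h3]; rfl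
    rw [hM, h2] at h5
    simpa [chi, not_le.2 h4] using h5
  refine ⟨fun t => hat (u t), h0, fun t ht => ⟨herm_hat _, hb t ht, ?_⟩⟩
  have h1 := hd t ht
  rwa [show gal κ ν n (fun ξ => (chi n ξ : ℂ) * hat (u t) ξ) = gal κ ν n (hat (u t)) from ?_] at h1
  ext ξ
  simp only [gal]
  rw [conv_congr (hb t ht).chi_mul (hb t ht).chi_mul]
  simp only [chi]
  split_ifs <;> simp

end KdVApprox

end

noncomputable section

namespace KdVApprox

open ComplexConjugate

/-! ### Weighted estimates for convolutions -/

theorem abs_le_wgt_one (ξ : ℝ) : |ξ| ≤ wgt 1 ξ := by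
  rw [wgt, ← Real.sqrt_eq_rpow]
  exact Real.abs_le_sqrt (by linarith)

theorem abs_mul_wgt_le (r ξ : ℝ) : |ξ| * wgt (r - 1) ξ ≤ wgt r ξ := by
  calc |ξ| * wgt (r - 1) ξ ≤ wgt 1 ξ * wgt (r - 1) ξ :=
        mul_le_mul_of_nonneg_right (abs_le_wgt_one ξ) (wgt_pos _ _).le
    _ = wgt r ξ := by rw [← wgt_add]; ring_nf

theorem norm_wgt (r ξ : ℝ) : ‖(wgt r ξ : ℂ)‖ = wgt r ξ := by
  rw [Complex.norm_real, Real.norm_eq_abs, abs_of_pos (wgt_pos r ξ)]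

theorem n2_wgt_mul_mono {r r' : ℝ} (h : r ≤ r') {d : ℝ → ℂ}
    (hd : MemLp (fun ξ => (wgt r' ξ : ℂ) * d ξ) 2 volume) :
    n2 (fun ξ => (wgt r ξ : ℂ) * d ξ) ≤ n2 (fun ξ => (wgt r' ξ : ℂ) * d ξ) := by
  refine n2_le_of_norm_le hd (ae_of_all _ fun ξ => ?_)
  rw [norm_mul, norm_mul, norm_wgt, norm_wgt]
  exact mul_le_mul_of_nonneg_right (wgt_mono h ξ) (norm_nonneg _)

theorem memLp_of_wgt {r : ℝ} (hr : 0 ≤ r) {d : ℝ → ℂ}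
    (hd : MemLp (fun ξ => (wgt r ξ : ℂ) * d ξ) 2 volume) : MemLp d 2 volume := by
  have := memLp_wgt_mul_of_le hr hd
  simpa [wgt_zero] using this

theorem n2_le_n2_wgt_mul {r : ℝ} (hr : 0 ≤ r) {d : ℝ → ℂ}
    (hd : MemLp (fun ξ => (wgt r ξ : ℂ) * d ξ) 2 volume) :
    n2 d ≤ n2 (fun ξ => (wgt r ξ : ℂ) * d ξ) := by
  have := n2_wgt_mul_mono hr hd
  simpa [wgt_zero] using this

/-- The norm of the embedding of `Hʳ` into the functions with integrable Fourier transform. -/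
def embConst (r : ℝ) : ℝ := n2 fun ξ => (wgt (-r) ξ : ℂ)

theorem embConst_nonneg (r : ℝ) : 0 ≤ embConst r := n2_nonneg _

theorem integrable_of_wgt {r : ℝ} (hr : 1 / 2 < r) {d : ℝ → ℂ}
    (hd : MemLp (fun ξ => (wgt r ξ : ℂ) * d ξ) 2 volume) :
    Integrable d volume ∧ n1 d ≤ embConst r * n2 (fun ξ => (wgt r ξ : ℂ) * d ξ) := by
  have e : ∀ ξ, (wgt (-r) ξ : ℂ) * ((wgt r ξ : ℂ) * d ξ) = d ξ := by
    intro ξ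
    rw [← mul_assoc, ← Complex.ofReal_mul, wgt_neg_mul, Complex.ofReal_one, one_mul]
  constructor
  · exact ((memLp_wgt_neg hr).integrable_mul hd).congr (ae_of_all _ e)
  · refine le_trans (le_of_eq ?_) (integral_norm_mul_le (memLp_wgt_neg hr) hd)
    simp only [← norm_mul, e, n1]

theorem memLp_wgt_id_mul {r : ℝ} {d : ℝ → ℂ}
    (hd : MemLp (fun ξ => (wgt r ξ : ℂ) * d ξ) 2 volume) :
    MemLp (fun ξ => (wgt (r - 1) ξ : ℂ) * ((ξ : ℂ) * d ξ)) 2 volume ∧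
      n2 (fun ξ => (wgt (r - 1) ξ : ℂ) * ((ξ : ℂ) * d ξ)) ≤ n2 (fun ξ => (wgt r ξ : ℂ) * d ξ) := by
  have hb : ∀ ξ : ℝ, ‖(wgt (r - 1) ξ : ℂ) * ((ξ : ℂ) * d ξ)‖ ≤ ‖(wgt r ξ : ℂ) * d ξ‖ := by
    intro ξ
    rw [norm_mul, norm_mul, norm_mul, norm_wgt, norm_wgt, Complex.norm_real, Real.norm_eq_abs,
      ← mul_assoc, mul_comm (wgt _ _)]
    exact mul_le_mul_of_nonneg_right (abs_mul_wgt_le r ξ) (norm_nonneg _)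
  have hm := aestronglyMeasurable_of_wgt hd.1
  refine ⟨hd.of_le ?_ (ae_of_all _ hb), n2_le_of_norm_le hd (ae_of_all _ hb)⟩
  exact (by fun_prop : Measurable fun ξ => (wgt (r - 1) ξ : ℂ)).aestronglyMeasurable.mul
    (((by fun_prop : Measurable fun ξ : ℝ => (ξ : ℂ)).aestronglyMeasurable).mul hm)

theorem integrable_id_mul_of_wgt {r : ℝ} (hr : 3 / 2 < r) {d : ℝ → ℂ}
    (hd : MemLp (fun ξ => (wgt r ξ : ℂ) * d ξ) 2 volume) :
    Integrable (fun ξ : ℝ => (ξ : ℂ) * d ξ) volume ∧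
      n1 (fun ξ : ℝ => (ξ : ℂ) * d ξ) ≤ embConst (r - 1) * n2 (fun ξ => (wgt r ξ : ℂ) * d ξ) := by
  have h1 := memLp_wgt_id_mul hd
  have h2 := integrable_of_wgt (by linarith) h1.1
  exact ⟨h2.1, h2.2.trans (mul_le_mul_of_nonneg_left h1.2 (embConst_nonneg _))⟩

/-- One of `η` and `ξ - η` has modulus at least `|ξ| / 2`. -/
theorem wgt_le_add {r : ℝ} (hr : 0 ≤ r) (ξ η : ℝ) :
    wgt r ξ ≤ 2 ^ r * (wgt r η + wgt r (ξ - η)) := by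
  have key : ∀ x y : ℝ, ξ ^ 2 ≤ 4 * y ^ 2 → 0 ≤ x → wgt r ξ ≤ 2 ^ r * (wgt r y + x) := by
    intro x y h hx
    have h1 : wgt r ξ ≤ 2 ^ r * wgt r y := by
      unfold wgt
      have e : (2 : ℝ) ^ r = 4 ^ (r / 2) := by
        rw [show (4 : ℝ) = 2 ^ (2 : ℝ) by norm_num, ← Real.rpow_mul (by norm_num)]
        ring_nf
      rw [e, ← Real.mul_rpow (by norm_num) (by positivity)]
      gcongr
      linarith
    refine h1.trans ?_
    gcongr
    linarith
  rcases le_total (η ^ 2) ((ξ - η) ^ 2) with h | h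
  · rw [add_comm]
    exact key _ _ (by nlinarith [sq_nonneg (ξ - 2 * η), sq_nonneg ξ]) (wgt_pos _ _).le
  · exact key _ _ (by nlinarith [sq_nonneg (ξ - 2 * η), sq_nonneg ξ]) (wgt_pos _ _).le

theorem norm_conv_le_conv_norm (a b : ℝ → ℂ) (ξ : ℝ) :
    ‖conv a b ξ‖ ≤ ∫ η, ‖a η‖ * ‖b (ξ - η)‖ := by
  refine (norm_integral_le_integral_norm _).trans (le_of_eq ?_)
  simp only [norm_mul]

theorem integral_norm_mul_norm_eq (f g : ℝ → ℂ) (ξ : ℝ) :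
    ‖conv (fun ξ => (‖f ξ‖ : ℂ)) (fun ξ => (‖g ξ‖ : ℂ)) ξ‖ = ∫ η, ‖f η‖ * ‖g (ξ - η)‖ := by
  unfold conv
  have : ∀ η, (‖f η‖ : ℂ) * (‖g (ξ - η)‖ : ℂ) = ((‖f η‖ * ‖g (ξ - η)‖ : ℝ) : ℂ) := by
    intro η; push_cast; rfl
  simp only [this]
  rw [integral_complex_ofReal, Complex.norm_real, Real.norm_eq_abs, abs_of_nonneg]
  exact integral_nonneg fun _ => by positivity

theorem n2_norm (f : ℝ → ℂ) : n2 (fun ξ => (‖f ξ‖ : ℂ)) = n2 f := by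
  unfold n2
  rw [eLpNorm_congr_norm_ae (g := f) (ae_of_all _ fun ξ => by simp)]

theorem n1_norm (f : ℝ → ℂ) : n1 (fun ξ => (‖f ξ‖ : ℂ)) = n1 f := by simp [n1]

/-- The constant in the algebra property of `Hʳ`. -/
def algConst (r : ℝ) : ℝ := 2 ^ r * (2 * embConst r)

theorem algConst_nonneg (r : ℝ) : 0 ≤ algConst r := by
  have := embConst_nonneg r
  unfold algConst
  positivity

/-- `Hʳ` is an algebra for `r > 1/2`. -/
theorem memLp_wgt_conv {r : ℝ} (hr : 1 / 2 < r) {a b : ℝ → ℂ}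
    (ha : MemLp (fun ξ => (wgt r ξ : ℂ) * a ξ) 2 volume)
    (hb : MemLp (fun ξ => (wgt r ξ : ℂ) * b ξ) 2 volume) :
    MemLp (fun ξ => (wgt r ξ : ℂ) * conv a b ξ) 2 volume ∧
      n2 (fun ξ => (wgt r ξ : ℂ) * conv a b ξ)
        ≤ algConst r * (n2 (fun ξ => (wgt r ξ : ℂ) * a ξ) * n2 (fun ξ => (wgt r ξ : ℂ) * b ξ)) := by
  have hr0 : 0 ≤ r := by linarith
  set A : ℝ → ℂ := fun ξ => (wgt r ξ : ℂ) * a ξ with hA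
  set B : ℝ → ℂ := fun ξ => (wgt r ξ : ℂ) * b ξ with hB
  have ha2 := memLp_of_wgt hr0 ha
  have hb2 := memLp_of_wgt hr0 hb
  have ha1 := integrable_of_wgt hr ha
  have hb1 := integrable_of_wgt hr hb
  have ka : MemLp (fun ξ => (‖a ξ‖ : ℂ)) 2 volume := ha2.norm.ofReal
  have kb : MemLp (fun ξ => (‖b ξ‖ : ℂ)) 2 volume := hb2.norm.ofReal
  have kA : MemLp (fun ξ => (‖A ξ‖ : ℂ)) 2 volume := ha.norm.ofReal
  have kB : MemLp (fun ξ => (‖B ξ‖ : ℂ)) 2 volume := hb.norm.ofReal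
  have ia : Integrable (fun ξ => (‖a ξ‖ : ℂ)) volume := ha1.1.norm.ofReal
  have ib : Integrable (fun ξ => (‖b ξ‖ : ℂ)) volume := hb1.1.norm.ofReal
  have c1 := memLp_conv ia ka kB
  have c2 := memLp_conv ib kb kA
  rw [conv_comm] at c2
  rw [n1_norm, n2_norm] at c1 c2
  set f1 := conv (fun ξ => (‖a ξ‖ : ℂ)) (fun ξ => (‖B ξ‖ : ℂ)) with hf1
  set f2 := conv (fun ξ => (‖A ξ‖ : ℂ)) (fun ξ => (‖b ξ‖ : ℂ)) with hf2
  -- The weight goes to one of the two factors. The other one is taken in `L¹`, where Young's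
  -- inequality and the embedding of `Hʳ` apply.
  have hpt : ∀ ξ, ‖(wgt r ξ : ℂ) * conv a b ξ‖ ≤ 2 ^ r * (‖f2 ξ‖ + ‖f1 ξ‖) := by
    intro ξ
    have j1 : Integrable (fun η => ‖A η‖ * ‖b (ξ - η)‖) volume := by
      have := (integrable_conv ha hb2 ξ).norm
      simpa only [norm_mul] using! this
    have j2 : Integrable (fun η => ‖a η‖ * ‖B (ξ - η)‖) volume := by
      have := (integrable_conv ha2 hb ξ).norm
      simpa only [norm_mul] using! this
    have j3 : Integrable (fun η => ‖a η‖ * ‖b (ξ - η)‖) volume := by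
      have := (integrable_conv ha2 hb2 ξ).norm
      simpa only [norm_mul] using! this
    rw [norm_mul, norm_wgt, hf1, hf2, integral_norm_mul_norm_eq, integral_norm_mul_norm_eq,
      ← integral_add j1 j2, ← integral_const_mul]
    refine (mul_le_mul_of_nonneg_left (norm_conv_le_conv_norm a b ξ) (wgt_pos _ _).le).trans ?_
    rw [← integral_const_mul]
    refine integral_mono (j3.const_mul _) ((j1.add j2).const_mul _) fun η => ?_
    simp only [hA, hB, norm_mul, norm_wgt]
    have h1 := wgt_le_add hr0 ξ η
    have h2 : 0 ≤ ‖a η‖ * ‖b (ξ - η)‖ := by positivity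
    calc _ ≤ 2 ^ r * (wgt r η + wgt r (ξ - η)) * (‖a η‖ * ‖b (ξ - η)‖) :=
          mul_le_mul_of_nonneg_right h1 h2
      _ = _ := by ring
  have kf1 : MemLp (fun ξ => (‖f1 ξ‖ : ℂ)) 2 volume := c1.1.norm.ofReal
  have kf2 : MemLp (fun ξ => (‖f2 ξ‖ : ℂ)) 2 volume := c2.1.norm.ofReal
  have kf : MemLp (fun ξ => (‖f2 ξ‖ : ℂ) + (‖f1 ξ‖ : ℂ)) 2 volume := kf2.add kf1
  have hpt' : ∀ᵐ ξ, ‖(wgt r ξ : ℂ) * conv a b ξ‖ ≤ 2 ^ r * ‖(‖f2 ξ‖ : ℂ) + (‖f1 ξ‖ : ℂ)‖ := by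
    refine ae_of_all _ fun ξ => ?_
    rw [← Complex.ofReal_add, Complex.norm_real, Real.norm_eq_abs, abs_of_nonneg (by positivity)]
    exact hpt ξ
  refine ⟨kf.of_le_mul ?_ hpt', ?_⟩
  · exact (by fun_prop : Measurable fun ξ => (wgt r ξ : ℂ)).aestronglyMeasurable.mul
      (aestronglyMeasurable_conv ha2.1 hb2.1)
  · refine (n2_le_mul_of_norm_le (by positivity) kf hpt').trans ?_
    have h1 := n2_add_le kf2 kf1
    rw [n2_norm, n2_norm] at h1
    have pa := n2_nonneg A
    have pb := n2_nonneg B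
    unfold algConst
    rw [mul_assoc]
    gcongr
    calc _ ≤ _ := h1
      _ ≤ embConst r * n2 B * n2 A + embConst r * n2 A * n2 B := by
          refine add_le_add (c2.2.trans ?_) (c1.2.trans ?_)
          · exact mul_le_mul_of_nonneg_right hb1.2 pa
          · exact mul_le_mul_of_nonneg_right ha1.2 pb
      _ = _ := by ring

/-! ### Uniform bounds for the truncated equation -/

/-- A solution of the truncated equation, on the Fourier side. -/
structure IsGalerkin (κ ν n T : ℝ) (a0 : ℝ → ℂ) (a : ℝ → H) : Prop where
  initial : a 0 = toH (fun ξ => (chi n ξ : ℂ) * a0 ξ)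
  herm : ∀ t ∈ Icc 0 T, Herm (a t)
  band : ∀ t ∈ Icc 0 T, Band n (a t)
  deriv : ∀ t ∈ Icc 0 T, HasDerivWithinAt a (toH (gal κ ν n (a t))) (Icc 0 T) t

theorem exists_isGalerkin (κ ν : ℝ) {n : ℝ} (hn : 0 ≤ n) (u0 : L2) {T : ℝ} (hT : 0 ≤ T) :
    ∃ a : ℝ → H, IsGalerkin κ ν n T (hat u0) a := by
  obtain ⟨a, h0, h⟩ := exists_galerkin κ ν hn u0 hT
  exact ⟨a, h0, fun t ht => (h t ht).1, fun t ht => (h t ht).2.1, fun t ht => (h t ht).2.2⟩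

theorem IsWeight.le_of_abs_le {W : ℝ → ℝ} {N : ℕ} (hW : IsWeight W N) {n ξ : ℝ} (h : |ξ| ≤ n) :
    W ξ ≤ W n := by
  have h1 : W |ξ| = W ξ := by
    rcases abs_cases ξ with ⟨h, _⟩ | ⟨h, _⟩ <;> rw [h]
    exact hW.even ξ
  rw [← h1]
  exact hW.mono (abs_nonneg _) h

theorem IsWeight.norm_le {W : ℝ → ℝ} {N : ℕ} (hW : IsWeight W N) {n ξ : ℝ} (h : |ξ| ≤ n) :
    ‖(W ξ : ℂ)‖ ≤ W n := by
  rw [Complex.norm_real, Real.norm_eq_abs, abs_of_pos (hW.pos ξ)]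
  exact hW.le_of_abs_le h

namespace IsGalerkin

variable {κ ν n T : ℝ} {a0 : ℝ → ℂ} {a : ℝ → H} {W : ℝ → ℝ} {N : ℕ}

theorem memLp_weight (h : IsGalerkin κ ν n T a0 a) (hW : IsWeight W N) {t : ℝ}
    (ht : t ∈ Icc 0 T) : MemLp (fun ξ => (W ξ : ℂ) * a t ξ) 2 volume :=
  (h.band t ht).memLp_mul (Lp.memLp _)
    (Complex.measurable_ofReal.comp hW.measurable) fun _ => hW.norm_le

theorem norm_weight_mul_chi_le (hW : IsWeight W N) (n ξ : ℝ) :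
    ‖(W ξ : ℂ) * chi n ξ‖ ≤ W n := by
  rcases le_or_gt |ξ| n with h1 | h1
  · simpa [chi, h1] using hW.norm_le h1
  · simpa [chi, not_le.2 h1] using (hW.pos n).le

/-- The estimate is linear in the energy, at a rate given by the `L¹` norm of `ξ * a`, which
dominates the Lipschitz norm. The constant depends on `W` through `N` only, and not on the
truncation. -/
theorem energy (h : IsGalerkin κ ν n T a0 a) (hW : IsWeight W N) {t : ℝ} (ht : t ∈ Icc 0 T) :
    ∃ D : ℝ, HasDerivWithinAt (fun t => n2 (fun ξ => (W ξ : ℂ) * a t ξ) ^ 2) D (Icc 0 T) t ∧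
      D ≤ 2 * |ν| * IsWeight.const N * n1 (fun ξ : ℝ => (ξ : ℂ) * a t ξ)
        * n2 (fun ξ => (W ξ : ℂ) * a t ξ) ^ 2 := by
  have hWm : Measurable fun ξ => (W ξ : ℂ) := Complex.measurable_ofReal.comp hW.measurable
  have hmm : Measurable fun ξ => (W ξ : ℂ) * chi n ξ := hWm.mul (by fun_prop)
  have hC := norm_weight_mul_chi_le hW n
  -- The weight may be unbounded. On the band it equals the bounded multiplier `W * chi n`, which
  -- can be exchanged with the time derivative.
  set M := mulB (fun ξ => (W ξ : ℂ) * chi n ξ) hmm (W n) hC with hM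
  have hn : ∀ t ∈ Icc 0 T, n2 (fun ξ => (W ξ : ℂ) * a t ξ) ^ 2 = ‖M (a t)‖ ^ 2 := by
    intro t ht
    rw [norm_eq_n2]
    congr 1
    apply n2_congr
    filter_upwards [mulB_coe hmm hC (a t), (h.band t ht).chi_mul] with ξ h1 h2
    rw [hM, h1, mul_assoc, h2]
  have hd := hasDerivWithinAt_norm_sq (hasDerivWithinAt_clm M (h.deriv t ht))
  refine ⟨_, hd.congr hn (hn t ht), ?_⟩
  have ha2 := Lp.memLp (a t)
  have hb := h.band t ht
  have hg := memLp_gal (κ := κ) (ν := ν) ha2 hb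
  have e : ∫ ξ, conj (M (a t) ξ) * M (toH (gal κ ν n (a t))) ξ
      = ∫ ξ, conj (((W ξ ^ 2 : ℝ) : ℂ) * a t ξ) * gal κ ν n (a t) ξ := by
    apply integral_congr_ae
    filter_upwards [mulB_coe hmm hC (a t), mulB_coe hmm hC (toH (gal κ ν n (a t))),
      toH_coe hg] with ξ h1 h2 h3
    rw [hM, h1, h2, h3]
    simp only [gal, map_mul, Complex.conj_ofReal]
    have : (chi n ξ : ℂ) * chi n ξ = chi n ξ := by
      unfold chi; split_ifs <;> simp
    push_cast
    linear_combination (W ξ ^ 2 : ℂ) * conj (a t ξ) * (Complex.I * (κ * ξ ^ 3 * a t ξ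
      - ν * ξ * conv (a t) (a t) ξ)) * (chi n ξ + 1) * this
  have b2 : ∀ ξ, |ξ| ≤ n → |W ξ ^ 2| ≤ W n ^ 2 := by
    intro ξ hξ
    rw [abs_of_nonneg (by positivity)]
    exact pow_le_pow_left₀ (hW.pos ξ).le (hW.le_of_abs_le hξ) 2
  rw [e, re_integral_conj_mul_gal ha2 hb (hW.measurable.pow_const 2) b2]
  have hu : MemLp (fun ξ => ((ξ * W ξ ^ 2 : ℝ) : ℂ) * a t ξ) 2 volume := by
    refine hb.memLp_mul ha2 (Complex.measurable_ofReal.comp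
      (measurable_id.mul (hW.measurable.pow_const 2))) (C := n * W n ^ 2) fun ξ hξ => ?_
    rw [Complex.norm_real, Real.norm_eq_abs, abs_mul]
    exact mul_le_mul hξ (b2 ξ hξ) (abs_nonneg _) ((abs_nonneg _).trans hξ)
  have hda := hb.memLp_id_mul ha2
  have key := norm_integral_energy_le hW (h.herm t ht) (hb.integrable ha2) ha2
    ((hb.mul_left fun ξ : ℝ => (ξ : ℂ)).integrable hda) hda (h.memLp_weight hW ht) hu
  have h1 := Complex.re_le_norm (-(Complex.I * ν)
    * ∫ ξ : ℝ, ((ξ * W ξ ^ 2 : ℝ) : ℂ) * (conj (a t ξ) * conv (a t) (a t) ξ))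
  rw [norm_mul, norm_neg, norm_mul, Complex.norm_I, one_mul, Complex.norm_real,
    Real.norm_eq_abs] at h1
  have h2 := mul_le_mul_of_nonneg_left key (abs_nonneg ν)
  calc _ ≤ 2 * (|ν| * (IsWeight.const N * (n1 (fun ξ : ℝ => (ξ : ℂ) * a t ξ)
        * n2 (fun ξ => (W ξ : ℂ) * a t ξ) ^ 2))) := by linarith
    _ = _ := by ring

theorem n2_initial_le (h : IsGalerkin κ ν n T a0 a) (ha0 : MemLp a0 2 volume)
    (hWa : MemLp (fun ξ => (W ξ : ℂ) * a0 ξ) 2 volume) :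
    n2 (fun ξ => (W ξ : ℂ) * a 0 ξ) ≤ n2 (fun ξ => (W ξ : ℂ) * a0 ξ) := by
  refine n2_le_of_norm_le hWa ?_
  rw [h.initial]
  filter_upwards [toH_coe (memLp_chi_mul n ha0)] with ξ h1
  rw [h1, norm_mul, norm_mul, norm_mul]
  gcongr
  exact mul_le_of_le_one_left (norm_nonneg _) (norm_chi_le n ξ)

theorem n1_id_mul_le (h : IsGalerkin κ ν n T a0 a) {r : ℝ} (hr : 3 / 2 < r) (hW : IsWeight W N)
    (hWr : ∀ ξ, wgt r ξ ≤ W ξ) {t : ℝ} (ht : t ∈ Icc 0 T) :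
    n1 (fun ξ : ℝ => (ξ : ℂ) * a t ξ) ≤ embConst (r - 1) * n2 (fun ξ => (W ξ : ℂ) * a t ξ) := by
  have h1 := h.memLp_weight (IsWeight.wgt (by linarith : 0 ≤ r)) ht
  refine (integrable_id_mul_of_wgt hr h1).2.trans ?_
  refine mul_le_mul_of_nonneg_left ?_ (embConst_nonneg _)
  refine n2_le_of_norm_le (h.memLp_weight hW ht) (ae_of_all _ fun ξ => ?_)
  rw [norm_mul, norm_mul, norm_wgt, Complex.norm_real, Real.norm_eq_abs, abs_of_pos (hW.pos ξ)]
  exact mul_le_mul_of_nonneg_right (hWr ξ) (norm_nonneg _)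

/-- The a priori bound in a weighted space, on a time interval independent of the truncation. -/
theorem n2_weight_le (h : IsGalerkin κ ν n T a0 a) (ha0 : MemLp a0 2 volume) {r : ℝ}
    (hr : 3 / 2 < r) (hW : IsWeight W N) (hWr : ∀ ξ, wgt r ξ ≤ W ξ)
    (hWa : MemLp (fun ξ => (W ξ : ℂ) * a0 ξ) 2 volume)
    (hT : 2 * |ν| * IsWeight.const N * embConst (r - 1) * T
      ≤ (n2 (fun ξ => (W ξ : ℂ) * a0 ξ) ^ 2 + 1) ^ (-1 / 2 : ℝ)) {t : ℝ} (ht : t ∈ Icc 0 T) :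
    n2 (fun ξ => (W ξ : ℂ) * a t ξ) ^ 2 ≤ 4 * (n2 (fun ξ => (W ξ : ℂ) * a0 ξ) ^ 2 + 1) := by
  have hD := fun (t : ℝ) (ht : t ∈ Icc 0 T) => h.energy hW ht
  choose! D hD1 hD2 using hD
  have hcn := (IsWeight.const_pos N).le
  have hem := embConst_nonneg (r - 1)
  have h0 := h.n2_initial_le ha0 hWa
  have h0' := pow_le_pow_left₀ (n2_nonneg _) h0 2
  have key := add_one_le_of_deriv_le (f' := D) (C := 2 * |ν| * IsWeight.const N * embConst (r - 1))
    (fun t _ => sq_nonneg (n2 fun ξ => (W ξ : ℂ) * a t ξ)) hD1 (fun t ht => ?_)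
    (hT.trans (Real.rpow_le_rpow_of_nonpos (by positivity) (by linarith) (by norm_num)))
    (by positivity) t ht
  · linarith
  · refine (hD2 t ht).trans ?_
    have h1 := h.n1_id_mul_le hr hW hWr ht
    set y := n2 (fun ξ => (W ξ : ℂ) * a t ξ) with hy
    have hy0 : 0 ≤ y := n2_nonneg _
    -- The Lipschitz norm is itself bounded by a multiple of `y`, so that the derivative of `y ^ 2`
    -- is cubic in `y`. This explains the exponent 3/2 in `add_one_le_of_deriv_le`.
    have e : y ^ 3 ≤ (y ^ 2 + 1) ^ (3 / 2 : ℝ) := by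
      calc y ^ 3 = (y ^ 2) ^ (3 / 2 : ℝ) := by
            rw [← Real.rpow_natCast, ← Real.rpow_natCast, ← Real.rpow_mul hy0]
            norm_num
        _ ≤ _ := by gcongr; linarith
    calc _ ≤ 2 * |ν| * IsWeight.const N * (embConst (r - 1) * y) * y ^ 2 := by gcongr
      _ = 2 * |ν| * IsWeight.const N * embConst (r - 1) * y ^ 3 := by ring
      _ ≤ _ := by gcongr

/-- Propagation of a weaker weighted norm, given a bound of the Lipschitz norm. -/
theorem n2_weight_le_two_mul (h : IsGalerkin κ ν n T a0 a) (ha0 : MemLp a0 2 volume)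
    (hW : IsWeight W N) (hWa : MemLp (fun ξ => (W ξ : ℂ) * a0 ξ) 2 volume) {B : ℝ}
    (hB : ∀ t ∈ Icc 0 T, n1 (fun ξ : ℝ => (ξ : ℂ) * a t ξ) ≤ B)
    (hT : 2 * |ν| * IsWeight.const N * B * T ≤ 1) {t : ℝ} (ht : t ∈ Icc 0 T) :
    n2 (fun ξ => (W ξ : ℂ) * a t ξ) ≤ 2 * n2 (fun ξ => (W ξ : ℂ) * a0 ξ) := by
  have hD := fun (t : ℝ) (ht : t ∈ Icc 0 T) => h.energy hW ht
  choose! D hD1 hD2 using hD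
  have hcn := (IsWeight.const_pos N).le
  have hB0 : 0 ≤ B := (n1_nonneg _).trans (hB t ht)
  have key := le_mul_exp_of_deriv_le (K := 2 * |ν| * IsWeight.const N * B) hD1
    (fun t ht => (hD2 t ht).trans (by
      have := hB t ht
      gcongr)) t ht
  have h0 := pow_le_pow_left₀ (n2_nonneg _) (h.n2_initial_le ha0 hWa) 2
  -- The energy grows at most by the factor e < 4, hence the norm by at most 2.
  have h1 : Real.exp (2 * |ν| * IsWeight.const N * B * t) ≤ 4 := by
    have h2 : 2 * |ν| * IsWeight.const N * B * t ≤ 1 :=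
      (mul_le_mul_of_nonneg_left ht.2 (by positivity)).trans hT
    calc _ ≤ Real.exp 1 := Real.exp_le_exp.2 h2
      _ ≤ 4 := by linarith [Real.exp_one_lt_d9]
  refine le_of_sq_le_sq ?_ (by have := n2_nonneg (fun ξ => (W ξ : ℂ) * a0 ξ); positivity)
  calc _ ≤ _ := key
    _ ≤ n2 (fun ξ => (W ξ : ℂ) * a0 ξ) ^ 2 * 4 := by gcongr
    _ = _ := by ring

end IsGalerkin

end KdVApprox

end

/-! ### Compactness at high frequencies and passage to the limit -/

noncomputable section

namespace KdVApprox

open ComplexConjugate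

/-! ### Limits in weighted spaces -/

/-- Fatou's lemma in a weighted `L²` space. -/
theorem memLp_weight_of_tendsto {w : ℝ → ℝ} (hw : Measurable w) {b : ℕ → H} {c : H} {B : ℝ}
    (hb : Tendsto b atTop (𝓝 c)) (h : ∀ k, MemLp (fun ξ => (w ξ : ℂ) * b k ξ) 2 volume)
    (hB : ∀ k, n2 (fun ξ => (w ξ : ℂ) * b k ξ) ≤ B) :
    MemLp (fun ξ => (w ξ : ℂ) * c ξ) 2 volume ∧ n2 (fun ξ => (w ξ : ℂ) * c ξ) ≤ B := by
  obtain ⟨ns, -, hns⟩ := (tendstoInMeasure_of_tendsto_Lp hb).exists_seq_tendsto_ae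
  have hB0 : 0 ≤ B := (n2_nonneg _).trans (hB 0)
  have h1 := Lp.eLpNorm_lim_le_liminf_eLpNorm (p := 2) (fun k => (h (ns k)).1)
    (fun ξ => (w ξ : ℂ) * c ξ) (by
      filter_upwards [hns] with ξ hξ
      exact hξ.const_mul _)
  have h2 : eLpNorm (fun ξ => (w ξ : ℂ) * c ξ) 2 volume ≤ ENNReal.ofReal B := by
    refine h1.trans ?_
    simp_rw [liminf_eq, eventually_atTop]
    refine sSup_le fun x ⟨k, hk⟩ => (hk k le_rfl).trans ?_
    rw [← ENNReal.ofReal_toReal (h (ns k)).2.ne]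
    exact ENNReal.ofReal_le_ofReal (hB _)
  refine ⟨⟨?_, h2.trans_lt ENNReal.ofReal_lt_top⟩, ?_⟩
  · exact (Complex.measurable_ofReal.comp hw).aestronglyMeasurable.mul (Lp.memLp c).1
  · exact ENNReal.toReal_le_of_le_ofReal hB0 h2

theorem memLp_of_weight_le {w W : ℝ → ℝ} (hw : Measurable w) {ε C : ℝ}
    (h : ∀ ξ, |w ξ| ≤ ε * |W ξ| + C) {b : ℝ → ℂ} (hb : MemLp b 2 volume)
    (hW : MemLp (fun ξ => (W ξ : ℂ) * b ξ) 2 volume) (hε : 0 ≤ ε) (hC : 0 ≤ C) :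
    MemLp (fun ξ => (w ξ : ℂ) * b ξ) 2 volume ∧
      n2 (fun ξ => (w ξ : ℂ) * b ξ) ≤ ε * n2 (fun ξ => (W ξ : ℂ) * b ξ) + C * n2 b := by
  set f : ℝ → ℂ := fun ξ => (ε : ℂ) * (‖(W ξ : ℂ) * b ξ‖ : ℂ) + (C : ℂ) * (‖b ξ‖ : ℂ) with hf
  have k1 : MemLp (fun ξ => (ε : ℂ) * (‖(W ξ : ℂ) * b ξ‖ : ℂ)) 2 volume :=
    (show MemLp (fun ξ => (‖(W ξ : ℂ) * b ξ‖ : ℂ)) 2 volume from hW.norm.ofReal).const_mul _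
  have k2 : MemLp (fun ξ => (C : ℂ) * (‖b ξ‖ : ℂ)) 2 volume :=
    (show MemLp (fun ξ => (‖b ξ‖ : ℂ)) 2 volume from hb.norm.ofReal).const_mul _
  have hfm : MemLp f 2 volume := k1.add k2
  have hle : ∀ᵐ ξ, ‖(w ξ : ℂ) * b ξ‖ ≤ ‖f ξ‖ := by
    refine ae_of_all _ fun ξ => ?_
    have e : f ξ = ((ε * (|W ξ| * ‖b ξ‖) + C * ‖b ξ‖ : ℝ) : ℂ) := by
      simp [hf]
    rw [e, Complex.norm_real, Real.norm_eq_abs, abs_of_nonneg (by positivity), norm_mul,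
      Complex.norm_real, Real.norm_eq_abs]
    have := mul_le_mul_of_nonneg_right (h ξ) (norm_nonneg (b ξ))
    linarith
  refine ⟨hfm.of_le ((Complex.measurable_ofReal.comp hw).aestronglyMeasurable.mul hb.1) hle,
    (n2_le_of_norm_le hfm hle).trans ((n2_add_le k1 k2).trans (le_of_eq ?_))⟩
  rw [n2_const_mul, n2_const_mul, n2_norm, n2_norm, Complex.norm_real, Complex.norm_real,
    Real.norm_of_nonneg hε, Real.norm_of_nonneg hC]

/-- A curve which is continuous in `L²` and bounded in a weighted space is continuous in any
weighted space of lower order. -/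
theorem continuousOn_weight {X : Type*} [TopologicalSpace X] {w W : ℝ → ℝ} (hw : Measurable w)
    (h : ∀ ε > 0, ∃ C ≥ 0, ∀ ξ, |w ξ| ≤ ε * |W ξ| + C) {b : X → H} {S : Set X} {B : ℝ}
    (hb : ContinuousOn b S) (hW : ∀ t ∈ S, MemLp (fun ξ => (W ξ : ℂ) * b t ξ) 2 volume)
    (hB : ∀ t ∈ S, n2 (fun ξ => (W ξ : ℂ) * b t ξ) ≤ B) :
    ContinuousOn (fun t => toH fun ξ => (w ξ : ℂ) * b t ξ) S := by
  intro t ht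
  have hB0 : 0 ≤ B := (n2_nonneg _).trans (hB t ht)
  have hm : ∀ t ∈ S, MemLp (fun ξ => (w ξ : ℂ) * b t ξ) 2 volume := by
    intro t ht
    obtain ⟨C, hC, hC'⟩ := h 1 one_pos
    exact (memLp_of_weight_le hw hC' (Lp.memLp _) (hW t ht) zero_le_one hC).1
  rw [ContinuousWithinAt, Metric.tendsto_nhds]
  intro δ hδ
  -- The bound in the stronger weight `W` makes the first part at most ε · 2B < δ/2. With ε fixed,
  -- the rest is `C * ‖b s - b t‖`, which is small by continuity in `L²`.
  set ε := δ / (4 * (B + 1)) with hε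
  have hε0 : 0 < ε := by positivity
  obtain ⟨C, hC, hC'⟩ := h ε hε0
  have h1 := (Metric.tendsto_nhds.1 (hb t ht)) (δ / (2 * (C + 1))) (by positivity)
  filter_upwards [h1, self_mem_nhdsWithin] with s hs hsS
  rw [dist_eq_norm] at hs ⊢
  have e1 : ∀ w : ℝ → ℝ, (fun ξ => (w ξ : ℂ) * b s ξ - (w ξ : ℂ) * b t ξ)
      =ᵐ[volume] fun ξ => (w ξ : ℂ) * (b s - b t) ξ := by
    intro w
    filter_upwards [Lp.coeFn_sub (b s) (b t)] with ξ hξ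
    rw [hξ, Pi.sub_apply, mul_sub]
  have hmW : MemLp (fun ξ => (W ξ : ℂ) * (b s - b t) ξ) 2 volume :=
    ((hW s hsS).sub (hW t ht)).ae_eq (e1 W)
  have h2 := (memLp_of_weight_le hw hC' (Lp.memLp (b s - b t)) hmW hε0.le hC).2
  have h3 : n2 (fun ξ => (W ξ : ℂ) * (b s - b t) ξ) ≤ 2 * B := by
    rw [← n2_congr (e1 W)]
    exact (n2_sub_le (hW s hsS) (hW t ht)).trans (by linarith [hB s hsS, hB t ht])
  rw [toH_sub (hm s hsS) (hm t ht), norm_toH (by exact (hm s hsS).sub (hm t ht)),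
    n2_congr (e1 w)]
  rw [← norm_eq_n2] at h2
  have h4 : C * ‖b s - b t‖ ≤ δ / 2 := by
    calc C * ‖b s - b t‖ ≤ (C + 1) * (δ / (2 * (C + 1))) :=
          mul_le_mul (by linarith) hs.le (norm_nonneg _) (by positivity)
      _ = δ / 2 := by field_simp
  have h5 : ε * n2 (fun ξ => (W ξ : ℂ) * (b s - b t) ξ) < δ / 2 := by
    calc _ ≤ ε * (2 * B) := by gcongr
      _ < ε * (2 * (B + 1)) := by gcongr; linarith
      _ = δ / 2 := by rw [hε]; field_simp; norm_num
  linarith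

/-! ### A slowly growing weight -/

/-- A function in `L²` always has a little more decay than required. By dominated convergence there
are radii R_k ≥ 2^k with ∫ min(|ξ|/R_k, 1)|g|² ≤ 2^(-k). The sum θ of these minima is finite, tends
to infinity, and θ|g|² is integrable. Each summand is nondecreasing on the half line and
nonincreasing after division by x; these properties pass to ω = √(1 + θ), which is a weight with
exponent 1. -/
theorem exists_growing_weight {g : ℝ → ℂ} (hg : MemLp g 2 volume) :
    ∃ ω : ℝ → ℝ, IsWeight ω 1 ∧ MemLp (fun ξ => (ω ξ : ℂ) * g ξ) 2 volume ∧
      ∀ K : ℝ, ∃ R : ℝ, ∀ ξ, ω ξ ≤ K → |ξ| ≤ R := by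
  have hfin : ∫⁻ ξ, ‖g ξ‖ₑ ^ (2 : ℝ) < ∞ := by
    have := (eLpNorm_lt_top_iff_lintegral_rpow_enorm_lt_top (by norm_num) (by norm_num)).1 hg.2
    simpa using this
  have hgm : AEMeasurable (fun ξ => ‖g ξ‖ₑ ^ (2 : ℝ)) volume := hg.1.enorm.pow_const _
  have hlim : Tendsto (fun R : ℕ => ∫⁻ ξ : ℝ, ENNReal.ofReal (min (|ξ| / R) 1) * ‖g ξ‖ₑ ^ (2 : ℝ))
      atTop (𝓝 0) := by
    have h1 := tendsto_lintegral_of_dominated_convergence' (μ := (volume : Measure ℝ))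
      (F := fun (R : ℕ) (ξ : ℝ) => ENNReal.ofReal (min (|ξ| / R) 1) * ‖g ξ‖ₑ ^ (2 : ℝ))
      (f := fun _ => 0) (fun ξ => ‖g ξ‖ₑ ^ (2 : ℝ)) (fun R => ?_) (fun R => ?_) hfin.ne ?_
    · simpa using h1
    · exact (by fun_prop : Measurable fun ξ : ℝ => ENNReal.ofReal (min (|ξ| / R) 1)).aemeasurable.mul
        hgm
    · refine ae_of_all _ fun ξ => mul_le_of_le_one_left zero_le ?_
      rw [← ENNReal.ofReal_one]
      exact ENNReal.ofReal_le_ofReal (min_le_right _ _)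
    · have hae : ∀ᵐ ξ, ‖g ξ‖ₑ ^ (2 : ℝ) < ∞ := ae_lt_top' hgm hfin.ne
      filter_upwards [hae] with ξ hξ
      have h2 : Tendsto (fun R : ℕ => min (|ξ| / (R : ℝ)) 1) atTop (𝓝 0) := by
        have h3 := (tendsto_const_div_atTop_nhds_zero_nat |ξ|).min
          (tendsto_const_nhds (x := (1 : ℝ)) (f := atTop))
        simpa using h3
      have h4 := ENNReal.tendsto_ofReal h2
      rw [ENNReal.ofReal_zero] at h4
      have h5 := ENNReal.Tendsto.mul_const h4 (Or.inr hξ.ne)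
      simpa using h5
  have hR : ∀ k : ℕ, ∃ R : ℕ, (2 : ℝ) ^ k ≤ R ∧
      ∫⁻ ξ : ℝ, ENNReal.ofReal (min (|ξ| / R) 1) * ‖g ξ‖ₑ ^ (2 : ℝ) ≤ ENNReal.ofReal ((1 / 2) ^ k) := by
    intro k
    have h1 : ∀ᶠ R : ℕ in atTop, (2 : ℝ) ^ k ≤ R := tendsto_natCast_atTop_atTop.eventually_ge_atTop _
    have h2 := hlim.eventually_le_const
      (ENNReal.ofReal_pos.2 (by positivity : (0 : ℝ) < (1 / 2) ^ k))
    exact (h1.and h2).exists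
  choose R hR1 hR2 using hR
  have hRpos : ∀ k, (0 : ℝ) < R k := fun k => lt_of_lt_of_le (by positivity) (hR1 k)
  set m : ℕ → ℝ → ℝ := fun k x => min (|x| / R k) 1 with hm
  have hm0 : ∀ k x, 0 ≤ m k x := fun k x => le_min (by positivity) zero_le_one
  have hsum : ∀ x, Summable fun k => m k x := by
    intro x
    refine Summable.of_nonneg_of_le (fun k => hm0 k x) (fun k => ?_)
      (summable_geometric_two.mul_left |x|)
    refine (min_le_left _ _).trans ?_
    rw [div_eq_mul_inv, one_div, inv_pow]
    gcongr
    exact hR1 k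
  set θ : ℝ → ℝ := fun x => ∑' k, m k x with hθ
  have hθ0 : ∀ x, 0 ≤ θ x := fun x => tsum_nonneg fun k => hm0 k x
  have hmono : ∀ {b a : ℝ}, 0 ≤ b → b ≤ a → θ b ≤ θ a := by
    intro b a hb hab
    refine (hsum b).tsum_le_tsum (fun k => ?_) (hsum a)
    simp only [hm, abs_of_nonneg hb, abs_of_nonneg (hb.trans hab)]
    have := hRpos k
    gcongr
  have hslow : ∀ {b a : ℝ}, 0 ≤ b → b ≤ a → b * θ a ≤ a * θ b := by
    intro b a hb hab
    simp only [hθ]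
    rw [← tsum_mul_left, ← tsum_mul_left]
    refine ((hsum a).mul_left b).tsum_le_tsum (fun k => ?_) ((hsum b).mul_left a)
    simp only [hm, abs_of_nonneg hb, abs_of_nonneg (hb.trans hab)]
    rw [mul_min_of_nonneg _ _ hb, mul_min_of_nonneg _ _ (hb.trans hab)]
    refine le_min ((min_le_left _ _).trans (le_of_eq (by ring))) ((min_le_right _ _).trans ?_)
    linarith
  have heven : ∀ x, θ (-x) = θ x := by intro x; simp [hθ, hm]
  have hmeas : Measurable θ := by
    have h1 : Monotone fun x => θ (max x 0) := fun x y hxy =>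
      hmono (le_max_right _ _) (max_le_max_right 0 hxy)
    have h2 : θ = (fun x => θ (max x 0)) ∘ fun x => |x| := by
      ext x
      simp only [Function.comp_apply, max_eq_left (abs_nonneg x)]
      simp [hθ, hm]
    rw [h2]
    exact h1.measurable.comp (by fun_prop)
  refine ⟨fun x => √(1 + θ x), ⟨?_, ?_, ?_, ?_, ?_⟩, ?_, ?_⟩
  · exact (measurable_const.add hmeas).sqrt
  · intro x
    rw [Real.one_le_sqrt]
    linarith [hθ0 x]
  · intro x
    simp only [heven]
  · intro b a hb hab
    exact Real.sqrt_le_sqrt (by linarith [hmono hb hab])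
  · intro b a hb hab
    have ha := hb.trans hab
    simp only [pow_one]
    rw [← Real.sqrt_sq hb, ← Real.sqrt_sq ha, ← Real.sqrt_mul (sq_nonneg b),
      ← Real.sqrt_mul (sq_nonneg a), Real.sqrt_sq hb, Real.sqrt_sq ha]
    refine Real.sqrt_le_sqrt ?_
    have h1 := hslow hb hab
    nlinarith [hθ0 b, mul_le_mul_of_nonneg_left h1 hb, mul_le_mul_of_nonneg_left hab
      (mul_nonneg ha (hθ0 b))]
  · refine ⟨((Complex.measurable_ofReal.comp (measurable_const.add hmeas).sqrt)).aestronglyMeasurable.mul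
      hg.1, ?_⟩
    rw [eLpNorm_lt_top_iff_lintegral_rpow_enorm_lt_top (by norm_num) (by norm_num)]
    have e : ∀ x, ‖((√(1 + θ x) : ℝ) : ℂ) * g x‖ₑ ^ (ENNReal.toReal 2)
        = ‖g x‖ₑ ^ (2 : ℝ) + ∑' k, ENNReal.ofReal (m k x) * ‖g x‖ₑ ^ (2 : ℝ) := by
      intro x
      have h1 : ‖((√(1 + θ x) : ℝ) : ℂ)‖ₑ ^ (2 : ℝ) = ENNReal.ofReal (1 + θ x) := by
        rw [← ofReal_norm, Complex.norm_real, Real.norm_of_nonneg (Real.sqrt_nonneg _),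
          ENNReal.ofReal_rpow_of_nonneg (Real.sqrt_nonneg _) (by norm_num), Real.rpow_two,
          Real.sq_sqrt (by linarith [hθ0 x])]
      rw [enorm_mul, ENNReal.toReal_ofNat, ENNReal.mul_rpow_of_nonneg _ _ (by norm_num), h1,
        ENNReal.ofReal_add zero_le_one (hθ0 x), ENNReal.ofReal_one, add_mul, one_mul,
        ENNReal.tsum_mul_right, hθ, ENNReal.ofReal_tsum_of_nonneg (fun k => hm0 k x) (hsum x)]
    simp only [e]
    rw [lintegral_add_left' hgm, lintegral_tsum fun k => ?_]
    · refine ENNReal.add_lt_top.2 ⟨hfin, lt_of_le_of_lt (ENNReal.tsum_le_tsum hR2) ?_⟩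
      rw [← ENNReal.ofReal_tsum_of_nonneg (fun k => by positivity) summable_geometric_two]
      exact ENNReal.ofReal_lt_top
    · exact (by fun_prop : Measurable fun ξ : ℝ =>
        ENNReal.ofReal (min (|ξ| / R k) 1)).aemeasurable.mul hgm
  · intro K
    obtain ⟨n, hn⟩ := exists_nat_gt (K ^ 2)
    -- Beyond this radius the first `n` terms of the series are equal to 1, so that θ ≥ n > K².
    refine ⟨∑ k ∈ Finset.range n, (R k : ℝ), fun ξ hξ => ?_⟩
    by_contra! hlt
    have h1 : (n : ℝ) ≤ θ ξ := by
      calc (n : ℝ) = ∑ k ∈ Finset.range n, m k ξ := by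
            rw [Finset.sum_congr rfl (g := fun _ => (1 : ℝ)) fun k hk => ?_]
            · simp
            · refine min_eq_right ?_
              rw [le_div_iff₀ (hRpos k), one_mul]
              exact (Finset.single_le_sum (f := fun k => (R k : ℝ)) (fun k _ => (hRpos k).le)
                hk).trans hlt.le
        _ ≤ θ ξ := (hsum ξ).sum_le_tsum _ fun k _ => hm0 k ξ
    have h2 : 1 + θ ξ ≤ K ^ 2 := by
      rw [← Real.sq_sqrt (by linarith [hθ0 ξ] : 0 ≤ 1 + θ ξ)]
      exact pow_le_pow_left₀ (Real.sqrt_nonneg _) hξ 2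
    linarith

end KdVApprox

end

noncomputable section

namespace KdVApprox

open ComplexConjugate

/-! ### Convergence of the truncated solutions -/

theorem n2_sub_coe (a b : H) : n2 (fun ξ => a ξ - b ξ) = ‖a - b‖ := by
  rw [norm_eq_n2]
  refine n2_congr ?_
  filter_upwards [Lp.coeFn_sub a b] with ξ h
  rw [h, Pi.sub_apply]

theorem norm_toH_sub {f g : ℝ → ℂ} (hf : MemLp f 2 volume) (hg : MemLp g 2 volume) :
    ‖toH f - toH g‖ = n2 (fun ξ => f ξ - g ξ) := by
  rw [toH_sub hf hg, norm_toH (by exact hf.sub hg)]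

theorem abs_chi_sub_mul_le {m n : ℝ} (hnm : n ≤ m) (ξ : ℝ) :
    n * |chi m ξ - chi n ξ| ≤ |ξ| := by
  unfold chi
  rcases le_or_gt |ξ| n with h | h
  · rw [if_pos h, if_pos (h.trans hnm)]
    simp
  · rw [if_neg (not_le.2 h)]
    split_ifs <;> simp [h.le]

theorem wgt_two (ξ : ℝ) : wgt 2 ξ = 1 + ξ ^ 2 := by simp [wgt]

theorem norm_chi_sub_mul_le {m n : ℝ} (hn : 0 < n) (hnm : n ≤ m) (ξ : ℝ) (z : ℂ) :
    ‖((chi m ξ - chi n ξ : ℝ) : ℂ) * (ξ * z)‖ ≤ 1 / n * ‖(wgt 2 ξ : ℂ) * z‖ := by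
  rw [norm_mul, norm_mul, norm_mul, norm_wgt, Complex.norm_real, Complex.norm_real,
    Real.norm_eq_abs, Real.norm_eq_abs, wgt_two, one_div, ← mul_assoc, ← mul_assoc]
  refine mul_le_mul_of_nonneg_right ?_ (norm_nonneg z)
  rw [inv_mul_eq_div, le_div_iff₀ hn]
  have h1 := abs_chi_sub_mul_le hnm ξ
  nlinarith [abs_nonneg ξ, sq_abs ξ]

/-- An `L²` energy estimate for the difference z = a − b. The dispersive term drops out. The
quadratic difference is the transport term ∂ₓ(pz) with p = a + b, controlled by the `L¹` norm of `ξ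
* p`. The mismatch of the two cut-offs acts on `conv b b`, which is bounded at order 2: one order
pays for the derivative, the other for the factor 1/n. The initial mismatch is of order 1/n as well.
-/
theorem norm_sub_le_of_isGalerkin {κ ν m n T r B : ℝ} (hr : 2 ≤ r) {a0 : ℝ → ℂ} {a b : ℝ → H}
    (ha : IsGalerkin κ ν m T a0 a) (hb : IsGalerkin κ ν n T a0 b) (hn : 0 < n) (hnm : n ≤ m)
    (ha0 : MemLp (fun ξ => (wgt r ξ : ℂ) * a0 ξ) 2 volume)
    (hB0 : n2 (fun ξ => (wgt r ξ : ℂ) * a0 ξ) ≤ B)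
    (hBa : ∀ t ∈ Icc 0 T, n2 (fun ξ => (wgt r ξ : ℂ) * a t ξ) ≤ B)
    (hBb : ∀ t ∈ Icc 0 T, n2 (fun ξ => (wgt r ξ : ℂ) * b t ξ) ≤ B) {t : ℝ} (ht : t ∈ Icc 0 T) :
    ‖a t - b t‖ ≤ √((B ^ 2 + 1) * Real.exp (2 * |ν| * (2 * embConst (r - 1) * B
      + algConst 2 * B ^ 2) * T)) / n := by
  have hr0 : 0 ≤ r := by linarith
  have hB' : 0 ≤ B := (n2_nonneg _).trans hB0
  have hem := embConst_nonneg (r - 1)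
  have hal := algConst_nonneg 2
  set C1 := 2 * |ν| * (2 * embConst (r - 1) * B + algConst 2 * B ^ 2) with hC1
  have hC1' : 0 ≤ C1 := by positivity
  -- The added constant `(1 / n) ^ 2` absorbs the source and makes the differential inequality
  -- homogeneous.
  have hd : ∀ t ∈ Icc 0 T, ∃ D : ℝ, HasDerivWithinAt (fun t => ‖a t - b t‖ ^ 2 + (1 / n) ^ 2) D
      (Icc 0 T) t ∧ D ≤ C1 * (‖a t - b t‖ ^ 2 + (1 / n) ^ 2) := by
    intro t ht
    have hd1 := hasDerivWithinAt_norm_sq ((ha.deriv t ht).sub (hb.deriv t ht))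
    refine ⟨_, hd1.add_const _, ?_⟩
    simp only [Pi.sub_apply]
    have ha2 := Lp.memLp (a t)
    have hb2 := Lp.memLp (b t)
    have hab := ha.band t ht
    have hbb := hb.band t ht
    have hbm : Band m (b t) := hbb.mono hnm
    have hwa := ha.memLp_weight (IsWeight.wgt hr0) ht
    have hwb := hb.memLp_weight (IsWeight.wgt hr0) ht
    set z : ℝ → ℂ := fun ξ => a t ξ - b t ξ with hz
    set p : ℝ → ℂ := fun ξ => a t ξ + b t ξ with hp
    have hz2 : MemLp z 2 volume := ha2.sub hb2
    have hzb : Band m z := hab.sub hbm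
    have hzH : Herm z := (ha.herm t ht).sub (hb.herm t ht)
    have hp2 : MemLp p 2 volume := ha2.add hb2
    have hpb : Band m p := hab.add hbm
    have hwp : MemLp (fun ξ => (wgt r ξ : ℂ) * p ξ) 2 volume := by
      refine (hwa.add hwb).ae_eq (ae_of_all _ fun ξ => ?_)
      simp only [hp, Pi.add_apply]; ring
    have hwp' : n2 (fun ξ => (wgt r ξ : ℂ) * p ξ) ≤ 2 * B := by
      have h1 := n2_add_le hwa hwb
      simp only [← mul_add] at h1
      exact h1.trans (by linarith [hBa t ht, hBb t ht])
    have hp1 := integrable_id_mul_of_wgt (by linarith) hwp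
    have hpn : n1 (fun ξ : ℝ => (ξ : ℂ) * p ξ) ≤ 2 * embConst (r - 1) * B := by
      refine hp1.2.trans ?_
      calc _ ≤ embConst (r - 1) * (2 * B) := by gcongr
        _ = _ := by ring
    set q : ℝ → ℂ := fun ξ => ((chi m ξ - chi n ξ : ℝ) : ℂ) * (ξ * conv (b t) (b t) ξ) with hq
    have hw2 := memLp_wgt_mul_of_le hr hwb
    have hw2' := (n2_wgt_mul_mono hr hwb).trans (hBb t ht)
    have hcb := memLp_wgt_conv (by norm_num : (1 : ℝ) / 2 < 2) hw2 hw2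
    have hqb : ∀ᵐ ξ, ‖q ξ‖ ≤ 1 / n * ‖(wgt 2 ξ : ℂ) * conv (b t) (b t) ξ‖ :=
      ae_of_all _ fun ξ => norm_chi_sub_mul_le hn hnm ξ _
    have hq2 : MemLp q 2 volume := by
      refine hcb.1.of_le_mul ?_ hqb
      exact (by fun_prop : Measurable fun ξ => ((chi m ξ - chi n ξ : ℝ) : ℂ)).aestronglyMeasurable.mul
        ((by fun_prop : Measurable fun ξ : ℝ => (ξ : ℂ)).aestronglyMeasurable.mul
          (aestronglyMeasurable_conv hb2.1 hb2.1))
    have hqn : n2 q ≤ algConst 2 * B ^ 2 * (1 / n) := by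
      refine (n2_le_mul_of_norm_le (by positivity) hcb.1 hqb).trans ?_
      have h1 := n2_nonneg (fun ξ => (wgt 2 ξ : ℂ) * b t ξ)
      calc _ ≤ 1 / n * (algConst 2 * (B * B)) := by
            refine mul_le_mul_of_nonneg_left (hcb.2.trans ?_) (by positivity)
            gcongr
        _ = _ := by ring
    have i1 : Integrable (fun ξ : ℝ => Complex.I * ((κ * ξ ^ 3 * ‖z ξ‖ ^ 2 : ℝ) : ℂ)) volume := by
      have h1 := (hzb.memLp_mul hz2 (m := fun ξ : ℝ => Complex.I * ((κ * ξ ^ 3 : ℝ) : ℂ))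
        (by fun_prop) (C := |κ| * m ^ 3) fun ξ hξ => by
          rw [norm_mul, Complex.norm_I, one_mul, Complex.norm_real, Real.norm_eq_abs, abs_mul,
            abs_pow]
          gcongr).integrable_mul (memLp_conj hz2)
      refine h1.congr (ae_of_all _ fun ξ => ?_)
      simp only [Pi.mul_apply]
      rw [mul_assoc, Complex.mul_conj, Complex.normSq_eq_norm_sq]
      push_cast
      ring
    have i2 : Integrable (fun ξ : ℝ => -(Complex.I * ν) * ((ξ : ℂ) * (conj (z ξ) * conv p z ξ)))
        volume := by
      have h1 := integrable_mul_conv (memLp_conj (hzb.memLp_id_mul hz2)) (hpb.integrable hp2) hp2 hz2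
      refine (h1.const_mul (-(Complex.I * ν))).congr (ae_of_all _ fun ξ => ?_)
      simp only [map_mul, Complex.conj_ofReal]
      ring
    have i3 : Integrable (fun ξ : ℝ => -(Complex.I * ν) * (conj (z ξ) * q ξ)) volume :=
      ((memLp_conj hz2).integrable_mul hq2).const_mul _
    have e : ∫ ξ, conj ((a t - b t : H) ξ)
          * (toH (gal κ ν m (a t)) - toH (gal κ ν n (b t)) : H) ξ
        = (∫ ξ : ℝ, Complex.I * ((κ * ξ ^ 3 * ‖z ξ‖ ^ 2 : ℝ) : ℂ))
          + (∫ ξ : ℝ, -(Complex.I * ν) * ((ξ : ℂ) * (conj (z ξ) * conv p z ξ)))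
          + ∫ ξ : ℝ, -(Complex.I * ν) * (conj (z ξ) * q ξ) := by
      rw [← integral_add₃ i1 i2 i3]
      apply integral_congr_ae
      filter_upwards [Lp.coeFn_sub (a t) (b t),
        Lp.coeFn_sub (toH (gal κ ν m (a t))) (toH (gal κ ν n (b t))),
        toH_coe (memLp_gal (κ := κ) (ν := ν) ha2 hab), toH_coe (memLp_gal (κ := κ) (ν := ν) hb2 hbb),
        hab.chi_mul, hbb.chi_mul, hzb.chi_mul] with ξ h1 h2 h3 h4 h5 h6 h7
      rw [h1, h2, Pi.sub_apply, Pi.sub_apply, h3, h4]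
      have hc := conv_self_sub ha2 hb2 ξ
      have h7' : (chi m ξ : ℂ) * conj (z ξ) = conj (z ξ) := by
        have := congrArg conj h7
        rwa [map_mul, Complex.conj_ofReal] at this
      have hnz : ((‖z ξ‖ ^ 2 : ℝ) : ℂ) = z ξ * conj (z ξ) := by
        rw [Complex.mul_conj, Complex.normSq_eq_norm_sq]
      rw [Complex.ofReal_mul _ (‖z ξ‖ ^ 2), hnz]
      simp only [gal, hq]
      push_cast
      change conj (z ξ) * _ = _
      have hz' : z ξ = a t ξ - b t ξ := rfl
      change _ = conv p z ξ at hc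
      rw [← hc, hz']
      rw [hz'] at h7'
      linear_combination (conj (a t ξ - b t ξ) * Complex.I * κ * ξ ^ 3) * (h5 - h6)
        - (Complex.I * ν * ξ * (conv (a t) (a t) ξ - conv (b t) (b t) ξ)) * h7'
    have r1 : (∫ ξ : ℝ, Complex.I * ((κ * ξ ^ 3 * ‖z ξ‖ ^ 2 : ℝ) : ℂ)).re = 0 := by
      rw [integral_const_mul, integral_complex_ofReal]
      simp
    have r2 : (∫ ξ : ℝ, -(Complex.I * ν) * ((ξ : ℂ) * (conj (z ξ) * conv p z ξ))).re
        ≤ |ν| * (2 * embConst (r - 1) * B * n2 z ^ 2) := by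
      refine (Complex.re_le_norm _).trans ?_
      rw [integral_const_mul, norm_mul, norm_neg, norm_mul, Complex.norm_I, one_mul,
        Complex.norm_real, Real.norm_eq_abs]
      gcongr
      refine (norm_integral_transport_le hz2 hzH (hzb.memLp_id_mul hz2) (hpb.integrable hp2) hp2
        hp1.1 (hpb.memLp_id_mul hp2)).trans ?_
      gcongr
    have r3 : (∫ ξ : ℝ, -(Complex.I * ν) * (conj (z ξ) * q ξ)).re
        ≤ |ν| * (n2 z * (algConst 2 * B ^ 2 * (1 / n))) := by
      refine (Complex.re_le_norm _).trans ?_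
      rw [integral_const_mul, norm_mul, norm_neg, norm_mul, Complex.norm_I, one_mul,
        Complex.norm_real, Real.norm_eq_abs]
      gcongr
      refine (norm_integral_le_integral_norm _).trans ?_
      simp only [norm_mul]
      refine (integral_norm_mul_le (memLp_conj hz2) hq2).trans ?_
      rw [n2_conj]
      exact mul_le_mul_of_nonneg_left hqn (n2_nonneg _)
    rw [e, Complex.add_re, Complex.add_re, r1, ← n2_sub_coe]
    change 2 * _ ≤ C1 * (n2 z ^ 2 + _)
    have hzn := n2_nonneg z
    have h4 : n2 z * (1 / n) ≤ n2 z ^ 2 + (1 / n) ^ 2 := by nlinarith [sq_nonneg (n2 z - 1 / n)]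
    calc _ ≤ 2 * (|ν| * (2 * embConst (r - 1) * B * n2 z ^ 2)
          + |ν| * (algConst 2 * B ^ 2 * (n2 z * (1 / n)))) := by linarith
      _ ≤ 2 * (|ν| * (2 * embConst (r - 1) * B * (n2 z ^ 2 + (1 / n) ^ 2))
          + |ν| * (algConst 2 * B ^ 2 * (n2 z ^ 2 + (1 / n) ^ 2))) := by
          gcongr
          exact le_add_of_nonneg_right (by positivity)
      _ = _ := by rw [hC1]; ring
  choose! D hD1 hD2 using hd
  have key := le_mul_exp_of_deriv_le hD1 hD2 t ht
  have ha02 := memLp_of_wgt hr0 ha0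
  have h0 : ‖a 0 - b 0‖ ≤ B * (1 / n) := by
    rw [ha.initial, hb.initial, toH_sub (memLp_chi_mul m ha02) (memLp_chi_mul n ha02),
      norm_toH (by exact (memLp_chi_mul m ha02).sub (memLp_chi_mul n ha02)), mul_comm]
    refine (n2_le_mul_of_norm_le (by positivity) ha0 (ae_of_all _ fun ξ => ?_)).trans
      (mul_le_mul_of_nonneg_left hB0 (by positivity))
    rw [← sub_mul, ← Complex.ofReal_sub, norm_mul, norm_mul, norm_wgt, Complex.norm_real,
      Real.norm_eq_abs, ← mul_assoc]
    refine mul_le_mul_of_nonneg_right ?_ (norm_nonneg _)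
    rw [one_div, inv_mul_eq_div, le_div_iff₀ hn, mul_comm]
    exact (abs_chi_sub_mul_le hnm ξ).trans ((abs_le_wgt_one ξ).trans (wgt_mono (by linarith) ξ))
  have h0' := pow_le_pow_left₀ (norm_nonneg _) h0 2
  have hexp : Real.exp (C1 * t) ≤ Real.exp (C1 * T) :=
    Real.exp_le_exp.2 (mul_le_mul_of_nonneg_left ht.2 hC1')
  rw [le_div_iff₀ hn]
  refine Real.le_sqrt_of_sq_le ?_
  have hfin : ‖a t - b t‖ ^ 2 ≤ (B ^ 2 + 1) * (1 / n) ^ 2 * Real.exp (C1 * T) := by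
    calc ‖a t - b t‖ ^ 2 ≤ ‖a t - b t‖ ^ 2 + (1 / n) ^ 2 := le_add_of_nonneg_right (by positivity)
      _ ≤ _ := key
      _ ≤ (B ^ 2 + 1) * (1 / n) ^ 2 * Real.exp (C1 * T) := by
          gcongr
          rw [mul_pow] at h0'
          linarith
  calc (‖a t - b t‖ * n) ^ 2 = ‖a t - b t‖ ^ 2 * n ^ 2 := by ring
    _ ≤ (B ^ 2 + 1) * (1 / n) ^ 2 * Real.exp (C1 * T) * n ^ 2 := by gcongr
    _ = _ := by field_simp

/-! ### Derivatives of curves in weighted spaces -/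

/-- Passage to the limit in an evolution equation with a loss of derivatives. The difference between
`f k` and the image under `M` of the primitive of `c` has slope at most `δ k`, so in the limit `M b`
and that image differ by a constant. Injectivity of `M` removes the loss, and continuity of `c`
gives the derivative in the strong norm. -/
theorem hasDerivWithinAt_of_approx {M : H →L[ℂ] H} (hM : Function.Injective M) {α β : ℝ}
    (hαβ : α ≤ β) {b c : ℝ → H} (hc : ContinuousOn c (Icc α β)) {f g : ℕ → ℝ → H} {δ : ℕ → ℝ}
    (hf : ∀ t ∈ Icc α β, Tendsto (fun k => f k t) atTop (𝓝 (M (b t))))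
    (hfg : ∀ k, ∀ t ∈ Icc α β, HasDerivWithinAt (f k) (g k t) (Icc α β) t)
    (hg : ∀ k, ∀ t ∈ Icc α β, ‖g k t - M (c t)‖ ≤ δ k) (hδ : Tendsto δ atTop (𝓝 0)) :
    ∀ t ∈ Icc α β, HasDerivWithinAt b (c t) (Icc α β) t := by
  set c' : ℝ → H := IccExtend hαβ ((Icc α β).domRestrict c) with hc'
  have hcc : Continuous c' := hc.domRestrict.Icc_extend'
  have hce : ∀ t ∈ Icc α β, c' t = c t := fun t ht => IccExtend_of_mem hαβ _ ht
  have hFd : ∀ t, HasDerivAt (fun t => ∫ s in α..t, c' s) (c' t) t := fun t =>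
    (hcc.integral_hasStrictDerivAt α t).hasDerivAt
  have hα : α ∈ Icc α β := ⟨le_rfl, hαβ⟩
  have hbt : ∀ t ∈ Icc α β, b t = b α + ∫ s in α..t, c' s := by
    intro t ht
    have h1 : ∀ k, ‖(f k t - M (∫ s in α..t, c' s)) - (f k α - M (∫ s in α..α, c' s))‖
        ≤ δ k * ‖t - α‖ := by
      intro k
      refine (convex_Icc α β).norm_image_sub_le_of_norm_hasDerivWithin_le
        (f := fun t => f k t - M (∫ s in α..t, c' s)) (f' := fun t => g k t - M (c t))
        (fun s hs => ?_) (hg k) hα ht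
      have h2 := hasDerivWithinAt_clm M ((hFd s).hasDerivWithinAt (s := Icc α β))
      rw [hce s hs] at h2
      exact (hfg k s hs).sub h2
    have h2 : Tendsto (fun k => ‖(f k t - M (∫ s in α..t, c' s))
        - (f k α - M (∫ s in α..α, c' s))‖) atTop
        (𝓝 ‖(M (b t) - M (∫ s in α..t, c' s)) - (M (b α) - M (∫ s in α..α, c' s))‖) :=
      (((hf t ht).sub_const _).sub ((hf α hα).sub_const _)).norm
    have h3 := le_of_tendsto_of_tendsto' h2 (hδ.mul_const ‖t - α‖) h1
    rw [zero_mul, norm_le_zero_iff, intervalIntegral.integral_same, map_zero, sub_zero,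
      ← map_sub, ← map_sub] at h3
    have h4 := hM (h3.trans (map_zero M).symm)
    have h5 : b t - b α = ∫ s in α..t, c' s := by
      rw [← sub_eq_zero, ← h4]; abel
    rw [← h5]; abel
  intro t ht
  have h1 := ((hFd t).const_add (b α)).hasDerivWithinAt (s := Icc α β)
  rw [hce t ht] at h1
  exact h1.congr hbt (hbt t ht)

theorem abs_pow_mul_wgt_le (r ξ : ℝ) (k : ℕ) : |ξ| ^ k * wgt (r - k) ξ ≤ wgt r ξ := by
  induction k generalizing r with
  | zero => simp
  | succ k ih =>
    calc |ξ| ^ (k + 1) * wgt (r - (k + 1 : ℕ)) ξ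
        = |ξ| ^ k * (|ξ| * wgt (r - k - 1) ξ) := by
          rw [show r - (k + 1 : ℕ) = r - k - 1 by push_cast; ring]; ring
      _ ≤ |ξ| ^ k * wgt (r - k) ξ := by gcongr; exact abs_mul_wgt_le _ _
      _ ≤ _ := ih r

theorem injective_mulB {m : ℝ → ℂ} (hm : Measurable m) {C : ℝ} (hC : ∀ ξ, ‖m ξ‖ ≤ C)
    (h0 : ∀ ξ, m ξ ≠ 0) : Function.Injective (mulB m hm C hC) := by
  intro a b hab
  apply Lp.ext
  have h1 := mulB_coe hm hC a
  rw [hab] at h1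
  filter_upwards [h1, mulB_coe hm hC b] with ξ h1 h2
  exact mul_left_cancel₀ (h0 ξ) (h1.symm.trans h2)

/-- Multiplication by the weight of order `-r`. -/
def mulW (r : ℝ) (hr : 0 ≤ r) : H →L[ℂ] H :=
  mulB (fun ξ => (wgt (-r) ξ : ℂ)) (by fun_prop) 1 fun ξ => by
    rw [norm_wgt]; exact wgt_le_one (by linarith) ξ

theorem mulW_coe (r : ℝ) (hr : 0 ≤ r) (a : H) :
    mulW r hr a =ᵐ[volume] fun ξ => (wgt (-r) ξ : ℂ) * a ξ := mulB_coe _ _ a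

theorem injective_mulW (r : ℝ) (hr : 0 ≤ r) : Function.Injective (mulW r hr) :=
  injective_mulB _ _ fun ξ => by exact_mod_cast (wgt_pos _ _).ne'

theorem mulW_toH {r r' q : ℝ} (hr : 0 ≤ r) {f : ℝ → ℂ}
    (hf : MemLp (fun ξ => (wgt r' ξ : ℂ) * f ξ) 2 volume) (hq : q = r' - r) :
    mulW r hr (toH fun ξ => (wgt r' ξ : ℂ) * f ξ) = toH fun ξ => (wgt q ξ : ℂ) * f ξ := by
  apply eq_toH
  filter_upwards [mulW_coe r hr (toH fun ξ => (wgt r' ξ : ℂ) * f ξ), toH_coe hf] with ξ h1 h2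
  rw [h1, h2, ← mul_assoc, ← Complex.ofReal_mul, ← wgt_add, hq]
  ring_nf

end KdVApprox

end

noncomputable section

namespace KdVApprox

open ComplexConjugate

/-! ### Existence for the equation on the Fourier side -/

/-- The Fourier transform of `-(l v ∂ₓ v + m ∂ₓ³ v)`, with `κ = 8 π³ m`, `ν = π l`. -/
def kdv (κ ν : ℝ) (a : ℝ → ℂ) (ξ : ℝ) : ℂ :=
  Complex.I * (κ * ξ ^ 3 * a ξ - ν * ξ * conv a a ξ)

variable {κ ν : ℝ}

theorem norm_wgt_mul_pow_mul_le (r ξ : ℝ) (k : ℕ) (z : ℂ) :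
    ‖(wgt (r - k) ξ : ℂ) * ((ξ : ℂ) ^ k * z)‖ ≤ ‖(wgt r ξ : ℂ) * z‖ := by
  rw [norm_mul, norm_mul, norm_mul, norm_wgt, norm_wgt, norm_pow, Complex.norm_real,
    Real.norm_eq_abs, ← mul_assoc, mul_comm (wgt _ _)]
  exact mul_le_mul_of_nonneg_right (abs_pow_mul_wgt_le r ξ k) (norm_nonneg _)

theorem memLp_wgt_mul_pow_mul {r : ℝ} (k : ℕ) {d : ℝ → ℂ}
    (hd : MemLp (fun ξ => (wgt r ξ : ℂ) * d ξ) 2 volume) :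
    MemLp (fun ξ => (wgt (r - k) ξ : ℂ) * ((ξ : ℂ) ^ k * d ξ)) 2 volume ∧
      n2 (fun ξ => (wgt (r - k) ξ : ℂ) * ((ξ : ℂ) ^ k * d ξ))
        ≤ n2 (fun ξ => (wgt r ξ : ℂ) * d ξ) := by
  have hb := fun ξ : ℝ => norm_wgt_mul_pow_mul_le r ξ k (d ξ)
  refine ⟨hd.of_le ?_ (ae_of_all _ hb), n2_le_of_norm_le hd (ae_of_all _ hb)⟩
  exact (by fun_prop : Measurable fun ξ => (wgt (r - k) ξ : ℂ)).aestronglyMeasurable.mul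
    (((by fun_prop : Measurable fun ξ : ℝ => (ξ : ℂ) ^ k).aestronglyMeasurable).mul
      (aestronglyMeasurable_of_wgt hd.1))

/-- The quadratic term uses the algebra property at order `r - 2`, hence `5 / 2 < r`. Its derivative
is then of order `r - 3`, like the dispersive term. -/
theorem memLp_wgt_kdv {r : ℝ} (hr : 5 / 2 < r) {a : ℝ → ℂ}
    (ha : MemLp (fun ξ => (wgt r ξ : ℂ) * a ξ) 2 volume) :
    MemLp (fun ξ => (wgt (r - 3) ξ : ℂ) * kdv κ ν a ξ) 2 volume := by
  have h1 := (memLp_wgt_mul_pow_mul 3 ha).1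
  have ha' := memLp_wgt_mul_of_le (by linarith : r - 2 ≤ r) ha
  have h2 := (memLp_wgt_mul_pow_mul 1 (memLp_wgt_conv (by linarith) ha' ha').1).1
  refine ((h1.const_mul (Complex.I * κ)).sub (h2.const_mul (Complex.I * ν))).ae_eq
    (ae_of_all _ fun ξ => ?_)
  simp only [Pi.sub_apply, kdv, pow_one]
  push_cast
  rw [show r - 2 - 1 = r - 3 by ring]
  ring

theorem n2_wgt_kdv_sub_le {r : ℝ} (hr : 5 / 2 < r) {a b : ℝ → ℂ}
    (ha : MemLp (fun ξ => (wgt r ξ : ℂ) * a ξ) 2 volume)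
    (hb : MemLp (fun ξ => (wgt r ξ : ℂ) * b ξ) 2 volume) :
    n2 (fun ξ => (wgt (r - 3) ξ : ℂ) * kdv κ ν a ξ - (wgt (r - 3) ξ : ℂ) * kdv κ ν b ξ)
      ≤ (|κ| + |ν| * (algConst (r - 2) * (n2 (fun ξ => (wgt r ξ : ℂ) * a ξ)
        + n2 (fun ξ => (wgt r ξ : ℂ) * b ξ)))) *
          n2 (fun ξ => (wgt r ξ : ℂ) * a ξ - (wgt r ξ : ℂ) * b ξ) := by
  have ha2 := memLp_of_wgt (by linarith : 0 ≤ r) ha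
  have hb2 := memLp_of_wgt (by linarith : 0 ≤ r) hb
  have hd : MemLp (fun ξ => (wgt r ξ : ℂ) * (a ξ - b ξ)) 2 volume := by
    simpa only [mul_sub] using! ha.sub hb
  have hp : MemLp (fun ξ => (wgt r ξ : ℂ) * (a ξ + b ξ)) 2 volume := by
    simpa only [mul_add] using! ha.add hb
  have hpn : n2 (fun ξ => (wgt r ξ : ℂ) * (a ξ + b ξ)) ≤ n2 (fun ξ => (wgt r ξ : ℂ) * a ξ)
        + n2 (fun ξ => (wgt r ξ : ℂ) * b ξ) := by
    have := n2_add_le ha hb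
    simpa only [mul_add] using this
  have h1 := memLp_wgt_mul_pow_mul 3 hd
  have hr2 : r - 2 ≤ r := by linarith
  have hc := memLp_wgt_conv (by linarith) (memLp_wgt_mul_of_le hr2 hp) (memLp_wgt_mul_of_le hr2 hd)
  have h2 := memLp_wgt_mul_pow_mul 1 hc.1
  set c := conv (fun ξ => a ξ + b ξ) (fun ξ => a ξ - b ξ) with hcdef
  have e : (fun ξ => (wgt (r - 3) ξ : ℂ) * kdv κ ν a ξ - (wgt (r - 3) ξ : ℂ) * kdv κ ν b ξ)
      = fun ξ : ℝ => (Complex.I * κ) * ((wgt (r - (3 : ℕ)) ξ : ℂ) * ((ξ : ℂ) ^ 3 * (a ξ - b ξ)))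
        - (Complex.I * ν) * ((wgt (r - 2 - (1 : ℕ)) ξ : ℂ) * ((ξ : ℂ) ^ 1 * c ξ)) := by
    ext ξ
    rw [hcdef, ← conv_self_sub ha2 hb2 ξ]
    simp only [kdv, pow_one]
    push_cast
    rw [show r - 2 - 1 = r - 3 by ring]
    ring
  rw [e]
  refine (n2_sub_le (h1.1.const_mul _) (h2.1.const_mul _)).trans ?_
  rw [n2_const_mul, n2_const_mul, norm_mul, norm_mul, Complex.norm_I, one_mul, one_mul,
    Complex.norm_real, Complex.norm_real, Real.norm_eq_abs, Real.norm_eq_abs]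
  simp only [← mul_sub]
  have hdn := n2_nonneg (fun ξ => (wgt r ξ : ℂ) * (a ξ - b ξ))
  have hal := algConst_nonneg (r - 2)
  calc _ ≤ |κ| * n2 (fun ξ => (wgt r ξ : ℂ) * (a ξ - b ξ)) + |ν| * (algConst (r - 2) *
        ((n2 (fun ξ => (wgt r ξ : ℂ) * a ξ) + n2 (fun ξ => (wgt r ξ : ℂ) * b ξ)) *
          n2 (fun ξ => (wgt r ξ : ℂ) * (a ξ - b ξ)))) := by
        gcongr
        · exact h1.2
        · refine h2.2.trans (hc.2.trans ?_)
          have k1 := (n2_wgt_mul_mono hr2 hp).trans hpn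
          have k2 := n2_wgt_mul_mono hr2 hd
          have k3 := n2_nonneg (fun ξ => (wgt (r - 2) ξ : ℂ) * (a ξ - b ξ))
          gcongr
          exact (n2_nonneg _).trans k1
    _ = _ := by ring

/-- The order -4 leaves enough room for the third derivative, and also for the first derivative
together with the factor |ξ|/n that bounds the truncation error. -/
theorem norm_wgt_neg_four_mul_pow_le {k : ℕ} (hk : k ≤ 4) (ξ : ℝ) (z : ℂ) :
    ‖(wgt (-4) ξ : ℂ) * ((ξ : ℂ) ^ k * z)‖ ≤ ‖z‖ := by
  have h1 := norm_wgt_mul_pow_mul_le (k - 4) ξ k z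
  rw [show ((k : ℝ) - 4 - k) = -4 by ring] at h1
  refine h1.trans ?_
  rw [norm_mul, norm_wgt]
  refine mul_le_of_le_one_left (norm_nonneg _) (wgt_le_one ?_ ξ)
  have : (k : ℝ) ≤ 4 := by exact_mod_cast hk
  linarith

/-- Consistency of the truncation. -/
theorem n2_gal_sub_kdv_le {n B : ℝ} (hn : 0 < n) {a b : ℝ → ℂ} (hbd : Band n a)
    (ha : MemLp (fun ξ => (wgt 1 ξ : ℂ) * a ξ) 2 volume)
    (hb : MemLp (fun ξ => (wgt 1 ξ : ℂ) * b ξ) 2 volume)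
    (hBa : n2 (fun ξ => (wgt 1 ξ : ℂ) * a ξ) ≤ B) (hBb : n2 (fun ξ => (wgt 1 ξ : ℂ) * b ξ) ≤ B) :
    n2 (fun ξ => (wgt (-4) ξ : ℂ) * gal κ ν n a ξ - (wgt (-4) ξ : ℂ) * kdv κ ν b ξ)
      ≤ (|κ| + |ν| * (2 * embConst 1 * B)) * n2 (fun ξ => a ξ - b ξ)
        + |ν| * (embConst 1 * B ^ 2) * (1 / n) := by
  have hB : 0 ≤ B := (n2_nonneg _).trans hBa
  have hem := embConst_nonneg 1
  have ha2 := memLp_of_wgt zero_le_one ha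
  have hb2 := memLp_of_wgt zero_le_one hb
  have hd2 : MemLp (fun ξ => a ξ - b ξ) 2 volume := ha2.sub hb2
  have hp2 : MemLp (fun ξ => a ξ + b ξ) 2 volume := ha2.add hb2
  have hp : MemLp (fun ξ => (wgt 1 ξ : ℂ) * (a ξ + b ξ)) 2 volume := by
    simpa only [mul_add] using! ha.add hb
  have hpn : n2 (fun ξ => (wgt 1 ξ : ℂ) * (a ξ + b ξ)) ≤ 2 * B := by
    have := n2_add_le ha hb
    simp only [← mul_add] at this
    linarith
  have hp1 := integrable_of_wgt (by norm_num : (1 : ℝ) / 2 < 1) hp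
  have hb1 := integrable_of_wgt (by norm_num : (1 : ℝ) / 2 < 1) hb
  have hc := memLp_conv hp1.1 hp2 hd2
  have hcb := memLp_conv hb1.1 hb2 hb2
  set c := conv (fun ξ => a ξ + b ξ) (fun ξ => a ξ - b ξ) with hcdef
  set f1 : ℝ → ℂ := fun ξ => (wgt (-4) ξ : ℂ) * ((ξ : ℂ) ^ 3 * (a ξ - b ξ)) with hf1
  set f2 : ℝ → ℂ := fun ξ => (wgt (-4) ξ : ℂ) * ((ξ : ℂ) ^ 1 * (chi n ξ * c ξ)) with hf2
  set f3 : ℝ → ℂ := fun ξ => (wgt (-4) ξ : ℂ) * ((ξ : ℂ) ^ 1 * ((1 - chi n ξ) * conv b b ξ)) with hf3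
  have e : (fun ξ => (wgt (-4) ξ : ℂ) * gal κ ν n a ξ - (wgt (-4) ξ : ℂ) * kdv κ ν b ξ)
      =ᵐ[volume] fun ξ => ((Complex.I * κ) * f1 ξ - (Complex.I * ν) * f2 ξ)
        + (Complex.I * ν) * f3 ξ := by
    filter_upwards [hbd.chi_mul] with ξ hξ
    simp only [hf1, hf2, hf3, hcdef, ← conv_self_sub ha2 hb2 ξ, gal, kdv]
    linear_combination (wgt (-4) ξ * Complex.I * κ * ξ ^ 3 : ℂ) * hξ
  have m4 : Measurable fun ξ => (wgt (-4) ξ : ℂ) := by fun_prop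
  have mp : ∀ k : ℕ, Measurable fun ξ : ℝ => (ξ : ℂ) ^ k := fun k => by fun_prop
  have b1 : ∀ ξ, ‖f1 ξ‖ ≤ 1 * ‖a ξ - b ξ‖ := fun ξ => by
    rw [one_mul]; exact norm_wgt_neg_four_mul_pow_le (by norm_num) ξ _
  have b2 : ∀ ξ, ‖f2 ξ‖ ≤ 1 * ‖c ξ‖ := fun ξ => by
    rw [one_mul]
    refine (norm_wgt_neg_four_mul_pow_le (by norm_num) ξ _).trans ?_
    rw [norm_mul]
    exact mul_le_of_le_one_left (norm_nonneg _) (norm_chi_le n ξ)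
  -- On the support of 1 − `chi n` one has n < |ξ|, so a second power of ξ is bought at the price
  -- 1/n.
  have b3 : ∀ ξ, ‖f3 ξ‖ ≤ 1 / n * ‖conv b b ξ‖ := fun ξ => by
    rcases le_or_gt |ξ| n with h | h
    · simp only [hf3, chi, if_pos h]
      simp only [Complex.ofReal_one, sub_self, zero_mul, mul_zero, norm_zero]
      positivity
    · have h1 := norm_wgt_neg_four_mul_pow_le (k := 2) (by norm_num) ξ (conv b b ξ)
      simp only [hf3, chi, if_neg (not_le.2 h)]
      rw [one_div, inv_mul_eq_div, le_div_iff₀ hn]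
      refine le_trans ?_ h1
      simp only [Complex.ofReal_zero, sub_zero, one_mul, norm_mul, Complex.norm_real,
        Real.norm_eq_abs, pow_one, pow_two]
      calc |wgt (-4) ξ| * (|ξ| * ‖conv b b ξ‖) * n
          = |wgt (-4) ξ| * (|ξ| * n * ‖conv b b ξ‖) := by ring
        _ ≤ _ := by gcongr
  have k1 : MemLp f1 2 volume := hd2.of_le_mul (m4.aestronglyMeasurable.mul
    ((mp 3).aestronglyMeasurable.mul hd2.1)) (ae_of_all _ b1)
  have k2 : MemLp f2 2 volume := hc.1.of_le_mul (m4.aestronglyMeasurable.mul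
    ((mp 1).aestronglyMeasurable.mul
      ((by fun_prop : Measurable fun ξ => (chi n ξ : ℂ)).aestronglyMeasurable.mul hc.1.1)))
    (ae_of_all _ b2)
  have k3 : MemLp f3 2 volume := hcb.1.of_le_mul (m4.aestronglyMeasurable.mul
    ((mp 1).aestronglyMeasurable.mul
      ((by fun_prop : Measurable fun ξ => (1 - chi n ξ : ℂ)).aestronglyMeasurable.mul hcb.1.1)))
    (ae_of_all _ b3)
  rw [n2_congr e]
  refine (n2_add_le ((k1.const_mul _).sub (k2.const_mul _)) (k3.const_mul _)).trans ?_
  have s1 := n2_sub_le (k1.const_mul (Complex.I * κ)) (k2.const_mul (Complex.I * ν))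
  have c1 := n2_le_mul_of_norm_le zero_le_one hd2 (ae_of_all _ b1)
  have c2 := n2_le_mul_of_norm_le zero_le_one hc.1 (ae_of_all _ b2)
  have c3 := n2_le_mul_of_norm_le (by positivity) hcb.1 (ae_of_all _ b3)
  rw [n2_const_mul, n2_const_mul, norm_mul, norm_mul, Complex.norm_I, one_mul, one_mul,
    Complex.norm_real, Complex.norm_real, Real.norm_eq_abs, Real.norm_eq_abs] at s1
  rw [n2_const_mul (Complex.I * ν) f3, norm_mul, Complex.norm_I, one_mul, Complex.norm_real,
    Real.norm_eq_abs]
  rw [one_mul] at c1 c2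
  have hdn := n2_nonneg (fun ξ => a ξ - b ξ)
  have d2 : n2 f2 ≤ 2 * embConst 1 * B * n2 (fun ξ => a ξ - b ξ) := by
    refine c2.trans (hc.2.trans (mul_le_mul_of_nonneg_right (hp1.2.trans ?_) hdn))
    calc _ ≤ embConst 1 * (2 * B) := by gcongr
      _ = _ := by ring
  have d3 : n2 f3 ≤ 1 / n * (embConst 1 * B ^ 2) := by
    refine c3.trans (mul_le_mul_of_nonneg_left (hcb.2.trans ?_) (by positivity))
    have := n2_le_n2_wgt_mul zero_le_one hb
    calc _ ≤ (embConst 1 * B) * B := by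
          refine mul_le_mul (hb1.2.trans (by gcongr)) (this.trans hBb) (n2_nonneg _) (by positivity)
      _ = _ := by ring
  calc _ ≤ |κ| * n2 f1 + |ν| * n2 f2 + |ν| * n2 f3 := add_le_add_left s1 _
    _ ≤ |κ| * n2 (fun ξ => a ξ - b ξ) + |ν| * (2 * embConst 1 * B * n2 (fun ξ => a ξ - b ξ))
        + |ν| * (1 / n * (embConst 1 * B ^ 2)) := by gcongr
    _ = _ := by ring

theorem herm_of_tendsto {b : ℕ → H} {c : H} (hb : Tendsto b atTop (𝓝 c)) (h : ∀ k, Herm (b k)) :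
    Herm c := by
  rw [herm_iff]
  have h1 : Tendsto (fun k => conjL (reflL (b k))) atTop (𝓝 (conjL (reflL c))) :=
    (conjL.continuous.tendsto _).comp ((reflL.continuous.tendsto _).comp hb)
  refine tendsto_nhds_unique h1 (hb.congr fun k => ?_)
  exact ((herm_iff _).1 (h k)).symm

end KdVApprox

end

/-! ### Local existence of strong solutions -/

noncomputable section

namespace KdVApprox

open ComplexConjugate

/-- A strong solution of the equation on the Fourier side. -/
structure IsFourierSolution (κ ν r T : ℝ) (a : ℝ → H) : Prop where
  herm : ∀ t ∈ Icc 0 T, Herm (a t)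
  memLp : ∀ t ∈ Icc 0 T, MemLp (fun ξ => (wgt r ξ : ℂ) * a t ξ) 2 volume
  continuous : ContinuousOn (fun t => toH fun ξ => (wgt r ξ : ℂ) * a t ξ) (Icc 0 T)
  deriv : ∀ t ∈ Icc 0 T, HasDerivWithinAt (fun t => toH fun ξ => (wgt (r - 3) ξ : ℂ) * a t ξ)
    (toH fun ξ => (wgt (r - 3) ξ : ℂ) * kdv κ ν (a t) ξ) (Icc 0 T) t

/-- The right-hand side of the equation is locally Lipschitz from order `r` to order `r - 3`.
Continuity of this derivative is what `hasDerivWithinAt_of_approx` requires. -/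
theorem continuousOn_kdv {κ ν r : ℝ} (hr : 5 / 2 < r) {a : ℝ → H} {S : Set ℝ}
    (hm : ∀ t ∈ S, MemLp (fun ξ => (wgt r ξ : ℂ) * a t ξ) 2 volume)
    (hc : ContinuousOn (fun t => toH fun ξ => (wgt r ξ : ℂ) * a t ξ) S) :
    ContinuousOn (fun t => toH fun ξ => (wgt (r - 3) ξ : ℂ) * kdv κ ν (a t) ξ) S := by
  intro t ht
  have h1 : ContinuousWithinAt (fun s => (|κ| + |ν| * (algConst (r - 2) *
      (‖toH fun ξ => (wgt r ξ : ℂ) * a s ξ‖ + ‖toH fun ξ => (wgt r ξ : ℂ) * a t ξ‖))) *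
      ‖(toH fun ξ => (wgt r ξ : ℂ) * a s ξ) - toH fun ξ => (wgt r ξ : ℂ) * a t ξ‖) S t :=
    (continuousWithinAt_const.add (continuousWithinAt_const.mul (continuousWithinAt_const.mul
      ((hc t ht).norm.add continuousWithinAt_const)))).mul
        ((hc t ht).sub continuousWithinAt_const).norm
  rw [ContinuousWithinAt, tendsto_iff_norm_sub_tendsto_zero]
  have h2 := h1.tendsto
  rw [sub_self, norm_zero, mul_zero] at h2
  refine squeeze_zero' (Eventually.of_forall fun _ => norm_nonneg _) ?_ h2
  filter_upwards [self_mem_nhdsWithin] with s hs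
  have k1 := memLp_wgt_kdv (κ := κ) (ν := ν) hr (hm s hs)
  have k2 := memLp_wgt_kdv (κ := κ) (ν := ν) hr (hm t ht)
  rw [norm_toH_sub k1 k2, norm_toH_sub (hm s hs) (hm t ht), norm_toH (hm s hs),
    norm_toH (hm t ht)]
  exact n2_wgt_kdv_sub_le hr (hm s hs) (hm t ht)

theorem continuousOn_of_uniform_approx {f : ℕ → ℝ → H} {g : ℝ → H} {S : Set ℝ} {δ : ℕ → ℝ}
    (hf : ∀ k, ContinuousOn (f k) S) (h : ∀ k, ∀ t ∈ S, ‖f k t - g t‖ ≤ δ k)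
    (hδ : Tendsto δ atTop (𝓝 0)) : ContinuousOn g S := by
  refine TendstoUniformlyOn.continuousOn (F := f) (p := atTop) ?_ (Frequently.of_forall hf)
  rw [Metric.tendstoUniformlyOn_iff]
  intro ε hε
  filter_upwards [hδ.eventually_lt_const hε] with k hk t ht
  rw [dist_comm, dist_eq_norm]
  exact (h k t ht).trans_lt hk

/-- Passage to the limit in the truncated equations. -/
theorem isFourierSolution_of_galerkin {κ ν r T B : ℝ} (hr : 5 / 2 < r) (hT : 0 ≤ T)
    {W : ℝ → ℝ} (hWm : Measurable W) (hWr : ∀ ε > 0, ∃ C ≥ 0, ∀ ξ, |wgt r ξ| ≤ ε * |W ξ| + C)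
    {a0 : ℝ → ℂ} (ha0 : MemLp (fun ξ => (wgt r ξ : ℂ) * a0 ξ) 2 volume) {a : ℕ → ℝ → H}
    (ha : ∀ k : ℕ, IsGalerkin κ ν (k + 1) T a0 (a k))
    (hW : ∀ k, ∀ t ∈ Icc 0 T, MemLp (fun ξ => (W ξ : ℂ) * a k t ξ) 2 volume)
    (hBW : ∀ k, ∀ t ∈ Icc 0 T, n2 (fun ξ => (W ξ : ℂ) * a k t ξ) ≤ B)
    {A : ℝ} (hA0 : n2 (fun ξ => (wgt r ξ : ℂ) * a0 ξ) ≤ A)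
    (hA : ∀ k, ∀ t ∈ Icc 0 T, n2 (fun ξ => (wgt r ξ : ℂ) * a k t ξ) ≤ A) :
    ∃ b : ℝ → H, b 0 = toH a0 ∧ IsFourierSolution κ ν r T b ∧
      ∀ t ∈ Icc 0 T, n2 (fun ξ => (wgt r ξ : ℂ) * b t ξ) ≤ A := by
  have hr0 : 0 ≤ r := by linarith
  have h0T : (0 : ℝ) ∈ Icc 0 T := ⟨le_rfl, hT⟩
  have hAnn : 0 ≤ A := (n2_nonneg _).trans hA0
  have ha02 := memLp_of_wgt hr0 ha0
  set C := √((A ^ 2 + 1) * Real.exp (2 * |ν| * (2 * embConst (r - 1) * A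
    + algConst 2 * A ^ 2) * T)) with hC
  have hCn : 0 ≤ C := Real.sqrt_nonneg _
  have hδ : Tendsto (fun k : ℕ => C / ((k : ℝ) + 1)) atTop (𝓝 0) := by
    have := (tendsto_one_div_add_atTop_nhds_zero_nat (𝕜 := ℝ)).const_mul C
    simpa [div_eq_mul_inv] using this
  have hcau : ∀ t ∈ Icc 0 T, ∀ n m : ℕ, n ≤ m → ‖a m t - a n t‖ ≤ C / ((n : ℝ) + 1) := by
    intro t ht n m hnm
    exact norm_sub_le_of_isGalerkin (by linarith) (ha m) (ha n) (by positivity)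
      (by gcongr) ha0 hA0 (hA m) (hA n) ht
  have hlim : ∀ t ∈ Icc 0 T, ∃ c, Tendsto (fun k => a k t) atTop (𝓝 c) := by
    intro t ht
    refine cauchySeq_tendsto_of_complete (cauchySeq_of_le_tendsto_0' _ (fun n m hnm => ?_) hδ)
    rw [dist_comm, dist_eq_norm]
    exact hcau t ht n m hnm
  choose! b hb using hlim
  have hrate : ∀ k, ∀ t ∈ Icc 0 T, ‖a k t - b t‖ ≤ C / ((k : ℝ) + 1) := by
    intro k t ht
    have h1 : Tendsto (fun m => ‖a m t - a k t‖) atTop (𝓝 ‖b t - a k t‖) :=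
      ((hb t ht).sub_const _).norm
    rw [norm_sub_rev]
    refine le_of_tendsto h1 ?_
    filter_upwards [eventually_ge_atTop k] with m hm
    exact hcau t ht k m hm
  have hbherm : ∀ t ∈ Icc 0 T, Herm (b t) := fun t ht =>
    herm_of_tendsto (hb t ht) fun k => (ha k).herm t ht
  have hbW : ∀ t ∈ Icc 0 T, MemLp (fun ξ => (W ξ : ℂ) * b t ξ) 2 volume ∧
      n2 (fun ξ => (W ξ : ℂ) * b t ξ) ≤ B := fun t ht =>
    memLp_weight_of_tendsto hWm (hb t ht) (fun k => hW k t ht) fun k => hBW k t ht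
  have hbr : ∀ t ∈ Icc 0 T, MemLp (fun ξ => (wgt r ξ : ℂ) * b t ξ) 2 volume ∧
      n2 (fun ξ => (wgt r ξ : ℂ) * b t ξ) ≤ A := fun t ht =>
    memLp_weight_of_tendsto (measurable_wgt r) (hb t ht)
      (fun k => (ha k).memLp_weight (IsWeight.wgt hr0) ht) fun k => hA k t ht
  have hbcont : ContinuousOn b (Icc 0 T) :=
    continuousOn_of_uniform_approx (fun k t ht => ((ha k).deriv t ht).continuousWithinAt) hrate hδ
  -- Uniform convergence gives continuity in `L²` only. The bound in the stronger weight `W`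
  -- upgrades it to continuity in `Hʳ`.
  have hbrc : ContinuousOn (fun t => toH fun ξ => (wgt r ξ : ℂ) * b t ξ) (Icc 0 T) :=
    continuousOn_weight (measurable_wgt r) hWr hbcont (fun t ht => (hbW t ht).1)
      fun t ht => (hbW t ht).2
  have hb0 : b 0 = toH a0 := by
    refine tendsto_nhds_unique (hb 0 h0T) ?_
    rw [tendsto_iff_norm_sub_tendsto_zero]
    refine squeeze_zero (fun _ => norm_nonneg _) (fun k => ?_)
      (g := fun k : ℕ => A / ((k : ℝ) + 1)) ?_
    · rw [(ha k).initial, toH_sub (memLp_chi_mul _ ha02) ha02,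
        norm_toH (by exact (memLp_chi_mul _ ha02).sub ha02), div_eq_inv_mul]
      refine (n2_le_mul_of_norm_le (by positivity) ha0 (ae_of_all _ fun ξ => ?_)).trans
        (mul_le_mul_of_nonneg_left hA0 (by positivity))
      rcases le_or_gt |ξ| ((k : ℝ) + 1) with h | h
      · simp only [chi, if_pos h, Complex.ofReal_one, one_mul, sub_self, norm_zero]
        positivity
      · simp only [chi, if_neg (not_le.2 h), Complex.ofReal_zero, zero_mul, zero_sub, norm_neg]
        rw [norm_mul, norm_wgt, ← mul_assoc]
        refine le_mul_of_one_le_left (norm_nonneg _) ?_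
        rw [inv_mul_eq_div, le_div_iff₀ (by positivity), one_mul]
        exact h.le.trans ((abs_le_wgt_one ξ).trans (wgt_mono (by linarith) ξ))
    · have := (tendsto_one_div_add_atTop_nhds_zero_nat (𝕜 := ℝ)).const_mul A
      simpa [div_eq_mul_inv] using this
  refine ⟨b, hb0, ⟨hbherm, fun t ht => (hbr t ht).1, hbrc, ?_⟩, fun t ht => (hbr t ht).2⟩
  have hr1 : 0 ≤ r + 1 := by linarith
  have hM4 : ∀ c : H, mulW 4 (by norm_num) c = toH fun ξ => (wgt (-4) ξ : ℂ) * c ξ :=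
    fun c => eq_toH (mulW_coe _ _ c)
  have h3 : ∀ t ∈ Icc 0 T, MemLp (fun ξ => (wgt (r - 3) ξ : ℂ) * b t ξ) 2 volume := fun t ht =>
    memLp_wgt_mul_of_le (by linarith) (hbr t ht).1
  -- The equations are compared at order -4 = (r − 3) − (r + 1), where the truncated right-hand
  -- sides converge uniformly in time. The limit equation is then recovered at order `r - 3`.
  refine hasDerivWithinAt_of_approx (injective_mulW (r + 1) hr1) hT
    (f := fun k t => mulW 4 (by norm_num) (a k t))
    (g := fun k t => mulW 4 (by norm_num) (toH (gal κ ν ((k : ℝ) + 1) (a k t))))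
    (δ := fun k : ℕ => (|κ| + |ν| * (2 * embConst 1 * A)) * (C / ((k : ℝ) + 1))
      + |ν| * (embConst 1 * A ^ 2) * (1 / ((k : ℝ) + 1)))
    (continuousOn_kdv hr (fun t ht => (hbr t ht).1) hbrc) (fun t ht => ?_)
    (fun k t ht => hasDerivWithinAt_clm _ ((ha k).deriv t ht)) (fun k t ht => ?_) ?_
  · rw [mulW_toH hr1 (h3 t ht) (q := -4) (by ring), ← hM4]
    exact ((mulW 4 _).continuous.tendsto _).comp (hb t ht)
  · have hk := memLp_wgt_kdv (κ := κ) (ν := ν) hr (hbr t ht).1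
    have hgm := memLp_gal (κ := κ) (ν := ν) (Lp.memLp (a k t)) ((ha k).band t ht)
    have hg4 : MemLp (fun ξ => (wgt (-4) ξ : ℂ) * gal κ ν ((k : ℝ) + 1) (a k t) ξ) 2 volume :=
      memLp_wgt_mul_of_le (by norm_num) (r' := 0) (by simpa [wgt_zero] using hgm)
    have hk4 : MemLp (fun ξ => (wgt (-4) ξ : ℂ) * kdv κ ν (b t) ξ) 2 volume :=
      memLp_wgt_mul_of_le (by linarith) hk
    have e : mulW 4 (by norm_num) (toH (gal κ ν ((k : ℝ) + 1) (a k t)))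
        = toH fun ξ => (wgt (-4) ξ : ℂ) * gal κ ν ((k : ℝ) + 1) (a k t) ξ := by
      rw [hM4]
      refine toH_congr ?_
      filter_upwards [toH_coe hgm] with ξ hξ
      rw [hξ]
    rw [mulW_toH hr1 hk (q := -4) (by ring), e, toH_sub hg4 hk4, norm_toH (by exact hg4.sub hk4)]
    have hak := (ha k).memLp_weight (IsWeight.wgt hr0) ht
    have hr11 : (1 : ℝ) ≤ r := by linarith
    refine (n2_gal_sub_kdv_le (B := A) (by positivity) ((ha k).band t ht)
      (memLp_wgt_mul_of_le hr11 hak) (memLp_wgt_mul_of_le hr11 (hbr t ht).1)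
      ((n2_wgt_mul_mono hr11 hak).trans (hA k t ht))
      ((n2_wgt_mul_mono hr11 (hbr t ht).1).trans (hbr t ht).2)).trans ?_
    rw [n2_sub_coe]
    have := hrate k t ht
    have := embConst_nonneg 1
    gcongr
  · have := ((hδ.const_mul (|κ| + |ν| * (2 * embConst 1 * A))).add
      ((tendsto_one_div_add_atTop_nhds_zero_nat (𝕜 := ℝ)).const_mul (|ν| * (embConst 1 * A ^ 2))))
    simpa using this

/-- The energy estimate is used twice. With `W = wgt r * ω` it fixes the time interval, bounds the
Lipschitz norm, and controls the high frequencies uniformly, which gives continuity in `Hʳ`. With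
`wgt r` alone it is now linear and yields the factor 2, however large the norm for `W` is; the price
is paid by `T`. -/
theorem exists_isFourierSolution (κ ν : ℝ) {r : ℝ} (hr : 5 / 2 < r) (u0 : L2)
    (h0 : MemLp (fun ξ => (wgt r ξ : ℂ) * hat u0 ξ) 2 volume) :
    ∃ T > 0, ∃ b : ℝ → H, b 0 = hat u0 ∧ IsFourierSolution κ ν r T b ∧
      ∀ t ∈ Icc 0 T, n2 (fun ξ => (wgt r ξ : ℂ) * b t ξ)
        ≤ 2 * n2 (fun ξ => (wgt r ξ : ℂ) * hat u0 ξ) := by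
  have hr0 : 0 ≤ r := by linarith
  obtain ⟨ω, hω, hωm, hωK⟩ := exists_growing_weight h0
  set W : ℝ → ℝ := fun ξ => wgt r ξ * ω ξ with hWdef
  have hWr := IsWeight.wgt hr0
  have hW : IsWeight W (⌈r⌉₊ + 1) := hWr.mul hω
  have hle : ∀ ξ, wgt r ξ ≤ W ξ := fun ξ => le_mul_of_one_le_right (wgt_pos r ξ).le (hω.one_le ξ)
  have hW0 : MemLp (fun ξ => (W ξ : ℂ) * hat u0 ξ) 2 volume := by
    refine hωm.ae_eq (ae_of_all _ fun ξ => ?_)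
    simp only [hWdef]
    push_cast
    ring
  have hcmp : ∀ ε > 0, ∃ C ≥ 0, ∀ ξ, |wgt r ξ| ≤ ε * |W ξ| + C := by
    intro ε hε
    obtain ⟨R, hR⟩ := hωK (1 / ε)
    refine ⟨wgt r R, (wgt_pos _ _).le, fun ξ => ?_⟩
    rw [abs_of_pos (wgt_pos r ξ), abs_of_pos (hW.pos ξ)]
    rcases le_or_gt (ω ξ) (1 / ε) with h | h
    · have h1 := hWr.le_of_abs_le (hR ξ h)
      have h2 := mul_pos hε (hW.pos ξ)
      linarith
    · have h1 : 1 ≤ ε * ω ξ := by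
        rw [div_lt_iff₀ hε] at h
        linarith
      have h2 : wgt r ξ ≤ ε * W ξ := by
        simp only [hWdef]
        nlinarith [wgt_pos r ξ]
      linarith [wgt_pos r R]
  set E := n2 (fun ξ => (W ξ : ℂ) * hat u0 ξ) ^ 2 with hE
  have hE0 : 0 ≤ E := sq_nonneg _
  set C1 := 2 * |ν| * IsWeight.const (⌈r⌉₊ + 1) * embConst (r - 1) with hC1
  have hem := embConst_nonneg (r - 1)
  have hc1 := (IsWeight.const_pos (⌈r⌉₊ + 1)).le
  have hc2 := (IsWeight.const_pos ⌈r⌉₊).le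
  have hC1n : 0 ≤ C1 := by positivity
  set B := √(4 * (E + 1)) with hB
  have hBn : 0 ≤ B := Real.sqrt_nonneg _
  set C2 := 2 * |ν| * IsWeight.const ⌈r⌉₊ * (embConst (r - 1) * B) with hC2
  have hC2n : 0 ≤ C2 := by positivity
  -- The first bound closes the cubic inequality for `W`, the second makes the exponent of the
  -- linear estimate at most 1. The summands 1 in the denominators exclude division by zero.
  set T := min ((E + 1) ^ (-1 / 2 : ℝ) / (C1 + 1)) (1 / (C2 + 1)) with hT
  have hTpos : 0 < T := lt_min (by positivity) (by positivity)
  have hT1 : C1 * T ≤ (E + 1) ^ (-1 / 2 : ℝ) := by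
    have h1 : T ≤ (E + 1) ^ (-1 / 2 : ℝ) / (C1 + 1) := min_le_left _ _
    rw [le_div_iff₀ (by positivity)] at h1
    nlinarith
  have hT2 : C2 * T ≤ 1 := by
    have h1 : T ≤ 1 / (C2 + 1) := min_le_right _ _
    rw [le_div_iff₀ (by positivity)] at h1
    nlinarith
  have hg : ∀ k : ℕ, ∃ a : ℝ → H, IsGalerkin κ ν (k + 1) T (hat u0) a := fun k =>
    exists_isGalerkin κ ν (by positivity) u0 hTpos.le
  choose a ha using hg
  have hBW : ∀ k, ∀ t ∈ Icc 0 T, n2 (fun ξ => (W ξ : ℂ) * a k t ξ) ≤ B := fun k t ht =>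
    Real.le_sqrt_of_sq_le ((ha k).n2_weight_le (memLp_hat u0) (by linarith) hW hle hW0 hT1 ht)
  have hA : ∀ k, ∀ t ∈ Icc 0 T, n2 (fun ξ => (wgt r ξ : ℂ) * a k t ξ)
      ≤ 2 * n2 (fun ξ => (wgt r ξ : ℂ) * hat u0 ξ) := fun k t ht =>
    (ha k).n2_weight_le_two_mul (memLp_hat u0) hWr h0 (fun t ht =>
      ((ha k).n1_id_mul_le (by linarith) hW hle ht).trans
        (mul_le_mul_of_nonneg_left (hBW k t ht) hem)) hT2 ht
  obtain ⟨b, hb0, hb, hbA⟩ := isFourierSolution_of_galerkin hr hTpos.le hW.measurable hcmp h0 ha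
    (fun k t ht => (ha k).memLp_weight hW ht) hBW (by linarith [n2_nonneg fun ξ => (wgt r ξ : ℂ) * hat u0 ξ]) hA
  refine ⟨T, hTpos, b, ?_, hb, hbA⟩
  rw [hb0]
  exact (eq_toH (ae_eq_refl _)).symm

end KdVApprox

end

noncomputable section

namespace KdVApprox

open ComplexConjugate

/-! ### Uniqueness on the Fourier side -/

/-- A product rule across a duality, for `f` and `g` which represent one curve at dual orders, `E`
being its squared `L²` norm. Because the increment of `E` pairs a sum with a difference, it is
enough that `f` is continuous and `g` differentiable. -/
theorem hasDerivWithinAt_of_polarization {f g : ℝ → H} {g' : H} {E : ℝ → ℝ} {S : Set ℝ} {t : ℝ}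
    (hE : ∀ σ ∈ S, E σ - E t = (inner ℂ (f σ + f t) (g σ - g t)).re)
    (hf : ContinuousWithinAt f S t) (hg : HasDerivWithinAt g g' S t) :
    HasDerivWithinAt E (2 * (inner ℂ (f t) g').re) S t := by
  rw [hasDerivWithinAt_iff_tendsto_slope] at hg ⊢
  have h1 : Tendsto (fun σ => (inner ℂ (f σ + f t) (slope g t σ)).re) (𝓝[S \ {t}] t)
      (𝓝 (inner ℂ (f t + f t) g').re) :=
    (Complex.continuous_re.tendsto _).comp
      (((hf.tendsto.mono_left (nhdsWithin_mono _ sdiff_subset)).add_const (f t)).inner hg)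
  rw [inner_add_left, Complex.add_re, ← two_mul] at h1
  refine h1.congr' ?_
  filter_upwards [self_mem_nhdsWithin] with σ hσ
  rw [slope_def_module, slope_def_field, hE σ hσ.1, RCLike.real_smul_eq_coe_smul (K := ℂ),
    inner_smul_right, div_eq_inv_mul]
  exact Complex.re_ofReal_mul _ _

theorem re_inner_add_sub (x y : H) : (inner ℂ (x + y) (x - y)).re = ‖x‖ ^ 2 - ‖y‖ ^ 2 := by
  rw [inner_add_left, inner_sub_right, inner_sub_right, Complex.add_re, Complex.sub_re,
    Complex.sub_re, ← inner_conj_symm y x, Complex.conj_re]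
  have h1 : (inner ℂ x x).re = ‖x‖ ^ 2 := inner_self_eq_norm_sq (𝕜 := ℂ) x
  have h2 : (inner ℂ y y).re = ‖y‖ ^ 2 := inner_self_eq_norm_sq (𝕜 := ℂ) y
  rw [h1, h2]
  ring

theorem inner_toH_toH {f g : ℝ → ℂ} (hf : MemLp f 2 volume) (hg : MemLp g 2 volume) :
    inner ℂ (toH f) (toH g) = ∫ ξ, conj (f ξ) * g ξ := by
  rw [inner_H]
  apply integral_congr_ae
  filter_upwards [toH_coe hf, toH_coe hg] with ξ h1 h2
  rw [h1, h2]

/-- The dispersive part is skew, and the quadratic difference is a transport term with coefficient p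
= a + b, to which `norm_integral_transport_le` applies. -/
theorem re_integral_conj_mul_kdv_sub_le {κ ν r : ℝ} (hr : 5 / 2 < r) {a b : ℝ → ℂ}
    (ha : MemLp (fun ξ => (wgt r ξ : ℂ) * a ξ) 2 volume)
    (hb : MemLp (fun ξ => (wgt r ξ : ℂ) * b ξ) 2 volume) (ha' : Herm a) (hb' : Herm b) :
    (∫ ξ, conj (a ξ - b ξ) * (kdv κ ν a ξ - kdv κ ν b ξ)).re
      ≤ |ν| * (embConst (r - 1) * (n2 (fun ξ => (wgt r ξ : ℂ) * a ξ)
        + n2 (fun ξ => (wgt r ξ : ℂ) * b ξ))) * n2 (fun ξ => a ξ - b ξ) ^ 2 := by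
  have hr0 : 0 ≤ r := by linarith
  have ha2 := memLp_of_wgt hr0 ha
  have hb2 := memLp_of_wgt hr0 hb
  set z : ℝ → ℂ := fun ξ => a ξ - b ξ with hz
  set p : ℝ → ℂ := fun ξ => a ξ + b ξ with hp
  have hz2 : MemLp z 2 volume := ha2.sub hb2
  have hp2 : MemLp p 2 volume := ha2.add hb2
  have hwz : MemLp (fun ξ => (wgt r ξ : ℂ) * z ξ) 2 volume := by
    simpa only [hz, mul_sub] using! ha.sub hb
  have hwp : MemLp (fun ξ => (wgt r ξ : ℂ) * p ξ) 2 volume := by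
    simpa only [hp, mul_add] using! ha.add hb
  have hwpn : n2 (fun ξ => (wgt r ξ : ℂ) * p ξ) ≤ n2 (fun ξ => (wgt r ξ : ℂ) * a ξ)
        + n2 (fun ξ => (wgt r ξ : ℂ) * b ξ) := by
    have := n2_add_le ha hb
    simpa only [hp, mul_add] using this
  have hdz : MemLp (fun ξ : ℝ => (ξ : ℂ) * z ξ) 2 volume :=
    memLp_of_wgt (by linarith) (memLp_wgt_id_mul hwz).1
  have hdp : MemLp (fun ξ : ℝ => (ξ : ℂ) * p ξ) 2 volume :=
    memLp_of_wgt (by linarith) (memLp_wgt_id_mul hwp).1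
  have hp1 := integrable_of_wgt (by linarith) hwp
  have hdp1 := integrable_id_mul_of_wgt (by linarith) hwp
  have h2z : MemLp (fun ξ : ℝ => (ξ : ℂ) ^ 2 * z ξ) 2 volume :=
    memLp_of_wgt (by push_cast; linarith) (memLp_wgt_mul_pow_mul 2 hwz).1
  have i1 : Integrable (fun ξ : ℝ => Complex.I * ((κ * ξ ^ 3 * ‖z ξ‖ ^ 2 : ℝ) : ℂ)) volume := by
    refine ((h2z.integrable_mul (memLp_conj hdz)).const_mul (Complex.I * κ)).congr
      (ae_of_all _ fun ξ => ?_)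
    have hnz : ((‖z ξ‖ ^ 2 : ℝ) : ℂ) = z ξ * conj (z ξ) := by
      rw [Complex.mul_conj, Complex.normSq_eq_norm_sq]
    change Complex.I * κ * ((ξ : ℂ) ^ 2 * z ξ * conj ((ξ : ℂ) * z ξ))
      = Complex.I * ((κ * ξ ^ 3 * ‖z ξ‖ ^ 2 : ℝ) : ℂ)
    rw [Complex.ofReal_mul _ (‖z ξ‖ ^ 2), hnz]
    simp only [map_mul, Complex.conj_ofReal]
    push_cast
    ring
  have i2 : Integrable (fun ξ : ℝ => -(Complex.I * ν) * ((ξ : ℂ) * (conj (z ξ) * conv p z ξ)))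
      volume := by
    refine ((integrable_mul_conv (memLp_conj hdz) hp1.1 hp2 hz2).const_mul (-(Complex.I * ν))).congr
      (ae_of_all _ fun ξ => ?_)
    simp only [map_mul, Complex.conj_ofReal]
    ring
  have e : ∫ ξ, conj (z ξ) * (kdv κ ν a ξ - kdv κ ν b ξ)
      = (∫ ξ : ℝ, Complex.I * ((κ * ξ ^ 3 * ‖z ξ‖ ^ 2 : ℝ) : ℂ))
        + ∫ ξ : ℝ, -(Complex.I * ν) * ((ξ : ℂ) * (conj (z ξ) * conv p z ξ)) := by
    rw [← integral_add i1 i2]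
    congr 1
    ext ξ
    have hnz : ((‖z ξ‖ ^ 2 : ℝ) : ℂ) = z ξ * conj (z ξ) := by
      rw [Complex.mul_conj, Complex.normSq_eq_norm_sq]
    have hc : conv a a ξ - conv b b ξ = conv p z ξ := conv_self_sub ha2 hb2 ξ
    have hz' : z ξ = a ξ - b ξ := rfl
    rw [Complex.ofReal_mul _ (‖z ξ‖ ^ 2), hnz, ← hc, hz']
    simp only [kdv]
    push_cast
    ring
  rw [e, Complex.add_re, integral_const_mul, integral_complex_ofReal, integral_const_mul]
  have h0 : (Complex.I * ((∫ ξ : ℝ, κ * ξ ^ 3 * ‖z ξ‖ ^ 2 : ℝ) : ℂ)).re = 0 := by simp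
  rw [h0, zero_add]
  refine (Complex.re_le_norm _).trans ?_
  rw [norm_mul, norm_neg, norm_mul, Complex.norm_I, one_mul, Complex.norm_real, Real.norm_eq_abs,
    mul_assoc]
  gcongr
  refine (norm_integral_transport_le hz2 (ha'.sub hb') hdz hp1.1 hp2 hdp1.1 hdp).trans ?_
  gcongr
  exact hdp1.2.trans (mul_le_mul_of_nonneg_left hwpn (embConst_nonneg _))

namespace IsFourierSolution

variable {κ ν r T : ℝ} {a b : ℝ → H}

theorem congr (h : IsFourierSolution κ ν r T a) (hab : ∀ t ∈ Icc 0 T, b t = a t) :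
    IsFourierSolution κ ν r T b where
  herm t ht := by rw [hab t ht]; exact h.herm t ht
  memLp t ht := by rw [hab t ht]; exact h.memLp t ht
  continuous := h.continuous.congr fun t ht => by simp only [hab t ht]
  deriv t ht := by
    rw [hab t ht]
    exact (h.deriv t ht).congr (fun s hs => by simp only [hab s hs]) (by simp only [hab t ht])

theorem mono (h : IsFourierSolution κ ν r T a) {T' : ℝ} (hT : T' ≤ T) :
    IsFourierSolution κ ν r T' a where
  herm t ht := h.herm t ⟨ht.1, ht.2.trans hT⟩
  memLp t ht := h.memLp t ⟨ht.1, ht.2.trans hT⟩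
  continuous := h.continuous.mono (Icc_subset_Icc_right hT)
  deriv t ht := (h.deriv t ⟨ht.1, ht.2.trans hT⟩).mono (Icc_subset_Icc_right hT)

theorem exists_bound (h : IsFourierSolution κ ν r T a) :
    ∃ B, ∀ t ∈ Icc 0 T, n2 (fun ξ => (wgt r ξ : ℂ) * a t ξ) ≤ B := by
  obtain ⟨B, hB⟩ := isCompact_Icc.exists_bound_of_continuousOn h.continuous
  refine ⟨B, fun t ht => ?_⟩
  rw [← norm_toH (h.memLp t ht)]
  exact hB t ht

theorem unique (hr : 5 / 2 < r) (ha : IsFourierSolution κ ν r T a)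
    (hb : IsFourierSolution κ ν r T b) (h0 : a 0 = b 0) : ∀ t ∈ Icc 0 T, a t = b t := by
  have hr0 : 0 ≤ r := by linarith
  have h2r : 0 ≤ 2 * r - 3 := by linarith
  obtain ⟨A, hA⟩ := ha.exists_bound
  obtain ⟨B, hB⟩ := hb.exists_bound
  -- Lowering the order `r` by 2r − 3 leads to 3 − r, the dual of the order r − 3 at which the time
  -- derivative exists. Continuity of `f` is thus inherited from continuity in `Hʳ`.
  set f : ℝ → H := fun t => mulW (2 * r - 3) h2r ((toH fun ξ => (wgt r ξ : ℂ) * a t ξ)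
    - toH fun ξ => (wgt r ξ : ℂ) * b t ξ) with hf
  have hfc : ContinuousOn f (Icc 0 T) :=
    (mulW (2 * r - 3) h2r).continuous.comp_continuousOn (ha.continuous.sub hb.continuous)
  have h3 : ∀ {c : ℝ → H}, IsFourierSolution κ ν r T c → ∀ t ∈ Icc 0 T,
      MemLp (fun ξ => (wgt (3 - r) ξ : ℂ) * c t ξ) 2 volume := fun hc t ht =>
    memLp_wgt_mul_of_le (by linarith) (hc.memLp t ht)
  have h3' : ∀ {c : ℝ → H}, IsFourierSolution κ ν r T c → ∀ t ∈ Icc 0 T,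
      MemLp (fun ξ => (wgt (r - 3) ξ : ℂ) * c t ξ) 2 volume := fun hc t ht =>
    memLp_wgt_mul_of_le (by linarith) (hc.memLp t ht)
  have hfe : ∀ t ∈ Icc 0 T, f t = (toH fun ξ => (wgt (3 - r) ξ : ℂ) * a t ξ)
      - toH fun ξ => (wgt (3 - r) ξ : ℂ) * b t ξ := by
    intro t ht
    simp only [hf]
    rw [map_sub, mulW_toH h2r (ha.memLp t ht) (q := 3 - r) (by ring),
      mulW_toH h2r (hb.memLp t ht) (q := 3 - r) (by ring)]
  set g : ℝ → H := fun t => (toH fun ξ => (wgt (r - 3) ξ : ℂ) * a t ξ)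
    - toH fun ξ => (wgt (r - 3) ξ : ℂ) * b t ξ with hg
  have hw : ∀ ξ, (wgt (3 - r) ξ : ℂ) * wgt (r - 3) ξ = 1 := by
    intro ξ
    rw [← Complex.ofReal_mul, ← wgt_add, show 3 - r + (r - 3) = 0 by ring, wgt_zero,
      Complex.ofReal_one]
  have hE : ∀ t ∈ Icc 0 T, ∀ σ ∈ Icc 0 T, ‖a σ - b σ‖ ^ 2 - ‖a t - b t‖ ^ 2
      = (inner ℂ (f σ + f t) (g σ - g t)).re := by
    intro t ht σ hσ
    have e1 : inner ℂ (f σ + f t) (g σ - g t)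
        = inner ℂ ((a σ - b σ) + (a t - b t)) ((a σ - b σ) - (a t - b t)) := by
      rw [hfe σ hσ, hfe t ht, inner_H, inner_H]
      apply integral_congr_ae
      simp only [hg]
      rw [toH_sub (h3 ha σ hσ) (h3 hb σ hσ), toH_sub (h3 ha t ht) (h3 hb t ht),
        toH_sub (h3' ha σ hσ) (h3' hb σ hσ), toH_sub (h3' ha t ht) (h3' hb t ht)]
      have mm : ∀ (q s : ℝ), MemLp (fun ξ => (wgt q ξ : ℂ) * a s ξ) 2 volume →
          MemLp (fun ξ => (wgt q ξ : ℂ) * b s ξ) 2 volume →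
          MemLp (fun ξ => (wgt q ξ : ℂ) * a s ξ - (wgt q ξ : ℂ) * b s ξ) 2 volume :=
        fun _ _ h h' => h.sub h'
      have m1 := mm _ _ (h3 ha σ hσ) (h3 hb σ hσ)
      have m2 := mm _ _ (h3 ha t ht) (h3 hb t ht)
      have m3 := mm _ _ (h3' ha σ hσ) (h3' hb σ hσ)
      have m4 := mm _ _ (h3' ha t ht) (h3' hb t ht)
      rw [toH_add m1 m2, toH_sub m3 m4]
      filter_upwards [toH_coe (m1.add m2), toH_coe (m3.sub m4),
        Lp.coeFn_add (a σ - b σ) (a t - b t), Lp.coeFn_sub (a σ - b σ) (a t - b t),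
        Lp.coeFn_sub (a σ) (b σ), Lp.coeFn_sub (a t) (b t)] with ξ k1 k2 k3 k4 k5 k6
      rw [k3, k4, Pi.add_apply, Pi.sub_apply, k5, k6]
      refine (congrArg₂ (fun x y => conj x * y) k1 k2).trans ?_
      simp only [Pi.add_apply, Pi.sub_apply, map_add, map_sub, map_mul, Complex.conj_ofReal]
      linear_combination (conj (a σ ξ) - conj (b σ ξ) + (conj (a t ξ) - conj (b t ξ))) *
        (a σ ξ - b σ ξ - (a t ξ - b t ξ)) * hw ξ
    rw [e1, re_inner_add_sub]
  have hd : ∀ t ∈ Icc 0 T, ∃ D : ℝ, HasDerivWithinAt (fun t => ‖a t - b t‖ ^ 2) D (Icc 0 T) t ∧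
      D ≤ (2 * (|ν| * (embConst (r - 1) * (A + B)))) * ‖a t - b t‖ ^ 2 := by
    intro t ht
    refine ⟨_, hasDerivWithinAt_of_polarization (hE t ht) (hfc t ht)
      ((ha.deriv t ht).sub (hb.deriv t ht)), ?_⟩
    have ka := memLp_wgt_kdv (κ := κ) (ν := ν) hr (ha.memLp t ht)
    have kb := memLp_wgt_kdv (κ := κ) (ν := ν) hr (hb.memLp t ht)
    rw [hfe t ht, toH_sub (h3 ha t ht) (h3 hb t ht), toH_sub ka kb,
      inner_toH_toH (by exact (h3 ha t ht).sub (h3 hb t ht)) (by exact ka.sub kb)]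
    have e : ∫ ξ, conj ((wgt (3 - r) ξ : ℂ) * a t ξ - (wgt (3 - r) ξ : ℂ) * b t ξ) *
        ((wgt (r - 3) ξ : ℂ) * kdv κ ν (a t) ξ - (wgt (r - 3) ξ : ℂ) * kdv κ ν (b t) ξ)
        = ∫ ξ, conj (a t ξ - b t ξ) * (kdv κ ν (a t) ξ - kdv κ ν (b t) ξ) := by
      congr 1
      ext ξ
      simp only [map_sub, map_mul, Complex.conj_ofReal]
      linear_combination (conj (a t ξ) - conj (b t ξ)) * (kdv κ ν (a t) ξ - kdv κ ν (b t) ξ) * hw ξ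
    rw [e]
    have key := re_integral_conj_mul_kdv_sub_le (κ := κ) (ν := ν) hr (ha.memLp t ht)
      (hb.memLp t ht) (ha.herm t ht) (hb.herm t ht)
    rw [n2_sub_coe] at key
    have h1 := hA t ht
    have h2 := hB t ht
    have hem := embConst_nonneg (r - 1)
    have : |ν| * (embConst (r - 1) * (n2 (fun ξ => (wgt r ξ : ℂ) * a t ξ)
        + n2 (fun ξ => (wgt r ξ : ℂ) * b t ξ))) * ‖a t - b t‖ ^ 2
        ≤ |ν| * (embConst (r - 1) * (A + B)) * ‖a t - b t‖ ^ 2 := by gcongr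
    linarith
  choose! D hD1 hD2 using hd
  intro t ht
  have key := le_mul_exp_of_deriv_le hD1 hD2 t ht
  rw [h0, sub_self, norm_zero] at key
  have h1 : ‖a t - b t‖ ^ 2 ≤ 0 := by simpa using key
  have h2 : ‖a t - b t‖ = 0 := by nlinarith [norm_nonneg (a t - b t)]
  exact sub_eq_zero.1 (norm_eq_zero.1 h2)

end IsFourierSolution

end KdVApprox

end

noncomputable section

namespace KdVApprox

open ComplexConjugate

/-! ### Sobolev regularity of curves on the Fourier side -/

theorem enorm_toH {f : ℝ → ℂ} (h : MemLp f 2 volume) : ‖toH f‖ₑ = eLpNorm f 2 volume := by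
  rw [Lp.enorm_def, eLpNorm_congr_ae (toH_coe h)]

theorem memSobolev_toDist_iff (r : ℝ) (f : L2) :
    MemSobolev r 2 (toDist f) ↔ MemLp (fun ξ => (wgt r ξ : ℂ) * hat f ξ) 2 volume :=
  (hasFourier_toDist f).memSobolev_iff r

theorem hNorm_toDist_sub {r : ℝ} {f g : L2}
    (hf : MemLp (fun ξ => (wgt r ξ : ℂ) * hat f ξ) 2 volume)
    (hg : MemLp (fun ξ => (wgt r ξ : ℂ) * hat g ξ) 2 volume) :
    hNorm r (toDist (f - g)) = ‖(toH fun ξ => (wgt r ξ : ℂ) * hat f ξ)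
      - toH fun ξ => (wgt r ξ : ℂ) * hat g ξ‖ₑ := by
  rw [toH_sub hf hg, enorm_toH (by exact hf.sub hg), (hasFourier_toDist (f - g)).hNorm_eq, map_sub]
  refine eLpNorm_congr_ae ?_
  filter_upwards [Lp.coeFn_sub (hat f) (hat g)] with ξ h
  rw [h, Pi.sub_apply, mul_sub]

theorem continuousInH_iff {X : Type*} [TopologicalSpace X] {r : ℝ} {v : X → L2} {A : Set X} :
    ContinuousInH r v A ↔ (∀ a ∈ A, MemLp (fun ξ => (wgt r ξ : ℂ) * hat (v a) ξ) 2 volume) ∧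
      ContinuousOn (fun a => toH fun ξ => (wgt r ξ : ℂ) * hat (v a) ξ) A := by
  simp only [ContinuousInH, memSobolev_toDist_iff]
  refine and_congr_right fun hm => ?_
  refine forall₂_congr fun a ha => ?_
  rw [ContinuousWithinAt, tendsto_iff_edist_tendsto_0]
  refine tendsto_congr' ?_
  filter_upwards [self_mem_nhdsWithin] with b hb
  rw [edist_eq_enorm_sub, hNorm_toDist_sub (hm b hb) (hm a ha)]

theorem hasDerivInH_iff {r : ℝ} {v : ℝ → L2} {D : 𝓢'(ℝ, ℂ)} {d : ℝ → ℂ} {S : Set ℝ} {t : ℝ}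
    (hD : HasFourier D d) (hd : MemLp (fun ξ => (wgt r ξ : ℂ) * d ξ) 2 volume) (ht : t ∈ S)
    (hm : ∀ s ∈ S, MemLp (fun ξ => (wgt r ξ : ℂ) * hat (v s) ξ) 2 volume) :
    HasDerivInH r v D S t ↔ HasDerivWithinAt (fun s => toH fun ξ => (wgt r ξ : ℂ) * hat (v s) ξ)
      (toH fun ξ => (wgt r ξ : ℂ) * d ξ) S t := by
  rw [HasDerivInH, hasDerivWithinAt_iff_tendsto_slope, tendsto_iff_edist_tendsto_0]
  refine tendsto_congr' ?_
  filter_upwards [self_mem_nhdsWithin] with s hs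
  set x : ℝ := (s - t)⁻¹ with hx
  have hms : MemLp (fun ξ => (wgt r ξ : ℂ) * hat (v s) ξ - (wgt r ξ : ℂ) * hat (v t) ξ) 2 volume :=
    (hm s hs.1).sub (hm t ht)
  have hmx : MemLp (fun ξ => (x : ℂ) * ((wgt r ξ : ℂ) * hat (v s) ξ - (wgt r ξ : ℂ) * hat (v t) ξ))
      2 volume := hms.const_mul _
  have hsl : slope (fun s => toH fun ξ => (wgt r ξ : ℂ) * hat (v s) ξ) t s
      = toH fun ξ => (x : ℂ) * ((wgt r ξ : ℂ) * hat (v s) ξ - (wgt r ξ : ℂ) * hat (v t) ξ) := by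
    rw [slope_def_module, toH_sub (hm s hs.1) (hm t ht), RCLike.real_smul_eq_coe_smul (K := ℂ)]
    exact smul_toH _ hms
  rw [edist_eq_enorm_sub, hsl, toH_sub hmx hd, enorm_toH (by exact hmx.sub hd),
    ((hasFourier_toDist _).sub hD).hNorm_eq, map_smul, map_sub]
  refine eLpNorm_congr_ae ?_
  filter_upwards [Lp.coeFn_sub (hat (v s)) (hat (v t)),
    Lp.coeFn_smul x (hat (v s) - hat (v t))] with ξ h1 h2
  rw [h2, Pi.smul_apply, h1, Pi.sub_apply, Complex.real_smul]
  ring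

/-! ### Strong solutions on the Fourier side -/

/-- The identity u ∂ₓu = ½ ∂ₓ(u²) on the Fourier side. -/
theorem conv_id_mul_self {a : ℝ → ℂ} (ha : MemLp a 2 volume)
    (hda : MemLp (fun ξ : ℝ => (ξ : ℂ) * a ξ) 2 volume) (ξ : ℝ) :
    2 * conv a (fun ξ : ℝ => (ξ : ℂ) * a ξ) ξ = ξ * conv a a ξ := by
  rw [two_mul]
  nth_rw 1 [conv_comm]
  unfold conv
  rw [← integral_add (integrable_conv hda ha ξ) (integrable_conv ha hda ξ), ← integral_const_mul]
  congr 1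
  ext η
  push_cast
  ring

/-- The constants come from (2πiξ)³ = −8π³iξ³ and from l u ∂ₓu = (l/2)∂ₓ(u²), whose transform is πl
iξ times the convolution of the transform of u with itself; the overall sign is reversed. -/
theorem hasFourier_kdv (l m : ℝ) {u : L2}
    (hdu : MemLp (fun ξ : ℝ => (ξ : ℂ) * hat u ξ) 2 volume) :
    HasFourier (-((l : ℂ) • mulDist u (weakDeriv u) + (m : ℂ) • dx (dx (dx (toDist u)))))
      (kdv (8 * Real.pi ^ 3 * m) (Real.pi * l) (hat u)) := by
  have hdu' : MemLp (fun ξ => 2 * Real.pi * Complex.I * ξ * hat u ξ) 2 volume := by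
    refine (hdu.const_mul (2 * Real.pi * Complex.I)).ae_eq (ae_of_all _ fun ξ => ?_)
    ring
  have h1 := (((hasFourier_mulDist u (weakDeriv u)).const_smul l).add
    ((hasFourier_toDist u).dx.dx.dx.const_smul m)).neg
  refine h1.congr (ae_of_all _ fun ξ => ?_)
  simp only [kdv]
  rw [conv_congr (ae_eq_refl _) (hat_weakDeriv hdu')]
  have h2 : conv (hat u) (fun ξ => 2 * Real.pi * Complex.I * ξ * hat u ξ) ξ
      = (2 * Real.pi * Complex.I) * conv (hat u) (fun ξ => ξ * hat u ξ) ξ := by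
    rw [conv_comm, conv_comm (hat u), ← conv_const_mul_left]
    simp only [mul_assoc]
  have h3 := conv_id_mul_self (memLp_hat u) hdu ξ
  rw [h2]
  push_cast
  linear_combination (-(l * Real.pi * Complex.I)) * h3
    - (8 * Real.pi ^ 3 * m * ξ ^ 3 * hat u ξ * Complex.I) * Complex.I_sq

theorem isStrongKdVSolution_iff {r l m T : ℝ} (hr : 5 / 2 < r) {u0 : L2} {v : ℝ → L2} :
    IsStrongKdVSolution r l m T u0 v ↔ v 0 = u0 ∧
      IsFourierSolution (8 * Real.pi ^ 3 * m) (Real.pi * l) r T fun t => hat (v t) := by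
  have key : ∀ (_ : ∀ t ∈ Icc 0 T, MemLp (fun ξ => (wgt r ξ : ℂ) * hat (v t) ξ) 2 volume),
      ∀ t ∈ Icc 0 T, (HasDerivInH (r - 3) v (-((l : ℂ) • mulDist (v t) (weakDeriv (v t))
        + (m : ℂ) • dx (dx (dx (toDist (v t)))))) (Icc 0 T) t ↔
      HasDerivWithinAt (fun t => toH fun ξ => (wgt (r - 3) ξ : ℂ) * hat (v t) ξ)
        (toH fun ξ => (wgt (r - 3) ξ : ℂ) * kdv (8 * Real.pi ^ 3 * m) (Real.pi * l) (hat (v t)) ξ)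
        (Icc 0 T) t) := by
    intro hm t ht
    exact hasDerivInH_iff (hasFourier_kdv l m (memLp_of_wgt (by linarith)
      (memLp_wgt_id_mul (hm t ht)).1)) (memLp_wgt_kdv hr (hm t ht)) ht
      fun s hs => memLp_wgt_mul_of_le (by linarith) (hm s hs)
  constructor
  · intro h
    obtain ⟨hm, hc⟩ := continuousInH_iff.1 h.continuous
    exact ⟨h.initial, fun t _ => herm_hat _, hm, hc, fun t ht => (key hm t ht).1 (h.equation t ht)⟩
  · rintro ⟨h0, h⟩
    exact ⟨h0, continuousInH_iff.2 ⟨h.memLp, h.continuous⟩,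
      fun t ht => (key h.memLp t ht).2 (h.deriv t ht)⟩

theorem IsStrongKdVSolution.mono {r l m T T' : ℝ} (hr : 5 / 2 < r) {u0 : L2} {v : ℝ → L2}
    (h : IsStrongKdVSolution r l m T u0 v) (hT : T' ≤ T) : IsStrongKdVSolution r l m T' u0 v := by
  rw [isStrongKdVSolution_iff hr] at h ⊢
  exact ⟨h.1, h.2.mono hT⟩

theorem IsStrongKdVSolution.unique {r l m T : ℝ} (hr : 5 / 2 < r) {u0 : L2} {v w : ℝ → L2}
    (hv : IsStrongKdVSolution r l m T u0 v) (hw : IsStrongKdVSolution r l m T u0 w) :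
    ∀ t ∈ Icc 0 T, v t = w t := by
  rw [isStrongKdVSolution_iff hr] at hv hw
  intro t ht
  exact hat.injective (hv.2.unique hr hw.2 (by rw [hv.1, hw.1]) t ht)

theorem exists_isStrongKdVSolution {r : ℝ} (hr : 5 / 2 < r) (l m : ℝ) {u0 : L2}
    (h0 : MemSobolev r 2 (toDist u0)) :
    ∃ T > 0, ∃ v : ℝ → L2, IsStrongKdVSolution r l m T u0 v ∧
      ∀ t ∈ Icc 0 T, hNorm r (toDist (v t)) ≤ 2 * hNorm r (toDist u0) := by
  rw [memSobolev_toDist_iff] at h0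
  obtain ⟨T, hT, b, hb0, hb, hbd⟩ := exists_isFourierSolution (8 * Real.pi ^ 3 * m) (Real.pi * l)
    hr u0 h0
  have hh : ∀ t ∈ Icc 0 T, hat (ofHat (b t)) = b t := fun t ht => hat_ofHat (hb.herm t ht)
  refine ⟨T, hT, fun t => ofHat (b t), (isStrongKdVSolution_iff hr).2 ⟨?_, hb.congr hh⟩, ?_⟩
  · apply hat.injective
    rw [hh 0 ⟨le_rfl, hT.le⟩, hb0]
  · intro t ht
    rw [(hasFourier_toDist _).hNorm_eq, (hasFourier_toDist _).hNorm_eq, hh t ht]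
    have h1 := hbd t ht
    have h2 := ENNReal.ofReal_le_ofReal h1
    rw [ENNReal.ofReal_mul (by norm_num), n2, n2, ENNReal.ofReal_toReal (hb.memLp t ht).2.ne,
      ENNReal.ofReal_toReal h0.2.ne] at h2
    simpa using h2

end KdVApprox

end

/-! ### Transport equations and the corrector -/

noncomputable section

namespace KdVApprox

open ComplexConjugate

/-! ### The transport group and its generator -/

/-- Translation by `x`, on the Fourier side. -/
def Phi (x : ℝ) : H →L[ℂ] H :=
  mulB (ph x) (continuous_ph x).measurable 1 fun ξ => (norm_ph x ξ).le

theorem Phi_coe (x : ℝ) (a : H) : Phi x a =ᵐ[volume] fun ξ => ph x ξ * a ξ := mulB_coe _ _ a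

theorem norm_Phi_apply (x : ℝ) (a : H) : ‖Phi x a‖ = ‖a‖ := by
  rw [norm_eq_n2, norm_eq_n2, n2_congr (Phi_coe x a), n2, n2]
  congr 1
  refine eLpNorm_congr_norm_ae (ae_of_all _ fun ξ => ?_)
  rw [norm_mul, norm_ph, one_mul]

theorem Phi_Phi (x y : ℝ) (a : H) : Phi x (Phi y a) = Phi (x + y) a := by
  apply Lp.ext
  filter_upwards [Phi_coe x (Phi y a), Phi_coe y a, Phi_coe (x + y) a] with ξ h1 h2 h3
  rw [h1, h2, h3, ph_add, mul_assoc]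

theorem Phi_zero (a : H) : Phi 0 a = a := by
  apply Lp.ext
  filter_upwards [Phi_coe 0 a] with ξ h1
  rw [h1, ph_zero, one_mul]

/-- Strong continuity of the translations, by dominated convergence. Continuity in operator norm
does not hold on `L²`. -/
theorem tendsto_Phi (a : H) (x : ℝ) : Tendsto (fun y => Phi y a) (𝓝 x) (𝓝 (Phi x a)) := by
  have e : ∀ y, ‖Phi y a - Phi x a‖ ^ 2 = ∫ ξ, ‖ph y ξ * a ξ - ph x ξ * a ξ‖ ^ 2 := by
    intro y
    have hm : ∀ y, MemLp (fun ξ => ph y ξ * a ξ) 2 volume := fun y =>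
      (Lp.memLp (Phi y a)).ae_eq (Phi_coe y a)
    rw [eq_toH (Phi_coe y a), eq_toH (Phi_coe x a), norm_toH_sub (hm y) (hm x),
      n2_sq (by exact (hm y).sub (hm x))]
  have ha : Integrable (fun ξ => ‖a ξ‖ ^ 2) volume :=
    (memLp_two_iff_integrable_sq_norm (Lp.memLp a).1).1 (Lp.memLp a)
  have h1 : Tendsto (fun y => ∫ ξ, ‖ph y ξ * a ξ - ph x ξ * a ξ‖ ^ 2) (𝓝 x)
      (𝓝 (∫ _ : ℝ, (0 : ℝ))) := by
    refine tendsto_integral_filter_of_dominated_convergence (fun ξ => 4 * ‖a ξ‖ ^ 2)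
      (Eventually.of_forall fun y => ?_) (Eventually.of_forall fun y => ae_of_all _ fun ξ => ?_)
      (ha.const_mul 4) (ae_of_all _ fun ξ => ?_)
    · exact ((((continuous_ph y).aestronglyMeasurable.mul (Lp.memLp a).1).sub
        ((continuous_ph x).aestronglyMeasurable.mul (Lp.memLp a).1)).norm.pow 2)
    · have h2 : ‖ph y ξ * a ξ - ph x ξ * a ξ‖ ≤ 2 * ‖a ξ‖ := by
        refine (norm_sub_le _ _).trans (le_of_eq ?_)
        rw [norm_mul, norm_mul, norm_ph, norm_ph]; ring
      rw [Real.norm_of_nonneg (by positivity)]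
      calc _ ≤ (2 * ‖a ξ‖) ^ 2 := pow_le_pow_left₀ (norm_nonneg _) h2 2
        _ = _ := by ring
    · have h2 : Continuous fun y => ‖ph y ξ * a ξ - ph x ξ * a ξ‖ ^ 2 := by
        unfold ph; fun_prop
      have h3 := h2.tendsto x
      simpa using h3
  rw [tendsto_iff_norm_sub_tendsto_zero]
  simp only [← e, integral_zero] at h1
  have h2 := h1.sqrt
  simpa [Real.sqrt_sq (norm_nonneg _)] using h2

/-- Strong continuity becomes joint continuity because the `Phi x` are isometries. -/
theorem continuous_Phi : Continuous fun q : ℝ × H => Phi q.1 q.2 := by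
  rw [continuous_iff_continuousAt]
  rintro ⟨x, a⟩
  rw [ContinuousAt, tendsto_iff_norm_sub_tendsto_zero]
  have h1 : Tendsto (fun q : ℝ × H => ‖q.2 - a‖ + ‖Phi q.1 a - Phi x a‖) (𝓝 (x, a)) (𝓝 (0 + 0)) := by
    refine Tendsto.add ?_ ?_
    · have : Continuous fun q : ℝ × H => ‖q.2 - a‖ := by fun_prop
      simpa using this.tendsto (x, a)
    · exact (tendsto_iff_norm_sub_tendsto_zero.1 (tendsto_Phi a x)).comp
        (continuous_fst.tendsto (x, a))
  rw [add_zero] at h1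
  refine squeeze_zero (fun _ => norm_nonneg _) (fun q => ?_) h1
  calc ‖Phi q.1 q.2 - Phi x a‖ = ‖Phi q.1 (q.2 - a) + (Phi q.1 a - Phi x a)‖ := by
        rw [map_sub]; congr 1; abel
    _ ≤ _ := (norm_add_le _ _).trans (by rw [norm_Phi_apply])

theorem herm_Phi {a : H} (ha : Herm a) (x : ℝ) : Herm (Phi x a) :=
  ((Herm.ph x).mul ha).congr (Phi_coe x a).symm

theorem norm_derivSymbol (ξ : ℝ) : ‖(2 * Real.pi * Complex.I * ξ : ℂ)‖ = 2 * Real.pi * |ξ| := by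
  simp [abs_of_pos Real.pi_pos]

/-- The derivative as an operator from `L²` to `H⁻¹`, on the Fourier side. -/
def dOp : H →L[ℂ] H :=
  mulB (fun ξ => (wgt (-1) ξ : ℂ) * (2 * Real.pi * Complex.I * ξ)) (by fun_prop) (2 * Real.pi)
    fun ξ => by
      rw [norm_mul, norm_wgt, norm_derivSymbol]
      have h1 := abs_mul_wgt_le 0 ξ
      rw [zero_sub, wgt_zero] at h1
      nlinarith [Real.pi_pos]

theorem dOp_coe (a : H) :
    dOp a =ᵐ[volume] fun ξ => (wgt (-1) ξ : ℂ) * (2 * Real.pi * Complex.I * ξ) * a ξ :=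
  mulB_coe _ _ a

theorem mulW_mulW {r r' q : ℝ} (hr : 0 ≤ r) (hr' : 0 ≤ r') (hq : 0 ≤ q) (h : q = r + r') (a : H) :
    mulW r hr (mulW r' hr' a) = mulW q hq a := by
  apply Lp.ext
  filter_upwards [mulW_coe r hr (mulW r' hr' a), mulW_coe r' hr' a, mulW_coe q hq a] with ξ h1 h2 h3
  rw [h1, h2, h3, ← mul_assoc, ← Complex.ofReal_mul, ← wgt_add, h]
  ring_nf

theorem herm_mulW {r : ℝ} (hr : 0 ≤ r) {a : H} (ha : Herm a) : Herm (mulW r hr a) :=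
  ((Herm.wgt (-r)).mul ha).congr (mulW_coe r hr a).symm

theorem norm_exp_sub_one_sub_le (θ : ℝ) :
    ‖Complex.exp (θ * Complex.I) - 1 - θ * Complex.I‖ ≤ 2 * θ ^ 2 := by
  have hn : ‖(θ * Complex.I : ℂ)‖ = |θ| := by simp
  rcases le_or_gt |θ| 1 with h | h
  · have h1 := Complex.norm_exp_sub_one_sub_id_le (x := θ * Complex.I) (by rw [hn]; exact h)
    rw [hn, sq_abs] at h1
    nlinarith [sq_nonneg θ]
  · have h1 : ‖Complex.exp (θ * Complex.I) - 1 - θ * Complex.I‖ ≤ |θ| + |θ| := by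
      refine (norm_sub_le _ _).trans ?_
      rw [hn]
      refine add_le_add_left ?_ _
      have h2 := Real.norm_exp_I_mul_ofReal_sub_one_le (x := θ)
      rwa [mul_comm, Real.norm_eq_abs] at h2
    nlinarith [sq_abs θ]

theorem norm_ph_taylor_le (x y ξ : ℝ) :
    ‖ph y ξ - ph x ξ + ((y - x : ℝ) : ℂ) * (2 * Real.pi * Complex.I * ξ) * ph x ξ‖
      ≤ 8 * Real.pi ^ 2 * (y - x) ^ 2 * ξ ^ 2 := by
  have e : ph y ξ = ph x ξ * Complex.exp (((-(2 * Real.pi * (y - x) * ξ) : ℝ) : ℂ) * Complex.I) := by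
    unfold ph
    rw [← Complex.exp_add]
    congr 1
    push_cast
    ring
  have h1 := norm_exp_sub_one_sub_le (-(2 * Real.pi * (y - x) * ξ))
  have e2 : ph y ξ - ph x ξ + ((y - x : ℝ) : ℂ) * (2 * Real.pi * Complex.I * ξ) * ph x ξ
      = ph x ξ * (Complex.exp (((-(2 * Real.pi * (y - x) * ξ) : ℝ) : ℂ) * Complex.I) - 1
        - ((-(2 * Real.pi * (y - x) * ξ) : ℝ) : ℂ) * Complex.I) := by
    rw [e]
    push_cast
    ring
  rw [e2, norm_mul, norm_ph, one_mul]
  refine h1.trans (le_of_eq ?_)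
  ring

/-- With a loss of two derivatives the translation group is differentiable in operator norm: the
Taylor remainder of its symbol is of order (y − x)²ξ², and ξ² is compensated by the weight of order
-2. -/
theorem norm_mulW_Phi_taylor_le (x y : ℝ) (a : H) :
    ‖mulW 2 zero_le_two (Phi y a) - mulW 2 zero_le_two (Phi x a)
      + ((y - x : ℝ) : ℂ) • mulW 1 zero_le_one (dOp (Phi x a))‖
      ≤ 8 * Real.pi ^ 2 * (y - x) ^ 2 * ‖a‖ := by
  have h0 : (0 : ℝ) ≤ 2 := by norm_num
  rw [norm_eq_n2, norm_eq_n2]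
  refine n2_le_mul_of_norm_le (by positivity) (Lp.memLp a) ?_
  filter_upwards [Lp.coeFn_add (mulW 2 h0 (Phi y a) - mulW 2 h0 (Phi x a))
      (((y - x : ℝ) : ℂ) • mulW 1 zero_le_one (dOp (Phi x a))),
    Lp.coeFn_sub (mulW 2 h0 (Phi y a)) (mulW 2 h0 (Phi x a)),
    Lp.coeFn_smul ((y - x : ℝ) : ℂ) (mulW 1 zero_le_one (dOp (Phi x a))),
    mulW_coe 2 h0 (Phi y a), mulW_coe 2 h0 (Phi x a), mulW_coe 1 zero_le_one (dOp (Phi x a)),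
    dOp_coe (Phi x a), Phi_coe x a, Phi_coe y a] with ξ h1 h2 h3 h4 h5 h6 h7 h8 h9
  rw [h1, Pi.add_apply, h2, h3, Pi.sub_apply, Pi.smul_apply, h4, h5, h6, h7, h8, h9, smul_eq_mul]
  have hw : (wgt (-1) ξ : ℂ) * wgt (-1) ξ = wgt (-2) ξ := by
    rw [← Complex.ofReal_mul, ← wgt_add]; norm_num
  have e : (wgt (-2) ξ : ℂ) * (ph y ξ * a ξ) - (wgt (-2) ξ : ℂ) * (ph x ξ * a ξ)
      + ((y - x : ℝ) : ℂ) * ((wgt (-1) ξ : ℂ) * ((wgt (-1) ξ : ℂ) *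
        (2 * Real.pi * Complex.I * ξ) * (ph x ξ * a ξ)))
      = (wgt (-2) ξ : ℂ) * (ph y ξ - ph x ξ
        + ((y - x : ℝ) : ℂ) * (2 * Real.pi * Complex.I * ξ) * ph x ξ) * a ξ := by
    linear_combination ((y - x : ℝ) : ℂ) * (2 * Real.pi * Complex.I * ξ) * ph x ξ * a ξ * hw
  rw [e, norm_mul, norm_mul, norm_wgt]
  refine mul_le_mul_of_nonneg_right ?_ (norm_nonneg _)
  have h10 := abs_pow_mul_wgt_le 0 ξ 2
  rw [wgt_zero, sq_abs] at h10
  norm_num at h10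
  calc wgt (-2) ξ * _ ≤ wgt (-2) ξ * (8 * Real.pi ^ 2 * (y - x) ^ 2 * ξ ^ 2) :=
        mul_le_mul_of_nonneg_left (norm_ph_taylor_le x y ξ) (wgt_pos _ _).le
    _ = 8 * Real.pi ^ 2 * (y - x) ^ 2 * (ξ ^ 2 * wgt (-2) ξ) := by ring
    _ ≤ 8 * Real.pi ^ 2 * (y - x) ^ 2 * 1 := by gcongr
    _ = _ := by ring

/-- The derivative of a transported curve, with values in `H⁻²`. -/
theorem hasDerivAt_mulW_Phi (c : ℝ) {g : ℝ → H} {g' : H} {t : ℝ} (hg : HasDerivAt g g' t) :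
    HasDerivAt (fun t => mulW 2 zero_le_two (Phi (c * t) (g t)))
      (mulW 1 zero_le_one (-(c : ℂ) • dOp (Phi (c * t) (g t))
        + mulW 1 zero_le_one (Phi (c * t) g'))) t := by
  set P : ℝ → H →L[ℝ] H := fun x => ((mulW 2 zero_le_two).comp (Phi x)).restrictScalars ℝ with hP
  set D : ℝ → H →L[ℝ] H := fun x =>
    -((mulW 1 zero_le_one).comp (dOp.comp (Phi x))).restrictScalars ℝ with hD
  have hPD : ∀ x, HasDerivAt P (D x) x := by
    intro x
    rw [hasDerivAt_iff_isLittleO]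
    refine Asymptotics.IsBigO.trans_isLittleO (g := fun y : ℝ => ‖y - x‖ ^ 2) ?_
      (Asymptotics.isLittleO_pow_sub_sub x one_lt_two)
    refine Asymptotics.IsBigO.of_bound (8 * Real.pi ^ 2) (Eventually.of_forall fun y => ?_)
    rw [Real.norm_of_nonneg (by positivity)]
    refine ContinuousLinearMap.opNorm_le_bound _ (by positivity) fun v => ?_
    have h1 := norm_mulW_Phi_taylor_le x y v
    rw [Real.norm_eq_abs, sq_abs]
    have e : (P y - P x - (y - x) • D x) v = mulW 2 zero_le_two (Phi y v)
        - mulW 2 zero_le_two (Phi x v) + ((y - x : ℝ) : ℂ) • mulW 1 zero_le_one (dOp (Phi x v)) := by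
      change mulW 2 zero_le_two (Phi y v) - mulW 2 zero_le_two (Phi x v)
        - (y - x) • (-(mulW 1 zero_le_one (dOp (Phi x v)))) = _
      rw [smul_neg, sub_neg_eq_add, RCLike.real_smul_eq_coe_smul (K := ℂ)]
      rfl
    rw [e]
    exact h1
  have h1 : HasDerivAt (fun t => P (c * t)) (c • D (c * t)) t := by
    have h2 : HasDerivAt (fun t : ℝ => c * t) c t := by
      simpa using (hasDerivAt_id t).const_mul c
    exact (hPD (c * t)).scomp t h2
  have h3 := h1.clm_apply hg
  have e : mulW 1 zero_le_one (-(c : ℂ) • dOp (Phi (c * t) (g t))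
      + mulW 1 zero_le_one (Phi (c * t) g')) = (c • D (c * t)) (g t) + P (c * t) g' := by
    change _ = c • (-(mulW 1 zero_le_one (dOp (Phi (c * t) (g t)))))
      + mulW 2 zero_le_two (Phi (c * t) g')
    rw [map_add, map_smul, mulW_mulW zero_le_one zero_le_one zero_le_two (by norm_num), smul_neg,
      neg_smul, RCLike.real_smul_eq_coe_smul (K := ℂ)]
    rfl
  rw [e]
  exact h3

/-! ### The product of `Hˢ` functions -/

theorem wgt_mul_mulW {s : ℝ} (hs : 0 ≤ s) (x : H) :
    (fun ξ => (wgt s ξ : ℂ) * mulW s hs x ξ) =ᵐ[volume] x := by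
  filter_upwards [mulW_coe s hs x] with ξ h
  rw [h, ← mul_assoc, ← Complex.ofReal_mul, wgt_mul_neg, Complex.ofReal_one, one_mul]

theorem memLp_wgt_mul_mulW {s : ℝ} (hs : 0 ≤ s) (x : H) :
    MemLp (fun ξ => (wgt s ξ : ℂ) * mulW s hs x ξ) 2 volume :=
  (Lp.memLp x).ae_eq (wgt_mul_mulW hs x).symm

/-- The Fourier transform of the product of two functions in `Hˢ`, all of them multiplied by the
weight of order `s`. -/
def algB (s : ℝ) (hs : 1 / 2 < s) : H →L[ℂ] H →L[ℂ] H :=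
  have hs0 : 0 ≤ s := by linarith
  have hm : ∀ x y : H, MemLp (fun ξ => (wgt s ξ : ℂ) * conv (mulW s hs0 x) (mulW s hs0 y) ξ) 2
      volume := fun x y => (memLp_wgt_conv hs (memLp_wgt_mul_mulW hs0 x) (memLp_wgt_mul_mulW hs0 y)).1
  have hadd : ∀ x x' y : H, ∀ ξ, conv (mulW s hs0 (x + x')) (mulW s hs0 y) ξ
      = conv (mulW s hs0 x) (mulW s hs0 y) ξ + conv (mulW s hs0 x') (mulW s hs0 y) ξ := by
    intro x x' y ξ
    rw [map_add, conv_congr (Lp.coeFn_add _ _) (ae_eq_refl _)]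
    exact conv_add_left (Lp.memLp _) (Lp.memLp _) (Lp.memLp _) ξ
  have hsmul : ∀ (c : ℂ) (x y : H), ∀ ξ, conv (mulW s hs0 (c • x)) (mulW s hs0 y) ξ
      = c * conv (mulW s hs0 x) (mulW s hs0 y) ξ := by
    intro c x y ξ
    rw [map_smul, conv_congr (Lp.coeFn_smul _ _) (ae_eq_refl _)]
    exact conv_const_mul_left c _ _ ξ
  LinearMap.mkContinuous₂
    (LinearMap.mk₂ ℂ (fun x y => toH fun ξ => (wgt s ξ : ℂ) * conv (mulW s hs0 x) (mulW s hs0 y) ξ)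
      (fun x x' y => by
        rw [toH_add (hm x y) (hm x' y)]
        simp only [hadd, mul_add])
      (fun c x y => by
        rw [smul_toH c (hm x y)]
        simp only [hsmul, mul_left_comm c])
      (fun x y y' => by
        rw [toH_add (hm x y) (hm x y')]
        simp only [conv_comm (mulW s hs0 x), hadd, mul_add])
      (fun c x y => by
        rw [smul_toH c (hm x y)]
        simp only [conv_comm (mulW s hs0 x), hsmul, mul_left_comm c]))
    (algConst s) fun x y => by
      rw [LinearMap.mk₂_apply, norm_toH (hm x y), norm_eq_n2, norm_eq_n2,
        ← n2_congr (wgt_mul_mulW hs0 x), ← n2_congr (wgt_mul_mulW hs0 y), mul_assoc]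
      exact (memLp_wgt_conv hs (memLp_wgt_mul_mulW hs0 x) (memLp_wgt_mul_mulW hs0 y)).2

theorem algB_coe {s : ℝ} (hs : 1 / 2 < s) {x y : H} {f g : ℝ → ℂ}
    (hx : x =ᵐ[volume] fun ξ => (wgt s ξ : ℂ) * f ξ) (hy : y =ᵐ[volume] fun ξ => (wgt s ξ : ℂ) * g ξ) :
    algB s hs x y =ᵐ[volume] fun ξ => (wgt s ξ : ℂ) * conv f g ξ := by
  have hs0 : 0 ≤ s := by linarith
  have key : ∀ {x : H} {f : ℝ → ℂ}, x =ᵐ[volume] (fun ξ => (wgt s ξ : ℂ) * f ξ) →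
      mulW s hs0 x =ᵐ[volume] f := by
    intro x f h
    filter_upwards [h, mulW_coe s hs0 x] with ξ h1 h2
    rw [h2, h1, ← mul_assoc, ← Complex.ofReal_mul, wgt_neg_mul, Complex.ofReal_one, one_mul]
  rw [← conv_congr (key hx) (key hy)]
  exact toH_coe (memLp_wgt_conv hs (memLp_wgt_mul_mulW hs0 x) (memLp_wgt_mul_mulW hs0 y)).1

theorem herm_algB {s : ℝ} (hs : 1 / 2 < s) {x y : H} (hx : Herm x) (hy : Herm y) :
    Herm (algB s hs x y) := by
  have hs0 : 0 ≤ s := by linarith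
  refine Herm.congr ?_ (algB_coe hs (wgt_mul_mulW hs0 x).symm (wgt_mul_mulW hs0 y).symm).symm
  exact (Herm.wgt s).mul ((herm_mulW hs0 hx).conv (herm_mulW hs0 hy))

end KdVApprox

end

noncomputable section

namespace KdVApprox

open ComplexConjugate

/-! ### The corrector on the Fourier side -/

/-- The Duhamel integral of the source `K` for the transport equation of speed `c`, in the moving
frame. -/
def duhamel (c : ℝ) (K : ℝ → ℝ → H) (τ t : ℝ) : H :=
  ∫ t' in (0 : ℝ)..t, Phi (-(c * t')) (K τ t')

/-- The solution with zero initial value of the transport equation of speed `c` with the source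
`-K` and resonance-free sources given by the profiles `b j`, transported with the speeds `cj j`. -/
def transportSol (c : ℝ) (cj γ : Fin 4 → ℝ) (K : ℝ → ℝ → H) (b : Fin 4 → ℝ → H) (τ t : ℝ) : H :=
  -Phi (c * t) (duhamel c K τ t)
    + ∑ j, (γ j : ℂ) • (Phi (cj j * t) (b j τ) - Phi (c * t) (b j τ))

variable {c : ℝ} {cj γ : Fin 4 → ℝ} {K : ℝ → ℝ → H} {b : Fin 4 → ℝ → H}

theorem continuous_duhamel_integrand (c : ℝ) (hK : Continuous (Function.uncurry K)) :
    Continuous fun q : ℝ × ℝ => Phi (-(c * q.2)) (K q.1 q.2) :=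
  continuous_Phi.comp (f := fun q : ℝ × ℝ => (-(c * q.2), K q.1 q.2))
    ((by fun_prop : Continuous fun q : ℝ × ℝ => -(c * q.2)).prodMk hK)

theorem continuous_duhamel (c : ℝ) (hK : Continuous (Function.uncurry K)) :
    Continuous fun q : ℝ × ℝ => duhamel c K q.1 q.2 := by
  refine intervalIntegral.continuous_parametric_intervalIntegral_of_continuous
    (f := fun (q : ℝ × ℝ) t' => Phi (-(c * t')) (K q.1 t')) ?_ continuous_snd
  exact (continuous_duhamel_integrand c hK).comp
    (f := fun p : (ℝ × ℝ) × ℝ => (p.1.1, p.2)) (by fun_prop)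

theorem hasDerivAt_duhamel (c : ℝ) (hK : Continuous (Function.uncurry K)) (τ t : ℝ) :
    HasDerivAt (duhamel c K τ) (Phi (-(c * t)) (K τ t)) t := by
  have h1 : Continuous fun t' => Phi (-(c * t')) (K τ t') :=
    (continuous_duhamel_integrand c hK).comp (f := fun t' => (τ, t')) (by fun_prop)
  exact (h1.integral_hasStrictDerivAt 0 t).hasDerivAt

theorem continuous_transportSol (c : ℝ) (cj γ : Fin 4 → ℝ) (hK : Continuous (Function.uncurry K))
    (hb : ∀ j, Continuous (b j)) :
    Continuous fun q : ℝ × ℝ => transportSol c cj γ K b q.1 q.2 := by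
  have hP : ∀ (c : ℝ) (g : ℝ × ℝ → H), Continuous g →
      Continuous fun q : ℝ × ℝ => Phi (c * q.2) (g q) := fun c g hg =>
    continuous_Phi.comp (f := fun q : ℝ × ℝ => (c * q.2, g q))
      ((by fun_prop : Continuous fun q : ℝ × ℝ => c * q.2).prodMk hg)
  refine (hP c _ (continuous_duhamel c hK)).neg.add (continuous_finsetSum _ fun j _ => ?_)
  exact ((hP (cj j) _ ((hb j).comp continuous_fst)).sub
    (hP c _ ((hb j).comp continuous_fst))).const_smul (γ j : ℂ)

theorem transportSol_zero (c : ℝ) (cj γ : Fin 4 → ℝ) (K : ℝ → ℝ → H) (b : Fin 4 → ℝ → H) (τ : ℝ) :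
    transportSol c cj γ K b τ 0 = 0 := by
  simp [transportSol, duhamel]

/-- Translations are isometries, so the Duhamel integral of a bounded source grows at most linearly,
while the profile terms remain bounded in `t`. -/
theorem norm_transportSol_le (c : ℝ) (cj γ : Fin 4 → ℝ) {τ t k B : ℝ}
    (hK : ∀ t, ‖K τ t‖ ≤ k) (hb : ∀ j, ‖b j τ‖ ≤ B) :
    ‖transportSol c cj γ K b τ t‖ ≤ k * |t| + ∑ j, |γ j| * (2 * B) := by
  refine (norm_add_le _ _).trans (add_le_add ?_ ((norm_sum_le _ _).trans
    (Finset.sum_le_sum fun j _ => ?_)))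
  · rw [norm_neg, norm_Phi_apply]
    have h1 := intervalIntegral.norm_integral_le_of_norm_le_const (a := 0) (b := t)
      (f := fun t' => Phi (-(c * t')) (K τ t')) (C := k) fun t' _ => by
        rw [norm_Phi_apply]; exact hK t'
    rwa [sub_zero] at h1
  · rw [norm_smul, Complex.norm_real, Real.norm_eq_abs]
    refine mul_le_mul_of_nonneg_left ((norm_sub_le _ _).trans ?_) (abs_nonneg _)
    rw [norm_Phi_apply, norm_Phi_apply]
    linarith [hb j]

theorem herm_add {x y : H} (hx : Herm x) (hy : Herm y) : Herm (x + y : H) :=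
  (Herm.add hx hy).congr (Lp.coeFn_add x y).symm

theorem herm_real_smul {x : H} (hx : Herm x) (k : ℝ) : Herm ((k : ℂ) • x : H) :=
  ((Herm.ofReal_of_even (m := fun _ => k) fun _ => rfl).mul hx).congr (Lp.coeFn_smul (k : ℂ) x).symm

theorem herm_neg {x : H} (hx : Herm x) : Herm (-x : H) := by
  have := herm_real_smul hx (-1)
  simpa using this

theorem herm_sub {x y : H} (hx : Herm x) (hy : Herm y) : Herm (x - y : H) := by
  rw [sub_eq_add_neg]
  exact herm_add hx (herm_neg hy)

theorem herm_zero : Herm (0 : H) := by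
  rw [herm_iff]; simp

theorem herm_sum {ι : Type*} (s : Finset ι) {x : ι → H} (hx : ∀ j ∈ s, Herm (x j)) :
    Herm (∑ j ∈ s, x j : H) := by
  classical
  induction s using Finset.induction_on with
  | empty => rw [Finset.sum_empty]; exact herm_zero
  | insert j s hj ih =>
    rw [Finset.sum_insert hj]
    exact herm_add (hx j (Finset.mem_insert_self j s)) (ih fun k hk => hx k (Finset.mem_insert_of_mem hk))

theorem herm_intervalIntegral {f : ℝ → H} (hf : Continuous f) (h : ∀ t, Herm (f t)) (α β : ℝ) :
    Herm (∫ t in α..β, f t : H) := by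
  rw [herm_iff]
  set L : H →L[ℝ] H := conjL ∘L (reflL.toContinuousLinearMap.restrictScalars ℝ) with hL
  change L (∫ t in α..β, f t) = _
  rw [← L.intervalIntegral_comp_comm (hf.intervalIntegrable α β)]
  congr 1
  ext1 t
  exact (herm_iff _).1 (h t)

theorem herm_transportSol (c : ℝ) (cj γ : Fin 4 → ℝ) (hK : Continuous (Function.uncurry K))
    (hKh : ∀ τ t, Herm (K τ t)) (hbh : ∀ j τ, Herm (b j τ)) (τ t : ℝ) :
    Herm (transportSol c cj γ K b τ t) := by
  refine herm_add (herm_neg (herm_Phi (herm_intervalIntegral ?_ (fun t' => herm_Phi (hKh τ t') _)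
    _ _) _)) (herm_sum _ fun j _ => herm_real_smul (herm_sub (herm_Phi (hbh j τ) _)
      (herm_Phi (hbh j τ) _)) _)
  exact (continuous_duhamel_integrand c hK).comp (f := fun t' => (τ, t')) (by fun_prop)

/-- The transport equation, with values in `H⁻¹`. -/
theorem hasDerivAt_transportSol (c : ℝ) (cj γ : Fin 4 → ℝ) (hK : Continuous (Function.uncurry K))
    (hb : ∀ j, Continuous (b j)) (τ t : ℝ) :
    HasDerivAt (fun t => mulW 1 zero_le_one (transportSol c cj γ K b τ t))
      (-(c : ℂ) • dOp (transportSol c cj γ K b τ t) - mulW 1 zero_le_one (K τ t)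
        + ∑ j, ((γ j * (c - cj j) : ℝ) : ℂ) • dOp (Phi (cj j * t) (b j τ))) t := by
  set Y := transportSol c cj γ K b τ with hY
  set D : ℝ → H := fun t => -(c : ℂ) • dOp (Y t) - mulW 1 zero_le_one (K τ t)
        + ∑ j, ((γ j * (c - cj j) : ℝ) : ℂ) • dOp (Phi (cj j * t) (b j τ)) with hD
  have hYc : Continuous Y := (continuous_transportSol c cj γ hK hb).comp
    (f := fun t => (τ, t)) (by fun_prop)
  have hKc : Continuous (K τ) := hK.comp (f := fun t => (τ, t)) (by fun_prop)
  have hDc : Continuous D := by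
    refine ((((dOp.continuous.comp hYc).const_smul (-(c : ℂ))).sub
      ((mulW 1 zero_le_one).continuous.comp hKc)).add (continuous_finsetSum _ fun j _ => ?_))
    have h : Continuous fun t : ℝ => Phi (cj j * t) (b j τ) :=
      continuous_Phi.comp (f := fun t : ℝ => (cj j * t, b j τ)) (by fun_prop)
    exact (dOp.continuous.comp h).const_smul ((γ j * (c - cj j) : ℝ) : ℂ)
  -- The derivative is first computed at order -2, where translations are differentiable in norm and
  -- the product rule applies.
  have hd : ∀ t, HasDerivAt (fun t => mulW 2 zero_le_two (Y t)) (mulW 1 zero_le_one (D t)) t := by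
    intro t
    have h1 := hasDerivAt_mulW_Phi c (hasDerivAt_duhamel c hK τ t)
    have h2 : ∀ j, HasDerivAt (fun t => mulW 2 zero_le_two (Phi (cj j * t) (b j τ)))
        (mulW 1 zero_le_one (-(cj j : ℂ) • dOp (Phi (cj j * t) (b j τ)))) t := fun j => by
      simpa using hasDerivAt_mulW_Phi (cj j) (hasDerivAt_const t (b j τ))
    have h3 : ∀ j, HasDerivAt (fun t => mulW 2 zero_le_two (Phi (c * t) (b j τ)))
        (mulW 1 zero_le_one (-(c : ℂ) • dOp (Phi (c * t) (b j τ)))) t := fun j => by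
      simpa using hasDerivAt_mulW_Phi c (hasDerivAt_const t (b j τ))
    have h4 := h1.neg.add (HasDerivAt.fun_sum (u := Finset.univ) fun j _ =>
      ((h2 j).sub (h3 j)).const_smul (γ j : ℂ))
    have e : D t = -(-(c : ℂ) • dOp (Phi (c * t) (duhamel c K τ t))
          + mulW 1 zero_le_one (Phi (c * t) (Phi (-(c * t)) (K τ t))))
        + ∑ j, (γ j : ℂ) • (-(cj j : ℂ) • dOp (Phi (cj j * t) (b j τ))
          - -(c : ℂ) • dOp (Phi (c * t) (b j τ))) := by
      have e1 : Phi (c * t) (Phi (-(c * t)) (K τ t)) = K τ t := by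
        rw [Phi_Phi, add_neg_cancel, Phi_zero]
      rw [e1]
      simp only [hD, hY, transportSol]
      rw [map_add, map_neg, map_sum, smul_add, Finset.smul_sum]
      -- Under ∂ₜ + c∂ₓ the profile moving with speed `c` disappears, and the one moving with speed
      -- `cj j` leaves its derivative times `c - cj j`.
      have e2 : ∀ j, (γ j : ℂ) • (-(cj j : ℂ) • dOp (Phi (cj j * t) (b j τ))
          - -(c : ℂ) • dOp (Phi (c * t) (b j τ)))
          = -(c : ℂ) • dOp ((γ j : ℂ) • (Phi (cj j * t) (b j τ) - Phi (c * t) (b j τ)))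
            + ((γ j * (c - cj j) : ℝ) : ℂ) • dOp (Phi (cj j * t) (b j τ)) := by
        intro j
        rw [map_smul, map_sub]
        push_cast
        module
      simp only [e2, Finset.sum_add_distrib]
      module
    refine (h4.congr_of_eventuallyEq (Eventually.of_forall fun t => ?_)).congr_deriv ?_
    · simp only [hY, transportSol, map_add, map_neg, map_sum, map_smul, map_sub, Pi.add_apply,
        Pi.neg_apply, Pi.sub_apply, Pi.smul_apply]
    · rw [e]
      simp only [map_add, map_neg, map_sum, map_smul, map_sub]
  -- As `D` is already continuous one order higher, the equation is upgraded from order -2 to order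
  -- -1. The approximating sequence is constant here.
  have key := hasDerivWithinAt_of_approx (injective_mulW 1 zero_le_one) (α := t - 1) (β := t + 1)
    (by linarith) (b := fun t => mulW 1 zero_le_one (Y t)) (c := D)
    (f := fun _ t => mulW 2 zero_le_two (Y t)) (g := fun _ t => mulW 1 zero_le_one (D t))
    (δ := fun _ => 0) hDc.continuousOn (fun t _ => ?_)
    (fun _ t _ => (hd t).hasDerivWithinAt) (fun _ t _ => by simp) tendsto_const_nhds
    t ⟨by linarith, by linarith⟩
  · exact key.hasDerivAt (Icc_mem_nhds (by linarith) (by linarith))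
  · rw [mulW_mulW zero_le_one zero_le_one zero_le_two (by norm_num)]
    exact tendsto_const_nhds

end KdVApprox

end

noncomputable section

namespace KdVApprox

open ComplexConjugate

/-! ### Representatives of distributions in `Hʳ` -/

/-- The Fourier transform of `D`, multiplied by the weight of order `r`, is the `L²` function
`x`. -/
def IsHRep (r : ℝ) (D : 𝓢'(ℝ, ℂ)) (x : H) : Prop :=
  ∃ d : ℝ → ℂ, HasFourier D d ∧ x =ᵐ[volume] fun ξ => (wgt r ξ : ℂ) * d ξ

theorem isHRep_toDist_iff {r : ℝ} {f : L2} {x : H} :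
    IsHRep r (toDist f) x ↔ x =ᵐ[volume] fun ξ => (wgt r ξ : ℂ) * hat f ξ := by
  constructor
  · rintro ⟨d, hd, hx⟩
    filter_upwards [hx, hd.unique (hasFourier_toDist f)] with ξ h1 h2
    rw [h1, h2]
  · exact fun h => ⟨_, hasFourier_toDist f, h⟩

theorem isHRep_ofHat {r : ℝ} (hr : 0 ≤ r) {x : H} (hx : Herm x) :
    IsHRep r (toDist (ofHat (mulW r hr x))) x := by
  rw [isHRep_toDist_iff, hat_ofHat (herm_mulW hr hx)]
  exact (wgt_mul_mulW hr x).symm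

theorem isHRep_toH {r : ℝ} {f : L2} (hf : MemSobolev r 2 (toDist f)) :
    IsHRep r (toDist f) (toH fun ξ => (wgt r ξ : ℂ) * hat f ξ) :=
  isHRep_toDist_iff.2 (toH_coe ((memSobolev_toDist_iff r f).1 hf))

theorem isHRep_sum_smul {r : ℝ} {ι : Type*} [Fintype ι] (k : ι → ℝ) {f : ι → L2} {x : ι → H}
    (h : ∀ i, IsHRep r (toDist (f i)) (x i)) :
    IsHRep r (toDist (∑ i, k i • f i)) (∑ i, (k i : ℂ) • x i) := by
  simp only [isHRep_toDist_iff] at h ⊢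
  rw [map_sum]
  have h1 : ∀ i, (x i : ℝ → ℂ) =ᵐ[volume] fun ξ => (wgt r ξ : ℂ) * hat (f i) ξ := h
  filter_upwards [Lp.coeFn_finsetSum Finset.univ fun i => (k i : ℂ) • x i,
    Lp.coeFn_finsetSum Finset.univ fun i => hat (k i • f i), ae_all_iff.2 h1,
    ae_all_iff.2 fun i => Lp.coeFn_smul (k i : ℂ) (x i),
    ae_all_iff.2 fun i => Lp.coeFn_smul (k i) (hat (f i))] with ξ h2 h3 h4 h5 h6
  rw [h2, h3, Finset.sum_apply, Finset.sum_apply, Finset.mul_sum]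
  refine Finset.sum_congr rfl fun i _ => ?_
  rw [map_smul, h6, h5, Pi.smul_apply, Pi.smul_apply, h4, Complex.real_smul, smul_eq_mul]
  ring

namespace IsHRep

variable {r : ℝ} {D D' : 𝓢'(ℝ, ℂ)} {x y : H}

theorem hNorm_eq (h : IsHRep r D x) : hNorm r D = ‖x‖ₑ := by
  obtain ⟨d, hd, hx⟩ := h
  rw [hd.hNorm_eq, Lp.enorm_def, eLpNorm_congr_ae hx]

theorem memSobolev (h : IsHRep r D x) : MemSobolev r 2 D := by
  rw [← hNorm_lt_top_iff, h.hNorm_eq]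
  exact enorm_lt_top

theorem add (h : IsHRep r D x) (h' : IsHRep r D' y) : IsHRep r (D + D') (x + y) := by
  obtain ⟨d, hd, hx⟩ := h
  obtain ⟨d', hd', hy⟩ := h'
  refine ⟨_, hd.add hd', ?_⟩
  filter_upwards [hx, hy, Lp.coeFn_add x y] with ξ h1 h2 h3
  rw [h3, Pi.add_apply, h1, h2, mul_add]

theorem smul (h : IsHRep r D x) (k : ℂ) : IsHRep r (k • D) (k • x) := by
  obtain ⟨d, hd, hx⟩ := h
  refine ⟨_, hd.const_smul k, ?_⟩
  filter_upwards [hx, Lp.coeFn_smul k x] with ξ h1 h2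
  rw [h2, Pi.smul_apply, h1, smul_eq_mul]
  ring

theorem neg (h : IsHRep r D x) : IsHRep r (-D) (-x) := by
  obtain ⟨d, hd, hx⟩ := h
  refine ⟨_, hd.neg, ?_⟩
  filter_upwards [hx, Lp.coeFn_neg x] with ξ h1 h2
  rw [h2, Pi.neg_apply, h1, mul_neg]

theorem sub (h : IsHRep r D x) (h' : IsHRep r D' y) : IsHRep r (D - D') (x - y) := by
  rw [sub_eq_add_neg, sub_eq_add_neg]
  exact h.add h'.neg

theorem zero (r : ℝ) : IsHRep r 0 0 := by
  refine ⟨_, HasFourier.zero, ?_⟩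
  filter_upwards [Lp.coeFn_zero ℂ 2 (volume : Measure ℝ)] with ξ h
  rw [h, Pi.zero_apply, mul_zero]

theorem ite {p : Prop} [Decidable p] (h : IsHRep r D x) :
    IsHRep r (if p then D else 0) (if p then x else 0) := by
  split_ifs
  · exact h
  · exact zero r

theorem sum {ι : Type*} (s : Finset ι) {D : ι → 𝓢'(ℝ, ℂ)} {x : ι → H}
    (h : ∀ i ∈ s, IsHRep r (D i) (x i)) : IsHRep r (∑ i ∈ s, D i) (∑ i ∈ s, x i) := by
  classical
  induction s using Finset.induction_on with
  | empty => simpa using zero r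
  | insert i s hi ih =>
    rw [Finset.sum_insert hi, Finset.sum_insert hi]
    exact (h i (Finset.mem_insert_self i s)).add (ih fun k hk => h k (Finset.mem_insert_of_mem hk))

theorem lower (h : IsHRep r D x) {q r' : ℝ} (hq : 0 ≤ q) (hr' : r' = r - q) :
    IsHRep r' D (mulW q hq x) := by
  obtain ⟨d, hd, hx⟩ := h
  refine ⟨d, hd, ?_⟩
  filter_upwards [hx, mulW_coe q hq x] with ξ h1 h2
  rw [h2, h1, hr', sub_eq_neg_add, wgt_add]
  push_cast
  ring

theorem dx (h : IsHRep r D x) {r' : ℝ} (hr' : r' = r - 1) :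
    IsHRep r' (KdVApprox.dx D) (dOp x) := by
  obtain ⟨d, hd, hx⟩ := h
  refine ⟨_, hd.dx, ?_⟩
  filter_upwards [hx, dOp_coe x] with ξ h1 h2
  rw [h2, h1, hr', sub_eq_neg_add, wgt_add]
  push_cast
  ring

theorem transl {f : L2} (h : IsHRep r (toDist f) x) (c : ℝ) :
    IsHRep r (toDist (transl c f)) (Phi c x) := by
  rw [isHRep_toDist_iff] at h ⊢
  filter_upwards [h, Phi_coe c x, hat_transl c f] with ξ h1 h2 h3
  rw [h2, h1, h3]
  ring

theorem weakDeriv {f : L2} (hr : 1 ≤ r) (h : IsHRep r (toDist f) x) {r' : ℝ} (hr' : r' = r - 1) :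
    IsHRep r' (toDist (weakDeriv f)) (dOp x) := by
  have h0 := h
  rw [isHRep_toDist_iff] at h
  have h1 := (memLp_wgt_id_mul ((Lp.memLp x).ae_eq h)).1
  have h2 : MemLp (fun ξ => 2 * Real.pi * Complex.I * ξ * hat f ξ) 2 volume := by
    refine ((memLp_of_wgt (by linarith) h1).const_mul (2 * Real.pi * Complex.I)).ae_eq
      (ae_of_all _ fun ξ => ?_)
    ring
  rw [isHRep_toDist_iff]
  filter_upwards [h, dOp_coe x, hat_weakDeriv h2] with ξ h3 h4 h5
  rw [h4, h3, h5, hr', sub_eq_neg_add, wgt_add]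
  push_cast
  ring

theorem mulDist {s : ℝ} (hs : 1 / 2 < s) {f g : L2} (hf : IsHRep s (toDist f) x)
    (hg : IsHRep s (toDist g) y) : IsHRep s (mulDist f g) (algB s hs x y) :=
  ⟨_, hasFourier_mulDist f g, algB_coe hs (isHRep_toDist_iff.1 hf) (isHRep_toDist_iff.1 hg)⟩

end IsHRep

theorem continuousInH_of_isHRep {X : Type*} [TopologicalSpace X] {r : ℝ} {v : X → L2} {A : Set X}
    {x : X → H} (h : ∀ a ∈ A, IsHRep r (toDist (v a)) (x a)) (hx : ContinuousOn x A) :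
    ContinuousInH r v A := by
  refine continuousInH_iff.2 ⟨fun a ha => (memSobolev_toDist_iff r _).1 (h a ha).memSobolev, ?_⟩
  exact hx.congr fun a ha => (eq_toH (isHRep_toDist_iff.1 (h a ha))).symm

theorem hasDerivInH_of_isHRep {r : ℝ} {v : ℝ → L2} {D : 𝓢'(ℝ, ℂ)} {t : ℝ} {x : ℝ → H} {x' : H}
    (h : ∀ t, IsHRep r (toDist (v t)) (x t)) (hD : IsHRep r D x') (hx : HasDerivAt x x' t) :
    HasDerivInH r v D univ t := by
  obtain ⟨d, hd, hx'⟩ := hD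
  rw [hasDerivInH_iff hd ((Lp.memLp x').ae_eq hx') (mem_univ t)
    fun t _ => (memSobolev_toDist_iff r _).1 (h t).memSobolev, hasDerivWithinAt_univ, ← eq_toH hx']
  have e : (fun t => toH fun ξ => (wgt r ξ : ℂ) * hat (v t) ξ) = x :=
    funext fun t => (eq_toH (isHRep_toDist_iff.1 (h t))).symm
  rwa [e]

/-- Four components, and √4 = 2. -/
theorem hNormVec_le {r : ℝ} {U : Fin 4 → L2} {m : ℝ≥0∞} (h : ∀ j, hNorm r (toDist (U j)) ≤ m) :
    hNormVec r U ≤ 2 * m := by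
  have h1 : ∑ j, hNorm r (toDist (U j)) ^ (2 : ℝ) ≤ (2 * m) ^ (2 : ℝ) := by
    refine (Finset.sum_le_sum fun j _ => ENNReal.rpow_le_rpow (h j) zero_le_two).trans_eq ?_
    rw [Finset.sum_const, ENNReal.mul_rpow_of_nonneg _ _ zero_le_two]
    simp
    norm_num
  refine (ENNReal.rpow_le_rpow h1 (by norm_num)).trans_eq ?_
  rw [← ENNReal.rpow_mul]
  norm_num

theorem hNorm_le_hNormVec (r : ℝ) (U : Fin 4 → L2) (j : Fin 4) :
    hNorm r (toDist (U j)) ≤ hNormVec r U := by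
  have h1 : hNorm r (toDist (U j)) = (hNorm r (toDist (U j)) ^ (2 : ℝ)) ^ (1 / 2 : ℝ) := by
    rw [← ENNReal.rpow_mul]
    norm_num
  rw [h1]
  exact ENNReal.rpow_le_rpow (Finset.single_le_sum
    (f := fun j => hNorm r (toDist (U j)) ^ (2 : ℝ)) (fun _ _ => zero_le) (Finset.mem_univ j))
    (by norm_num)

end KdVApprox

end

noncomputable section

namespace KdVApprox

open ComplexConjugate

/-! ### The corrector -/

theorem Phi_dOp (c : ℝ) (a : H) : Phi c (dOp a) = dOp (Phi c a) := by
  apply Lp.ext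
  filter_upwards [Phi_coe c (dOp a), dOp_coe a, dOp_coe (Phi c a), Phi_coe c a] with ξ h1 h2 h3 h4
  rw [h1, h2, h3, h4]
  ring

theorem herm_dOp {a : H} (ha : Herm a) : Herm (dOp a) :=
  (((Herm.wgt (-1)).mul Herm.derivSymbol).mul ha).congr (dOp_coe a).symm

/-- The quadratic interaction of the waves of speeds `c k` with the profiles `A k`, which are
normalized in `Hˢ⁺²`. -/
def waveProd (s : ℝ) (hs : 1 / 2 < s) (c : Fin 4 → ℝ) (A : Fin 4 → ℝ → H) (j k : Fin 4)
    (τ t : ℝ) : H :=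
  algB s hs (mulW 2 zero_le_two (Phi (c k * t) (A k τ)))
    (mulW 1 zero_le_one (dOp (Phi (c j * t) (A j τ))))

/-- The quadratic source of the `i`-th corrector equation. -/
def waveSource (s : ℝ) (hs : 1 / 2 < s) (c : Fin 4 → ℝ) (α : Fin 4 → Fin 4 → Fin 4 → ℝ)
    (A : Fin 4 → ℝ → H) (i : Fin 4) (τ t : ℝ) : H :=
  ∑ j, ∑ k, if (j, k) ≠ (i, i) then (α i j k : ℂ) • waveProd s hs c A j k τ t else 0

section source

variable {s : ℝ} (hs : 1 / 2 < s) (c : Fin 4 → ℝ) (α : Fin 4 → Fin 4 → Fin 4 → ℝ)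
  {A : Fin 4 → ℝ → H}

theorem continuous_waveSource (hA : ∀ j, Continuous (A j)) (i : Fin 4) :
    Continuous (Function.uncurry (waveSource s hs c α A i)) := by
  have h1 : ∀ j, Continuous fun q : ℝ × ℝ => Phi (c j * q.2) (A j q.1) := fun j =>
    continuous_Phi.comp (f := fun q : ℝ × ℝ => (c j * q.2, A j q.1))
      ((by fun_prop : Continuous fun q : ℝ × ℝ => c j * q.2).prodMk ((hA j).comp continuous_fst))
  have h2 : Function.uncurry (waveSource s hs c α A i) = fun q : ℝ × ℝ => ∑ j, ∑ k,
      if (j, k) ≠ (i, i) then (α i j k : ℂ) • waveProd s hs c A j k q.1 q.2 else 0 := rfl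
  rw [h2]
  refine continuous_finsetSum _ fun j _ => continuous_finsetSum _ fun k _ => ?_
  split_ifs
  · exact (((algB s hs).continuous.comp ((mulW 2 zero_le_two).continuous.comp (h1 k))).clm_apply
      ((mulW 1 zero_le_one).continuous.comp (dOp.continuous.comp (h1 j)))).const_smul
      (α i j k : ℂ)
  · exact continuous_const

theorem herm_waveSource (hA : ∀ j τ, Herm (A j τ)) (i : Fin 4) (τ t : ℝ) :
    Herm (waveSource s hs c α A i τ t) := by
  refine herm_sum _ fun j _ => herm_sum _ fun k _ => ?_
  split_ifs
  · exact herm_real_smul (herm_algB hs (herm_mulW _ (herm_Phi (hA k τ) _))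
      (herm_mulW _ (herm_dOp (herm_Phi (hA j τ) _)))) _
  · exact herm_zero

theorem norm_waveSource_le (i : Fin 4) (τ t : ℝ) :
    ‖waveSource s hs c α A i τ t‖ ≤ ∑ j, ∑ k, |α i j k| * (‖algB s hs‖ *
      (‖mulW 2 zero_le_two‖ * ‖A k τ‖) * (‖mulW 1 zero_le_one‖ * (‖dOp‖ * ‖A j τ‖))) := by
  refine (norm_sum_le _ _).trans (Finset.sum_le_sum fun j _ => (norm_sum_le _ _).trans
    (Finset.sum_le_sum fun k _ => ?_))
  split_ifs
  · rw [norm_smul, Complex.norm_real, Real.norm_eq_abs]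
    refine mul_le_mul_of_nonneg_left ?_ (abs_nonneg _)
    refine ((algB s hs).le_opNorm₂ _ _).trans ?_
    have h1 := (mulW 2 zero_le_two).le_opNorm (Phi (c k * t) (A k τ))
    have h2 := (mulW 1 zero_le_one).le_opNorm (dOp (Phi (c j * t) (A j τ)))
    have h3 := dOp.le_opNorm (Phi (c j * t) (A j τ))
    rw [norm_Phi_apply] at h1 h3
    have h4 := h2.trans (mul_le_mul_of_nonneg_left h3 (norm_nonneg _))
    gcongr
  · rw [norm_zero]
    positivity

end source

variable {P : SymmSystem} {e : Fin 4 → Fin 4 → ℝ}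

/-- By orthonormality for S₀, recombining amplitudes along the eigenvectors inverts the four
pairings. A corrector can therefore be prescribed through its four scalar components. -/
theorem pair_sum_smul (he : P.IsEigenbasis e) (w : Fin 4 → L2) (i : Fin 4) :
    P.pair (e i) (fun l => ∑ k, e k l • w k) = w i := by
  unfold SymmSystem.pair
  simp only [Finset.smul_sum, smul_smul]
  rw [Finset.sum_comm]
  simp only [← Finset.sum_smul]
  have h : ∀ k, ∑ l, (e i ᵥ* P.S0) l * e k l = if i = k then 1 else 0 := fun k => by
    rw [← he.2 i k, Matrix.dotProduct_mulVec]
    rfl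
  simp [h]

/-- Each component is a Duhamel integral of the quadratic interactions, which are in `Hˢ` because
both `u_k` and `∂ₓ u_j` are, plus explicit profile terms which account for the linear sources. Only
the continuity of the `u i` in `Hˢ⁺²` matters, not the equations they satisfy: τ is a parameter. -/
theorem exists_isStrongCorrector (he : P.IsEigenbasis e) {s T : ℝ} (hs : 1 / 2 < s) (hT : 0 < T)
    {u : Fin 4 → ℝ → L2} (hu : ∀ i, ContinuousInH (s + 2) (u i) (Icc 0 T)) :
    ∃ U1 : ℝ → ℝ → Fin 4 → L2, IsStrongCorrector P e s T u U1 ∧ U1 0 0 = 0 ∧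
      ∃ C : ℝ, ∀ τ ∈ Icc 0 T, ∀ t : ℝ, hNormVec s (U1 τ t) ≤ ENNReal.ofReal (C * (1 + |t|)) := by
  have hs0 : 0 ≤ s := by linarith
  -- Composition with the projection onto `[0, T]` extends the profiles continuously to all τ, so
  -- that they can be treated as functions on the whole plane.
  set p : ℝ → ℝ := fun τ => projIcc 0 T hT.le τ with hp
  have hpm : ∀ τ, p τ ∈ Icc 0 T := fun τ => (projIcc 0 T hT.le τ).2
  have hpe : ∀ τ ∈ Icc 0 T, p τ = τ := fun τ hτ => by rw [hp]; simp [projIcc_of_mem hT.le hτ]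
  set A : Fin 4 → ℝ → H := fun j τ => toH fun ξ => (wgt (s + 2) ξ : ℂ) * hat (u j (p τ)) ξ with hAdef
  have hA : ∀ j, Continuous (A j) := fun j =>
    (continuousInH_iff.1 (hu j)).2.comp_continuous
      (continuous_subtype_val.comp continuous_projIcc) hpm
  have hAr' : ∀ j τ, IsHRep (s + 2) (toDist (u j (p τ))) (A j τ) := fun j τ =>
    isHRep_toH ((hu j).1 _ (hpm τ))
  have hAr : ∀ j, ∀ τ ∈ Icc 0 T, IsHRep (s + 2) (toDist (u j τ)) (A j τ) := fun j τ hτ => by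
    have := hAr' j τ
    rwa [hpe τ hτ] at this
  have hAh : ∀ j τ, Herm (A j τ) := fun j τ =>
    ((Herm.wgt _).mul (herm_hat _)).congr (isHRep_toDist_iff.1 (hAr' j τ)).symm
  -- Since cⱼ ≠ cᵢ, the operator ∂ₜ + cᵢ∂ₓ maps ∂ₓ²uⱼ(x − cⱼt), multiplied by βᵢⱼ/(cᵢ − cⱼ), to
  -- βᵢⱼ∂ₓ³uⱼ(x − cⱼt). The corrector contains only second derivatives, which are in `Hˢ`, and these
  -- sources need no integration in time.
  set γ : Fin 4 → Fin 4 → ℝ := fun i j => if j ≠ i then P.beta e i j / (P.c i - P.c j) else 0 with hγ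
  set b : Fin 4 → ℝ → H := fun j τ => dOp (dOp (A j τ)) with hbdef
  have hb : ∀ j, Continuous (b j) := fun j =>
    dOp.continuous.comp (dOp.continuous.comp (hA j))
  have hbh : ∀ j τ, Herm (b j τ) := fun j τ => herm_dOp (herm_dOp (hAh j τ))
  set K := waveSource s hs P.c (P.alpha e) A with hK
  have hKc : ∀ i, Continuous (Function.uncurry (K i)) := continuous_waveSource hs _ _ hA
  set Y : Fin 4 → ℝ → ℝ → H := fun i => transportSol (P.c i) P.c (γ i) (K i) b with hY
  have hYc : ∀ i, Continuous fun q : ℝ × ℝ => Y i q.1 q.2 := fun i =>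
    continuous_transportSol _ _ _ (hKc i) hb
  set w : ℝ → ℝ → Fin 4 → L2 := fun τ t i => ofHat (mulW s hs0 (Y i τ t)) with hw
  have hwr : ∀ τ t i, IsHRep s (toDist (w τ t i)) (Y i τ t) := fun τ t i =>
    isHRep_ofHat hs0 (herm_transportSol _ _ _ (hKc i) (herm_waveSource hs _ _ hAh i) hbh τ t)
  set U1 : ℝ → ℝ → Fin 4 → L2 := fun τ t l => ∑ k, e k l • w τ t k with hU1
  have hUr : ∀ τ t l, IsHRep s (toDist (U1 τ t l)) (∑ k, (e k l : ℂ) • Y k τ t) := fun τ t l =>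
    isHRep_sum_smul (fun k => e k l) fun k => hwr τ t k
  have hpair : ∀ τ t i, P.pair (e i) (U1 τ t) = w τ t i := fun τ t i => pair_sum_smul he _ i
  refine ⟨U1, ⟨fun l => ?_, fun τ hτ t i => ?_⟩, ?_, ?_⟩
  · refine continuousInH_of_isHRep (fun q _ => hUr q.1 q.2 l) (Continuous.continuousOn ?_)
    exact continuous_finsetSum _ fun k _ => (hYc k).const_smul (e k l : ℂ)
  · simp only [hpair]
    refine hasDerivInH_of_isHRep (fun t => (hwr τ t i).lower zero_le_one rfl) ?_
      (hasDerivAt_transportSol _ _ _ (hKc i) hb τ t)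
    have hAt : ∀ j, IsHRep (s + 2) (toDist (transl (P.c j * t) (u j τ))) (Phi (P.c j * t) (A j τ)) :=
      fun j => (hAr j τ hτ).transl _
    refine IsHRep.add (IsHRep.sub ?_ (IsHRep.lower ?_ zero_le_one rfl)) ?_
    · rw [neg_smul]
      exact (((hwr τ t i).dx rfl).smul _).neg
    · refine IsHRep.sum _ fun j _ => IsHRep.sum _ fun k _ => ((IsHRep.mulDist hs ?_ ?_).smul _).ite
      · exact (hAt k).lower zero_le_two (by ring)
      · exact ((hAt j).weakDeriv (by linarith) rfl).lower zero_le_one (by ring)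
    · refine IsHRep.sum _ fun j _ => ?_
      have h1 := ((((hAt j).dx rfl).dx rfl).dx (r' := s - 1) (by ring)).smul (P.beta e i j : ℂ)
      have h2 : ((γ i j * (P.c i - P.c j) : ℝ) : ℂ) • dOp (Phi (P.c j * t) (b j τ))
          = if j ≠ i then (P.beta e i j : ℂ) • dOp (dOp (dOp (Phi (P.c j * t) (A j τ)))) else 0 := by
        simp only [hγ, hbdef, Phi_dOp]
        split_ifs with hj
        · rw [div_mul_cancel₀ _ (sub_ne_zero.2 fun h => hj (P.c_injective h).symm)]
        · simp
      rw [h2]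
      exact h1.ite
  · funext l
    simp only [hU1, hw, hY, transportSol_zero, map_zero, smul_zero, Finset.sum_const_zero,
      Pi.zero_apply]
  · set k : Fin 4 → ℝ → ℝ := fun i τ => ∑ j, ∑ k, |P.alpha e i j k| * (‖algB s hs‖ *
      (‖mulW 2 zero_le_two‖ * ‖A k τ‖) * (‖mulW 1 zero_le_one‖ * (‖dOp‖ * ‖A j τ‖))) with hk
    set B : ℝ → ℝ := fun τ => ∑ j, ‖b j τ‖ with hB
    have hk0 : ∀ i τ, 0 ≤ k i τ := fun i τ => by positivity
    have hB0 : ∀ τ, 0 ≤ B τ := fun τ => by positivity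
    -- A continuous function of τ alone that bounds the coefficient of `1 + |t|` in all components.
    -- Compactness of `[0, T]` makes the bound uniform.
    set g : ℝ → ℝ := fun τ => ∑ l, ∑ i, |e i l| * (k i τ + ∑ j, |γ i j| * (2 * B τ)) with hg
    have hgc : Continuous g := by
      have := fun j => (hA j).norm
      have := fun j => (hb j).norm
      fun_prop
    obtain ⟨M, hM⟩ := isCompact_Icc.exists_bound_of_continuousOn (s := Icc 0 T) hgc.continuousOn
    refine ⟨2 * M, fun τ hτ t => ?_⟩
    have ht : 0 ≤ |t| := abs_nonneg t
    rw [mul_assoc, ENNReal.ofReal_mul zero_le_two, ENNReal.ofReal_ofNat]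
    refine hNormVec_le fun l => ?_
    rw [(hUr τ t l).hNorm_eq, ← ofReal_norm]
    refine ENNReal.ofReal_le_ofReal ?_
    calc ‖∑ i, (e i l : ℂ) • Y i τ t‖ ≤ ∑ i, |e i l| * ‖Y i τ t‖ := by
          refine (norm_sum_le _ _).trans_eq (Finset.sum_congr rfl fun i _ => ?_)
          rw [norm_smul, Complex.norm_real, Real.norm_eq_abs]
      _ ≤ ∑ i, |e i l| * (k i τ + ∑ j, |γ i j| * (2 * B τ)) * (1 + |t|) := by
          refine Finset.sum_le_sum fun i _ => ?_
          rw [mul_assoc]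
          refine mul_le_mul_of_nonneg_left ?_ (abs_nonneg _)
          have h1 := norm_transportSol_le (K := K i) (b := b) (t := t) (P.c i) P.c (γ i)
            (norm_waveSource_le hs P.c (P.alpha e) i τ)
            fun j => Finset.single_le_sum (f := fun j => ‖b j τ‖) (fun _ _ => norm_nonneg _)
              (Finset.mem_univ j)
          have h2 : 0 ≤ ∑ j, |γ i j| * (2 * B τ) :=
            Finset.sum_nonneg fun j _ => mul_nonneg (abs_nonneg _) (by linarith [hB0 τ])
          refine h1.trans ?_
          nlinarith [hk0 i τ, mul_nonneg h2 ht]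
      _ = (∑ i, |e i l| * (k i τ + ∑ j, |γ i j| * (2 * B τ))) * (1 + |t|) := by
          rw [Finset.sum_mul]
      _ ≤ g τ * (1 + |t|) := by
          refine mul_le_mul_of_nonneg_right ?_ (by positivity)
          refine Finset.single_le_sum
            (f := fun l => ∑ i, |e i l| * (k i τ + ∑ j, |γ i j| * (2 * B τ)))
            (fun l _ => Finset.sum_nonneg fun i _ => mul_nonneg (abs_nonneg _)
              (add_nonneg (hk0 i τ) (Finset.sum_nonneg fun j _ =>
                mul_nonneg (abs_nonneg _) (by linarith [hB0 τ])))) (Finset.mem_univ l)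
      _ ≤ M * (1 + |t|) :=
          mul_le_mul_of_nonneg_right ((le_abs_self _).trans (hM τ hτ)) (by positivity)

/-! ### The initial values -/

/-- Cauchy–Schwarz for the scalar product u · S₀v, applied to the unit vector eᵢ and the l-th
coordinate vector. -/
theorem sq_vecMul_le (he : P.IsEigenbasis e) (i l : Fin 4) : (e i ᵥ* P.S0) l ^ 2 ≤ P.S0 l l := by
  set δ : Fin 4 → ℝ := Pi.single l 1 with hδ
  set p := (e i ᵥ* P.S0) l with hp
  set q := P.S0 l l with hq
  have h0 : 0 < q := P.S0_posDef.diag_pos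
  have h1 : e i ⬝ᵥ (P.S0 *ᵥ δ) = p := by
    rw [Matrix.dotProduct_mulVec, hδ, dotProduct_single, mul_one]
  have h2 : δ ⬝ᵥ (P.S0 *ᵥ e i) = p := by
    rw [hδ, single_dotProduct, one_mul, hp, ← Matrix.mulVec_transpose, P.S0_symm.eq]
  have h3 : δ ⬝ᵥ (P.S0 *ᵥ δ) = q := by
    simp [hδ, hq]
  have h4 : e i ⬝ᵥ (P.S0 *ᵥ e i) = 1 := by simpa using he.2 i i
  -- At this vector the quadratic form equals q² − qp², and q > 0.
  have h5 := P.S0_posDef.posSemidef.dotProduct_mulVec_nonneg (q • e i - p • δ)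
  rw [star_trivial] at h5
  simp only [Matrix.mulVec_sub, Matrix.mulVec_smul, sub_dotProduct, dotProduct_sub,
    smul_dotProduct, dotProduct_smul, h1, h2, h3, h4, smul_eq_mul] at h5
  by_contra! h6
  nlinarith

theorem diag_le_opNorm (M : Matrix (Fin 4) (Fin 4) ℝ) (l : Fin 4) : M l l ≤ opNorm M := by
  have h1 := (Matrix.toEuclideanCLM (𝕜 := ℝ) M).le_opNorm (EuclideanSpace.single l 1)
  rw [PiLp.norm_single, norm_one, mul_one] at h1
  have h2 := PiLp.norm_apply_le (WithLp.toLp 2 (M *ᵥ Pi.single l 1)) l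
  have h3 : (M *ᵥ Pi.single l 1) l = M l l := by simp
  rw [PiLp.toLp_apply, h3] at h2
  exact (le_abs_self _).trans (h2.trans h1)

/-- The pairing combines four components with coefficients of modulus at most √‖S₀‖, because eᵢ is
normalized for S₀. -/
theorem pair_bound (he : P.IsEigenbasis e) {r : ℝ} {U0 : Fin 4 → L2}
    (hU : ∀ j, MemSobolev r 2 (toDist (U0 j))) (i : Fin 4) :
    MemSobolev r 2 (toDist (P.pair (e i) U0)) ∧ hNorm r (toDist (P.pair (e i) U0))
      ≤ ENNReal.ofReal (4 * √(opNorm P.S0)) * hNormVec r U0 := by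
  have h := isHRep_sum_smul (fun l => (e i ᵥ* P.S0) l) fun l => isHRep_toH (hU l)
  refine ⟨h.memSobolev, ?_⟩
  change hNorm r (toDist (∑ l, (e i ᵥ* P.S0) l • U0 l)) ≤ _
  rw [h.hNorm_eq]
  refine (enorm_sum_le _ _).trans ?_
  have h1 : ∀ l, ‖(((e i ᵥ* P.S0) l : ℝ) : ℂ) • toH fun ξ => (wgt r ξ : ℂ) * hat (U0 l) ξ‖ₑ
      ≤ ENNReal.ofReal √(opNorm P.S0) * hNormVec r U0 := by
    intro l
    rw [enorm_smul, ← (isHRep_toH (hU l)).hNorm_eq]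
    refine mul_le_mul' ?_ (hNorm_le_hNormVec r U0 l)
    rw [← ofReal_norm, Complex.norm_real]
    exact ENNReal.ofReal_le_ofReal (Real.abs_le_sqrt ((sq_vecMul_le he i l).trans
      (diag_le_opNorm _ l)))
  refine (Finset.sum_le_sum fun l _ => h1 l).trans_eq ?_
  rw [Finset.sum_const, ENNReal.ofReal_mul (by norm_num)]
  simp [mul_assoc]

end KdVApprox

end

theorem proposition3p2 :
    ∃ C₀ : ℝ → ℝ → ℝ, (∀ a b, 0 < C₀ a b) ∧
      (∀ a a' b b', a ≤ a' → b ≤ b' → C₀ a b ≤ C₀ a' b') ∧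
      ∀ (P : KdVApprox.SymmSystem) (e : Fin 4 → Fin 4 → ℝ), P.IsEigenbasis e →
      ∀ (s : ℝ), 1 / 2 < s →
      ∀ (U0 : Fin 4 → KdVApprox.L2), (∀ j, MemSobolev (s + 2) 2 (KdVApprox.toDist (U0 j))) →
        -- uniqueness of strong solutions of the Cauchy problems, on any time interval
        (∀ i, ∀ T' : ℝ, 0 < T' → ∀ v w : ℝ → KdVApprox.L2,
          KdVApprox.IsStrongKdVSolution (s + 2) (P.lam e i) (P.mu e i) T' (P.pair (e i) U0) v →
          KdVApprox.IsStrongKdVSolution (s + 2) (P.lam e i) (P.mu e i) T' (P.pair (e i) U0) w →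
          ∀ τ ∈ Icc 0 T', v τ = w τ) ∧
        ∃ T : ℝ, 0 < T ∧ ∃ u : Fin 4 → ℝ → KdVApprox.L2,
          -- existence of strong solutions on `[0, T]`
          (∀ i, KdVApprox.IsStrongKdVSolution (s + 2) (P.lam e i) (P.mu e i) T
            (P.pair (e i) U0) (u i)) ∧
          -- the estimate in `L^∞([0, T]; H^{s+2})`
          ∑ i, ⨆ τ ∈ Icc 0 T, KdVApprox.hNorm (s + 2) (KdVApprox.toDist (u i τ)) ≤
            ENNReal.ofReal (C₀ (KdVApprox.opNorm P.S0) (KdVApprox.opNorm P.S0⁻¹)) *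
              KdVApprox.hNormVec (s + 2) U0 ∧
          -- existence of the corrector
          ∃ U1 : ℝ → ℝ → Fin 4 → KdVApprox.L2,
            KdVApprox.IsStrongCorrector P e s T u U1 ∧ U1 0 0 = 0 ∧
            ∃ C : ℝ, ∀ τ ∈ Icc 0 T, ∀ t : ℝ,
              KdVApprox.hNormVec s (U1 τ t) ≤ ENNReal.ofReal (C * (1 + |t|)) := by
  -- 32 = 4 · 2 · 4: four solutions, each bounded by twice its initial value, which is a combination
  -- of four components with coefficients at most √‖S₀‖. The summand 1 keeps the constant positive.
  refine ⟨fun a _ => 32 * (1 + √a), fun a _ => by positivity, fun a a' _ _ h _ => ?_, ?_⟩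
  · have := Real.sqrt_le_sqrt h
    dsimp only
    linarith
  intro P e he s hs U0 hU0
  have hr : 5 / 2 < s + 2 := by linarith
  refine ⟨fun i T' _ v w hv hw => KdVApprox.IsStrongKdVSolution.unique hr hv hw, ?_⟩
  have hpair := fun i => KdVApprox.pair_bound he hU0 i
  choose T hT u hu hbound using fun i =>
    KdVApprox.exists_isStrongKdVSolution hr (P.lam e i) (P.mu e i) (hpair i).1
  -- The common interval is given by the shortest of the four existence times.
  obtain ⟨i₀, -, hi₀⟩ := Finset.exists_min_image Finset.univ T Finset.univ_nonempty
  have hle : ∀ i, T i₀ ≤ T i := fun i => hi₀ i (Finset.mem_univ i)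
  have hsol := fun i => (hu i).mono hr (hle i)
  refine ⟨T i₀, hT i₀, u, hsol, ?_,
    KdVApprox.exists_isStrongCorrector he hs (hT i₀) fun i => (hsol i).continuous⟩
  set N := KdVApprox.hNormVec (s + 2) U0
  have h1 : ∀ i, ⨆ τ ∈ Icc 0 (T i₀), KdVApprox.hNorm (s + 2) (KdVApprox.toDist (u i τ))
      ≤ ENNReal.ofReal (8 * √(KdVApprox.opNorm P.S0)) * N := fun i => by
    refine iSup₂_le fun τ hτ => (hbound i τ ⟨hτ.1, hτ.2.trans (hle i)⟩).trans ?_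
    refine (mul_le_mul_right (hpair i).2 2).trans_eq ?_
    rw [← mul_assoc, ← ENNReal.ofReal_ofNat 2, ← ENNReal.ofReal_mul zero_le_two]
    ring_nf
  refine (Finset.sum_le_sum fun i _ => h1 i).trans ?_
  rw [← Finset.sum_mul]
  refine mul_le_mul_left ?_ N
  rw [← ENNReal.ofReal_sum_of_nonneg fun _ _ => by positivity]
  refine ENNReal.ofReal_le_ofReal ?_
  rw [Finset.sum_const, Finset.card_univ, Fintype.card_fin, nsmul_eq_mul]
  push_cast
  linarith [Real.sqrt_nonneg (KdVApprox.opNorm P.S0)]
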